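/- **Setting.** Let $\mu$ be a probability measure on $\mathcal X$ and let $(e_j)_{j\ge1}$ be an orthonormal basis of $L^2(\mathcal X,\mu)$ with $\sup_j\|e_j\|_\infty<\infty$. Let $\lambda_j\asymp j^{-\gamma}$ with $\gamma>1$. Let $f^*=\sum_j\theta_j^*e_j\in L^2(\mu)$, and let $(x_i,y_i)_{i\le n}$ be i.i.d. with $x_i\sim\mu$ and $y_i=f^*(x_i)+\varepsilon_i$, where, given $x_i$, the noise $\varepsilon_i$ has mean zero and is $\sigma^2$-sub-Gaussian. (Here $\asymp$ means equality of order up to positive constant factors.) **Estimator.** Fix an integer $D\ge0$ (the number of extra layers). For parameters $a=(a_j)$, $b=(b_j)$, $\beta=(\beta_j)$ put $f_{a,b,\beta}(x)=\sum_j a_jb_j^D\beta_j\,e_j(x)$ and $\mathcal L_n(f)=\frac1{2n}\sum_{i=1}^n(y_i-f(x_i))^2$. Consider the gradient flow $$\dot a=-\nabla_a\mathcal L_n,\quad \dot b=-\nabla_b\mathcal L_n,\quad \dot\beta=-\nabla_\beta\mathcal L_n,\qquad a_j(0)=\lambda_j^{1/2},\quad b_j(0)=b_0,\quad \beta(0)=0,$$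 with $a(t),\beta(t)$ continuous curves in $\ell^2$ and $b(t)$ a continuous curve in $\ell^\infty$ (for $D=0$ the parameter $b$ plays no role). Let $\hat f_t^{\mathrm{EigGD},D}=f_{a(t),b(t),\beta(t)}$. **Misalignment model.** Let $p>0$ and $q\ge1$. There is an injective index sequence $\ell$ listing the coefficients in descending order, $|\theta^*_{\ell(1)}|\ge|\theta^*_{\ell(2)}|\ge\dots$, with $\theta^*_k=0$ for indices $k$ outside its range, and $$|\theta^*_{\ell(j)}|\asymp j^{-(p+1)/2},\qquad \ell(j)\asymp j^q .$$ Assume moreover that for some constants $s_0,B>0$ one has $\#\{j:|\theta_j^*|\ge\delta\}\le B\,\delta^{-(1-s_0)}$ for all $\delta>0$ (in this model this means $p>1$). **Corollary.** Suppose $\gamma>\frac{p+1}{D+2}$. Choose $b_0=b_0(n)\asymp n^{-\frac1{2(D+2)}}$ (if $D\ne0$) and $t=t(n)\asymp n^{\frac{D+1}{D+2}}$. Then, for every $n$, the gradient flow almost surely exists for all times $t \ge 0$, and $$\big\|f^*-\hat f^{\mathrm{EigGD},D}_{t}\big\|_{L^2(\mu)}^2=\tilde O_{\mathbb P}\big(n^{-\frac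 p{p+1}}\big),$$ that is, for some $L$ the left-hand side divided by $n^{-p/(p+1)}(\ln n)^L$ is bounded in probability as $n\to\infty$. The rate does not depend on $q$. -/

import Mathlib

open MeasureTheory ProbabilityTheory Filter Topology
open scoped ENNReal NNReal

noncomputable section

namespace AdaptiveKernel

/- Conventions. Sequences indexed by `j = 1, 2, …` on paper are indexed by `ℕ` here, the entry
`j : ℕ` standing for the paper index `j + 1`. The sequence spaces are Mathlib's `lp`. -/

/-- `u ≍ v` along the filter `l`: `c v ≤ u ≤ C v` for some constants `c, C > 0`
(`l = ⊤`: for all indices; `l = atTop`: for all large indices). -/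
def SameOrder (l : Filter ℕ) (u v : ℕ → ℝ) : Prop :=
  ∃ c > 0, ∃ C > 0, ∀ᶠ j in l, c * v j ≤ u j ∧ u j ≤ C * v j

/-- `Z_n = Õ_P(r_n)`: for some power `L` of the logarithm, `Z_n / (r_n (log n) ^ L)` is bounded
in probability as `n → ∞`. -/
def IsTildeBigOP {Ω : Type*} [MeasurableSpace Ω] (P : Measure Ω)
    (Z : ℕ → Ω → ℝ≥0∞) (r : ℕ → ℝ) : Prop :=
  ∃ L : ℕ, ∀ ε : ℝ, 0 < ε → ∃ M : ℝ, 0 < M ∧ ∀ᶠ n : ℕ in atTop,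
    P {ω | ENNReal.ofReal (M * (Real.log n ^ L * r n)) < Z n ω} ≤ ENNReal.ofReal ε

section Model

variable {X : Type*} [MeasurableSpace X]

/-- The functions `e_j` form an orthonormal basis of the real Hilbert space `L²(X, μ)`. -/
def IsOrthonormalBasis (μ : Measure X) (e : ℕ → X → ℝ) : Prop :=
  ∃ B : HilbertBasis ℕ ℝ (Lp ℝ 2 μ), ∀ j, (B j : X → ℝ) =ᵐ[μ] e j

/-- The assumption on the eigensystem: `(e_j)` is an orthonormal basis of `L²(X, μ)` which is
uniformly bounded, and `λ_j ≍ j^{-γ}` with `γ > 1`. -/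
structure EigenSystem (μ : Measure X) (e : ℕ → X → ℝ) (lam : ℕ → ℝ) (γ : ℝ) : Prop where
  basis : IsOrthonormalBasis μ e
  bounded : ∃ C : ℝ, ∀ j, ∀ᵐ x ∂μ, |e j x| ≤ C
  one_lt : 1 < γ
  decay : SameOrder ⊤ lam (fun j => ((j : ℝ) + 1) ^ (-γ))

/-- The coefficient `θ*_j = ⟨f*, e_j⟩` of the truth function, so that `f* = ∑ θ*_j e_j`
in `L²(X, μ)`. -/
def coeff (μ : Measure X) (e : ℕ → X → ℝ) (fstar : X → ℝ) (j : ℕ) : ℝ :=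
  ∫ x, fstar x * e j x ∂μ

/-- The misalignment model: an index sequence `ℓ` lists the coefficients in descending order of
`|θ_{ℓ(j)}|` (each index at most once, the indices left out having coefficient zero), with
`|θ_{ℓ(j)}| ≍ j^{-(p+1)/2}` and `ℓ(j) ≍ j^q`. -/
def Misaligned (θ : ℕ → ℝ) (p q : ℝ) : Prop :=
  ∃ ℓ : ℕ → ℕ, Function.Injective ℓ ∧
    Antitone (fun j => |θ (ℓ j)|) ∧
    (∀ k, k ∉ Set.range ℓ → θ k = 0) ∧
    SameOrder ⊤ (fun j => |θ (ℓ j)|) (fun j => ((j : ℝ) + 1) ^ (-(p + 1) / 2)) ∧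
    SameOrder ⊤ (fun j => (ℓ j : ℝ) + 1) (fun j => ((j : ℝ) + 1) ^ q)

/-- The decay (summability) condition on the truth coefficients: the number `Φ(δ)` of indices with
`|θ_j| ≥ δ` is finite and at most `B δ^{-(1 - s₀)}`, for some constants `s₀, B > 0`. -/
def FastDecay (θ : ℕ → ℝ) : Prop :=
  ∃ s₀ > (0 : ℝ), ∃ B > (0 : ℝ), ∀ δ > (0 : ℝ),
    {j | δ ≤ |θ j|}.Finite ∧ (({j | δ ≤ |θ j|}.ncard : ℕ) : ℝ) ≤ B * δ ^ (-(1 - s₀))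

/-- The noise: `κ x` is the law of `ε` given the input `x` (a constant kernel if the noise is
independent of the input). Given the input, `ε` is `σ²`-sub-Gaussian, that is
`E[exp (s ε) | x] ≤ exp (σ² s² / 2)` for all real `s`, which contains `E[ε | x] = 0`. -/
def IsSubGaussianNoise (μ : Measure X) (κ : Kernel X ℝ) (σ : ℝ≥0) : Prop :=
  ∀ᵐ x ∂μ, HasSubgaussianMGF (fun z : ℝ => z) (σ ^ 2) (κ x)

/-- The pairs `(x_i, ε_i)` are i.i.d., with `x_i ∼ μ` and `ε_i` given `x_i` of law `κ x_i`. -/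
structure IsSample {Ω : Type*} [MeasurableSpace Ω] (P : Measure Ω) (μ : Measure X)
    (κ : Kernel X ℝ) (x : ℕ → Ω → X) (ε : ℕ → Ω → ℝ) : Prop where
  indep : iIndepFun (fun i ω => (x i ω, ε i ω)) P
  law : ∀ i, HasLaw (fun ω => (x i ω, ε i ω)) (μ ⊗ₘ κ) P

end Model

section GradientFlow

variable {X : Type*}

/-- The empirical loss `L_n(f) = (2n)⁻¹ ∑_i (y_i - f(x_i))²`. -/
def empLoss {n : ℕ} (x : Fin n → X) (y : Fin n → ℝ) (f : X → ℝ) : ℝ :=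
  1 / (2 * n) * ∑ i, (y i - f (x i)) ^ 2

/-- The predictor `f(x) = ⟨Φ_{a,b}(x), β⟩` with feature map `Φ_{a,b}(x) = (a_j b_j^D e_j(x))_j`.
For `D = 0` this is the feature map `Φ_a(x) = (a_j e_j(x))_j`. -/
def predictor (e : ℕ → X → ℝ) (D : ℕ) (a b β : ℕ → ℝ) (x : X) : ℝ :=
  ∑' j, a j * b j ^ D * e j x * β j

/-- The empirical loss as a function of the parameters `a`, `b`, `β`. -/
def paramLoss (e : ℕ → X → ℝ) (D : ℕ) {n : ℕ} (x : Fin n → X) (y : Fin n → ℝ)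
    (a b β : ℕ → ℝ) : ℝ :=
  empLoss x y (predictor e D a b β)

/-- The partial derivative of `F` in the `j`-th coordinate at `u`. -/
def partialDeriv (F : (ℕ → ℝ) → ℝ) (u : ℕ → ℝ) (j : ℕ) : ℝ :=
  deriv (fun s => F (Function.update u j s)) (u j)

/-- `(a, b, β)` solves, for all times `t ≥ 0`, the gradient flow of the empirical loss in all
parameters, with `a_j(0) = λ_j^{1/2}`, `b_j(0) = b₀` and `β(0) = 0`. The parameters `a(t)`, `β(t)`
are continuous curves in `ℓ²`, and `b(t)` is a continuous curve in `ℓ^∞` (it starts at a constant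
sequence). For `D = 0` the loss does not depend on `b`, so that this is the gradient flow in
`(a, β)` alone, for the feature map `Φ_a`. -/
structure IsGradientFlow (e : ℕ → X → ℝ) (lam : ℕ → ℝ) (D : ℕ) (b₀ : ℝ) {n : ℕ}
    (x : Fin n → X) (y : Fin n → ℝ)
    (a : ℝ → lp (fun _ : ℕ => ℝ) 2) (b : ℝ → lp (fun _ : ℕ => ℝ) ∞)
    (β : ℝ → lp (fun _ : ℕ => ℝ) 2) : Prop where
  init_a : ∀ j, a 0 j = √(lam j)
  init_b : ∀ j, b 0 j = b₀
  init_β : ∀ j, β 0 j = 0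
  cont_a : ContinuousOn a (Set.Ici 0)
  cont_b : ContinuousOn b (Set.Ici 0)
  cont_β : ContinuousOn β (Set.Ici 0)
  flow_a : ∀ t, 0 ≤ t → ∀ j, HasDerivWithinAt (fun s => a s j)
    (-partialDeriv (fun u => paramLoss e D x y u (b t) (β t)) (a t) j) (Set.Ici 0) t
  flow_b : ∀ t, 0 ≤ t → ∀ j, HasDerivWithinAt (fun s => b s j)
    (-partialDeriv (fun u => paramLoss e D x y (a t) u (β t)) (b t) j) (Set.Ici 0) t
  flow_β : ∀ t, 0 ≤ t → ∀ j, HasDerivWithinAt (fun s => β s j)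
    (-partialDeriv (fun u => paramLoss e D x y (a t) (b t) u) (β t) j) (Set.Ici 0) t

/-- `f` is the adaptive kernel estimator computed from the data `(x_i, y_i)`: the predictor
obtained at time `t` from the gradient flow. -/
def IsEstimator (e : ℕ → X → ℝ) (lam : ℕ → ℝ) (D : ℕ) (b₀ t : ℝ) {n : ℕ}
    (x : Fin n → X) (y : Fin n → ℝ) (f : X → ℝ) : Prop :=
  ∃ a b β, IsGradientFlow e lam D b₀ x y a b β ∧ f = predictor e D (a t) (b t) (β t)

end GradientFlow

end AdaptiveKernel

end

namespace AdaptiveKernel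

/-! ### Scalar flows: one coordinate of the gradient flow, driven by an external signal -/

/-- One coordinate of the gradient flow with driving signal `g`. -/
structure ScalarFlow (D : ℕ) (lam b₀ : ℝ) (a b β g : ℝ → ℝ) : Prop where
  init_a : a 0 = √lam
  init_b : b 0 = b₀
  init_β : β 0 = 0
  deriv_a : ∀ t, 0 ≤ t → HasDerivWithinAt a (b t ^ D * β t * g t) (Set.Ici 0) t
  deriv_b : ∀ t, 0 ≤ t →
    HasDerivWithinAt b (D * a t * b t ^ (D - 1) * β t * g t) (Set.Ici 0) t
  deriv_β : ∀ t, 0 ≤ t → HasDerivWithinAt β (a t * b t ^ D * g t) (Set.Ici 0) t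

/-- If a continuous function starts below `c`, and stays below `c` at each time up to which it has
been below `c`, then it is below `c` throughout. -/
theorem forall_lt_of_continuousOn_of_bootstrap {V : ℝ → ℝ} {T c : ℝ}
    (hV : ContinuousOn V (Set.Icc 0 T))
    (hstep : ∀ t ∈ Set.Icc 0 T, (∀ s ∈ Set.Ico 0 t, V s < c) → V t < c) :
    ∀ t ∈ Set.Icc 0 T, V t < c := by
  by_contra! hcon
  obtain ⟨t, ht, hct⟩ := hcon
  have hcl : IsClosed (Set.Icc 0 T ∩ V ⁻¹' Set.Ici c) :=
    hV.preimage_isClosed_of_isClosed isClosed_Icc isClosed_Ici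
  have hcomp : IsCompact (Set.Icc 0 T ∩ V ⁻¹' Set.Ici c) :=
    isCompact_Icc.of_isClosed_subset hcl Set.inter_subset_left
  obtain ⟨s, hs, hmin⟩ := hcomp.exists_isLeast ⟨t, ht, hct⟩
  refine absurd (hstep s hs.1 fun r hr => ?_) (not_lt.2 hs.2)
  by_contra! hr'
  exact absurd (hmin ⟨⟨hr.1, hr.2.le.trans hs.1.2⟩, hr'⟩) (not_le.2 hr.2)

theorem eq_of_hasDerivWithinAt_Ici_zero {f : ℝ → ℝ}
    (hf : ∀ t, 0 ≤ t → HasDerivWithinAt f 0 (Set.Ici 0) t) {t : ℝ} (ht : 0 ≤ t) : f t = f 0 :=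
  constant_of_has_deriv_right_zero (a := 0) (b := t)
    (fun s hs => ((hf s hs.1).continuousWithinAt).mono Set.Icc_subset_Ici_self)
    (fun s hs => (hf s hs.1).mono (Set.Ici_subset_Ici.2 hs.1)) t ⟨ht, le_rfl⟩

theorem pos_of_continuousOn_of_ne_zero {f : ℝ → ℝ} (hf : ContinuousOn f (Set.Ici 0)) (h0 : 0 < f 0)
    (hne : ∀ t, 0 ≤ t → f t ≠ 0) {t : ℝ} (ht : 0 ≤ t) : 0 < f t := by
  by_contra! hneg
  obtain ⟨s, hs, hs0⟩ := intermediate_value_Icc' ht (hf.mono Set.Icc_subset_Ici_self)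
    ⟨hneg, h0.le⟩
  exact hne s hs.1 hs0

namespace ScalarFlow

variable {D : ℕ} {lam b₀ : ℝ} {a b β g : ℝ → ℝ}

theorem continuousOn_a (h : ScalarFlow D lam b₀ a b β g) : ContinuousOn a (Set.Ici 0) :=
  fun t ht => (h.deriv_a t ht).continuousWithinAt

theorem continuousOn_b (h : ScalarFlow D lam b₀ a b β g) : ContinuousOn b (Set.Ici 0) :=
  fun t ht => (h.deriv_b t ht).continuousWithinAt

theorem continuousOn_β (h : ScalarFlow D lam b₀ a b β g) : ContinuousOn β (Set.Ici 0) :=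
  fun t ht => (h.deriv_β t ht).continuousWithinAt

theorem neg (h : ScalarFlow D lam b₀ a b β g) :
    ScalarFlow D lam b₀ a b (fun t => -β t) (fun t => -g t) where
  init_a := h.init_a
  init_b := h.init_b
  init_β := by simp [h.init_β]
  deriv_a t ht := (h.deriv_a t ht).congr_deriv (by ring)
  deriv_b t ht := (h.deriv_b t ht).congr_deriv (by ring)
  deriv_β t ht := ((h.deriv_β t ht).neg).congr_deriv (by ring)

/-- Without extra layers the parameter `b` plays no role. -/
theorem change_b (h : ScalarFlow 0 lam b₀ a b β g) (b₁ : ℝ) :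
    ScalarFlow 0 lam b₁ a (fun _ => b₁) β g where
  init_a := h.init_a
  init_b := rfl
  init_β := h.init_β
  deriv_a t ht := (h.deriv_a t ht).congr_deriv (by simp)
  deriv_b t ht := (hasDerivWithinAt_const t _ b₁).congr_deriv (by simp)
  deriv_β t ht := (h.deriv_β t ht).congr_deriv (by simp)

theorem sq_a (h : ScalarFlow D lam b₀ a b β g) (hl : 0 ≤ lam) {t : ℝ} (ht : 0 ≤ t) :
    a t ^ 2 = lam + β t ^ 2 := by
  have := eq_of_hasDerivWithinAt_Ici_zero (f := fun t => a t ^ 2 - β t ^ 2) (fun s hs =>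
    (((h.deriv_a s hs).pow 2).sub ((h.deriv_β s hs).pow 2)).congr_deriv (by push_cast; ring)) ht
  simp only [h.init_a, h.init_β, Real.sq_sqrt hl] at this
  linarith

theorem sq_b (h : ScalarFlow D lam b₀ a b β g) {t : ℝ} (ht : 0 ≤ t) :
    b t ^ 2 = b₀ ^ 2 + D * β t ^ 2 := by
  have := eq_of_hasDerivWithinAt_Ici_zero (f := fun t => b t ^ 2 - D * β t ^ 2) (fun s hs =>
    (((h.deriv_b s hs).pow 2).sub (((h.deriv_β s hs).pow 2).const_mul (D : ℝ))).congr_deriv (by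
      rcases D with _ | k
      · simp
      · push_cast [Nat.add_sub_cancel]; ring)) ht
  simp only [h.init_b, h.init_β] at this
  linarith

theorem a_pos (h : ScalarFlow D lam b₀ a b β g) (hl : 0 < lam) {t : ℝ} (ht : 0 ≤ t) : 0 < a t := by
  refine pos_of_continuousOn_of_ne_zero h.continuousOn_a ?_ (fun s hs h0 => ?_) ht
  · rw [h.init_a]; exact Real.sqrt_pos.2 hl
  · have := h.sq_a hl.le hs
    rw [h0] at this
    nlinarith [sq_nonneg (β s)]

theorem b_pos (h : ScalarFlow D lam b₀ a b β g) (hb : 0 < b₀) {t : ℝ} (ht : 0 ≤ t) : 0 < b t := by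
  refine pos_of_continuousOn_of_ne_zero h.continuousOn_b (by rwa [h.init_b]) (fun s hs h0 => ?_) ht
  have := h.sq_b hs
  rw [h0] at this
  have h2 : 0 ≤ (D : ℝ) * β s ^ 2 := by positivity
  nlinarith

theorem le_b (h : ScalarFlow D lam b₀ a b β g) (hb : 0 < b₀) {t : ℝ} (ht : 0 ≤ t) : b₀ ≤ b t := by
  have h2 : 0 ≤ (D : ℝ) * β t ^ 2 := by positivity
  exact (abs_le.1 (abs_le_of_sq_le_sq (by linarith [h.sq_b ht]) (h.b_pos hb ht).le)).2

theorem abs_β_lt_a (h : ScalarFlow D lam b₀ a b β g) (hl : 0 < lam) {t : ℝ} (ht : 0 ≤ t) :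
    |β t| < a t :=
  abs_lt_of_sq_lt_sq (by linarith [h.sq_a hl.le ht]) (h.a_pos hl ht).le

/-- The coefficient `θ = a b ^ D β` moves in the direction of the driving signal. -/
theorem hasDerivWithinAt_coeff (h : ScalarFlow D lam b₀ a b β g) (hl : 0 < lam) (hb : 0 < b₀)
    {t : ℝ} (ht : 0 ≤ t) :
    ∃ K > 0, HasDerivWithinAt (fun s => a s * b s ^ D * β s) (K * g t) (Set.Ici 0) t := by
  refine ⟨b t ^ D * b t ^ D * (β t ^ 2 + a t ^ 2) +
    (D * a t * b t ^ (D - 1) * β t) ^ 2, ?_, ?_⟩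
  · have := h.a_pos hl ht
    have := h.b_pos hb ht
    positivity
  · exact (((h.deriv_a t ht).mul ((h.deriv_b t ht).pow D)).mul (h.deriv_β t ht)).congr_deriv
      (by simp only [Pi.pow_apply, Pi.mul_apply]; ring)

theorem coeff_zero (h : ScalarFlow D lam b₀ a b β g) : a 0 * b 0 ^ D * β 0 = 0 := by
  simp [h.init_β]

theorem continuousOn_coeff (h : ScalarFlow D lam b₀ a b β g) :
    ContinuousOn (fun s => a s * b s ^ D * β s) (Set.Ici 0) :=
  (h.continuousOn_a.mul (h.continuousOn_b.pow D)).mul h.continuousOn_β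

/-- A barrier from above. -/
theorem coeff_le (h : ScalarFlow D lam b₀ a b β g) (hl : 0 < lam) (hb : 0 < b₀) {t m : ℝ}
    (ht : 0 ≤ t) (hm : 0 ≤ m)
    (hg : ∀ s ∈ Set.Ico 0 t, m < a s * b s ^ D * β s → g s < 0) : a t * b t ^ D * β t ≤ m := by
  refine le_of_forall_pos_le_add fun δ hδ => ?_
  choose! K hK hd using fun s (hs : 0 ≤ s) => h.hasDerivWithinAt_coeff hl hb hs
  refine image_le_of_deriv_right_lt_deriv_boundary (a := 0) (b := t)
    (f := fun s => a s * b s ^ D * β s) (f' := fun s => K s * g s)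
    (B := fun _ => m + δ) (B' := fun _ => 0)
    (h.continuousOn_coeff.mono Set.Icc_subset_Ici_self)
    (fun s hs => (hd s hs.1).mono (Set.Ici_subset_Ici.2 hs.1)) ?_
    (fun s => hasDerivAt_const s _) (fun s hs heq => ?_) ⟨ht, le_rfl⟩
  · rw [h.coeff_zero]; linarith
  · exact mul_neg_of_pos_of_neg (hK s hs.1) (hg s hs (by
      have heq' : a s * b s ^ D * β s = m + δ := heq
      linarith))

/-- A coefficient driven towards `c` with an error of at most `ν` never moves beyond `c` by more
than `ν`. -/
theorem abs_coeff_sub_le (h : ScalarFlow D lam b₀ a b β g) (hl : 0 < lam) (hb : 0 < b₀)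
    {t c ν : ℝ} (ht : 0 ≤ t) (hν : 0 ≤ ν)
    (hg : ∀ s ∈ Set.Ico 0 t, |g s - (c - a s * b s ^ D * β s)| ≤ ν) :
    a t * b t ^ D * β t ≤ max 0 (c + ν) ∧ |c - a t * b t ^ D * β t| ≤ |c| + ν := by
  have h1 : a t * b t ^ D * β t ≤ max 0 (c + ν) := by
    refine h.coeff_le hl hb ht (le_max_left _ _) fun s hs hlt => ?_
    have := abs_le.1 (hg s hs)
    linarith [le_max_right 0 (c + ν)]
  have h2 := h.neg.coeff_le hl hb ht (le_max_left 0 (-c + ν)) fun s hs hlt => ?_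
  · refine ⟨h1, abs_le.2 ⟨?_, ?_⟩⟩
    · rcases max_cases 0 (c + ν) with h3 | h3 <;>
        linarith [neg_abs_le c, le_abs_self c]
    · rcases max_cases 0 (-c + ν) with h3 | h3 <;>
        linarith [neg_abs_le c, le_abs_self c]
  · have := abs_le.1 (hg s hs)
    linarith [le_max_right 0 (-c + ν)]

theorem hasDerivWithinAt_add (h : ScalarFlow D lam b₀ a b β g) {t : ℝ} (ht : 0 ≤ t) :
    HasDerivWithinAt (fun s => a s + β s) (b t ^ D * g t * (a t + β t)) (Set.Ici 0) t :=
  ((h.deriv_a t ht).add (h.deriv_β t ht)).congr_deriv (by ring)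

theorem add_le (h : ScalarFlow D lam b₀ a b β g) {t κ : ℝ}
    (ht : 0 ≤ t) (hκ : ∀ s ∈ Set.Ico 0 t, |b s ^ D * g s| ≤ κ) :
    a t + β t ≤ √lam * Real.exp (κ * t) := by
  have := norm_le_gronwallBound_of_norm_deriv_right_le (f := fun s => a s + β s)
    (f' := fun s => b s ^ D * g s * (a s + β s)) (δ := √lam) (K := κ) (ε := 0) (a := 0) (b := t)
    ((h.continuousOn_a.add h.continuousOn_β).mono Set.Icc_subset_Ici_self)
    (fun s hs => (h.hasDerivWithinAt_add hs.1).mono (Set.Ici_subset_Ici.2 hs.1))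
    (by simp [h.init_a, h.init_β, abs_of_nonneg (Real.sqrt_nonneg lam)])
    (fun s hs => by
      rw [norm_mul, add_zero]
      exact mul_le_mul_of_nonneg_right (hκ s hs) (norm_nonneg _)) t ⟨ht, le_rfl⟩
  rw [gronwallBound_ε0, sub_zero] at this
  exact (le_abs_self _).trans this

theorem a_le (h : ScalarFlow D lam b₀ a b β g) {t κ : ℝ}
    (ht : 0 ≤ t) (hκ : ∀ s ∈ Set.Ico 0 t, |b s ^ D * g s| ≤ κ) :
    a t ≤ √lam * Real.exp (κ * t) := by
  have h1 := h.add_le ht hκ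
  have h2 := h.neg.add_le ht (fun s hs => by simpa using hκ s hs)
  linarith

/-- Growth bound for a coefficient driven by a weak signal. -/
theorem abs_coeff_le_of_weak (h : ScalarFlow D lam b₀ a b β g) (hl : 0 < lam) (hb : 0 < b₀)
    {t T G : ℝ} (ht : 0 ≤ t) (htT : t ≤ T) (hG : 0 ≤ G) (hg : ∀ s ∈ Set.Ico 0 t, |g s| ≤ G)
    (hsmall : √lam * Real.exp ((√(1 + D) * b₀) ^ D * G * T) < b₀) :
    |a t * b t ^ D * β t| ≤
      lam * Real.exp (2 * ((√(1 + D) * b₀) ^ D * G * T)) * (√(1 + D) * b₀) ^ D := by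
  have hD : (0 : ℝ) ≤ 1 + D := by positivity
  have hb_le : ∀ s, 0 ≤ s → |β s| < b₀ → b s ^ D ≤ (√(1 + D) * b₀) ^ D := by
    intro s hs hβ
    refine pow_le_pow_left₀ (h.b_pos hb hs).le
      (abs_le.1 (abs_le_of_sq_le_sq ?_ (by positivity))).2 D
    rw [h.sq_b hs, mul_pow, Real.sq_sqrt hD]
    have : β s ^ 2 ≤ b₀ ^ 2 := sq_le_sq' (by linarith [(abs_lt.1 hβ).1]) (abs_lt.1 hβ).2.le
    nlinarith [(Nat.cast_nonneg D : (0 : ℝ) ≤ D)]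
  have hκ : ∀ r, 0 ≤ r → r ≤ t → (∀ s ∈ Set.Ico 0 r, |β s| < b₀) →
      ∀ s ∈ Set.Ico 0 r, |b s ^ D * g s| ≤ (√(1 + D) * b₀) ^ D * G := by
    intro r hr hrt hβ s hs
    rw [abs_mul, abs_of_nonneg (pow_nonneg (h.b_pos hb hs.1).le D)]
    exact mul_le_mul (hb_le s hs.1 (hβ s hs)) (hg s ⟨hs.1, hs.2.trans_le hrt⟩) (abs_nonneg _)
      (by positivity)
  have hexp : ∀ r, r ≤ t → √lam * Real.exp ((√(1 + D) * b₀) ^ D * G * r) ≤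
      √lam * Real.exp ((√(1 + D) * b₀) ^ D * G * T) := by
    intro r hr
    have : (√(1 + D) * b₀) ^ D * G * r ≤ (√(1 + D) * b₀) ^ D * G * T :=
      mul_le_mul_of_nonneg_left (hr.trans htT) (by positivity)
    gcongr
  have hβ : ∀ s ∈ Set.Icc 0 t, |β s| < b₀ := by
    refine forall_lt_of_continuousOn_of_bootstrap
      (h.continuousOn_β.mono Set.Icc_subset_Ici_self).abs fun r hr hlt => ?_
    have h1 := h.a_le hr.1 (hκ r hr.1 hr.2 hlt)
    linarith [h.abs_β_lt_a hl hr.1, hexp r hr.2]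
  have ha := (h.a_le ht (hκ t ht le_rfl fun s hs => hβ s ⟨hs.1, hs.2.le⟩)).trans (hexp t le_rfl)
  have hb' := hb_le t ht (hβ t ⟨ht, le_rfl⟩)
  have ha0 := (h.a_pos hl ht).le
  have hb0 := pow_nonneg (h.b_pos hb ht).le D
  rw [abs_mul, abs_mul, abs_of_nonneg ha0, abs_of_nonneg hb0]
  calc a t * b t ^ D * |β t| ≤ a t * b t ^ D * a t := by
        gcongr; exact (h.abs_β_lt_a hl ht).le
    _ = a t * a t * b t ^ D := by ring
    _ ≤ (√lam * Real.exp ((√(1 + D) * b₀) ^ D * G * T)) *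
        (√lam * Real.exp ((√(1 + D) * b₀) ^ D * G * T)) * (√(1 + D) * b₀) ^ D := by gcongr
    _ = _ := by
      rw [two_mul, Real.exp_add]
      linear_combination Real.exp ((√(1 + D) * b₀) ^ D * G * T) ^ 2 * (√(1 + D) * b₀) ^ D *
        Real.mul_self_sqrt hl.le

/-- Once a coefficient has reached a level below which it is driven upwards, it stays above. -/
theorem le_coeff_of_le (h : ScalarFlow D lam b₀ a b β g) (hl : 0 < lam) (hb : 0 < b₀)
    {r t m : ℝ} (hr : 0 ≤ r) (hrt : r ≤ t) (hm : m ≤ a r * b r ^ D * β r)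
    (hg : ∀ s ∈ Set.Ico r t, a s * b s ^ D * β s = m → 0 < g s) : m ≤ a t * b t ^ D * β t := by
  choose! K hK hd using fun s (hs : 0 ≤ s) => h.hasDerivWithinAt_coeff hl hb hs
  have := image_le_of_deriv_right_lt_deriv_boundary (a := r) (b := t)
    (f := fun s => -(a s * b s ^ D * β s)) (f' := fun s => -(K s * g s))
    (B := fun _ => -m) (B' := fun _ => 0)
    ((h.continuousOn_coeff.mono (Set.Icc_subset_Ici_self.trans (Set.Ici_subset_Ici.2 hr))).neg)
    (fun s hs => ((hd s (hr.trans hs.1)).mono (Set.Ici_subset_Ici.2 (hr.trans hs.1))).neg)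
    (neg_le_neg hm)
    (fun s => hasDerivAt_const s _) (fun s hs heq => ?_) ⟨hrt, le_rfl⟩
  · exact neg_le_neg_iff.1 this
  · have := mul_pos (hK s (hr.trans hs.1)) (hg s hs (neg_inj.1 heq))
    linarith

/-- Exponential growth under a persistently positive signal. -/
theorem le_add_of_le (h : ScalarFlow D lam b₀ a b β g) (hl : 0 < lam) (hb : 0 < b₀)
    {t τ : ℝ} (ht : 0 ≤ t) (hτ : 0 ≤ τ) (hg : ∀ s ∈ Set.Ico 0 t, τ ≤ g s) :
    √lam * Real.exp (b₀ ^ D * τ * t) ≤ a t + β t := by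
  have hpos : ∀ s, 0 ≤ s → 0 < a s + β s := fun s hs => by
    linarith [(abs_lt.1 (h.abs_β_lt_a hl hs)).1]
  have := image_le_of_deriv_right_le_deriv_boundary (a := 0) (b := t)
    (f := fun s => -((a s + β s) * Real.exp (-(b₀ ^ D * τ) * s)))
    (f' := fun s => -((b s ^ D * g s * (a s + β s)) * Real.exp (-(b₀ ^ D * τ) * s) +
      (a s + β s) * (Real.exp (-(b₀ ^ D * τ) * s) * (-(b₀ ^ D * τ)))))
    (B := fun _ => -√lam) (B' := fun _ => 0)
    (((h.continuousOn_a.add h.continuousOn_β).mono Set.Icc_subset_Ici_self).mul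
      (by fun_prop)).neg
    (fun s hs => (((h.hasDerivWithinAt_add hs.1).mono (Set.Ici_subset_Ici.2 hs.1)).mul
      (((hasDerivAt_id s).const_mul (-(b₀ ^ D * τ))).exp.hasDerivWithinAt.congr_deriv
        (by simp))).neg)
    (by simp [h.init_a, h.init_β]) continuousOn_const
    (fun s _ => hasDerivWithinAt_const s _ _) (fun s hs => ?_)
    (show t ∈ Set.Icc 0 t from ⟨ht, le_rfl⟩)
  · have h1 : √lam ≤ (a t + β t) * Real.exp (-(b₀ ^ D * τ) * t) := neg_le_neg_iff.1 this
    calc √lam * Real.exp (b₀ ^ D * τ * t)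
        ≤ (a t + β t) * Real.exp (-(b₀ ^ D * τ) * t) * Real.exp (b₀ ^ D * τ * t) := by gcongr
      _ = a t + β t := by
        rw [mul_assoc, ← Real.exp_add]; simp
  · have h1 : b₀ ^ D * τ ≤ b s ^ D * g s :=
      mul_le_mul (pow_le_pow_left₀ hb.le (h.le_b hb hs.1) D) (hg s hs) hτ
        (pow_nonneg (h.b_pos hb hs.1).le D)
    have h2 : 0 ≤ (b s ^ D * g s - b₀ ^ D * τ) * ((a s + β s) * Real.exp (-(b₀ ^ D * τ) * s)) :=
      mul_nonneg (sub_nonneg.2 h1) (mul_nonneg (hpos s hs.1).le (Real.exp_pos _).le)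
    linarith

/-- A coefficient with a target `c` reaches it up to `2τ`, if the flow runs long enough for a signal
of strength `τ` to be picked up. -/
theorem le_coeff_of_strong (h : ScalarFlow D lam b₀ a b β g) (hl : 0 < lam) (hb : 0 < b₀)
    {T c ν τ : ℝ} (hT : 0 ≤ T) (hντ : ν ≤ τ) (hτ : 0 < τ)
    (hg : ∀ s ∈ Set.Ico 0 T, |g s - (c - a s * b s ^ D * β s)| ≤ ν)
    (h2 : 2 ≤ Real.exp (b₀ ^ D * τ * T))
    (hc : |c| ≤ b₀ ^ D * lam * Real.exp (2 * (b₀ ^ D * τ * T)) / 8) :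
    c - 2 * τ ≤ a T * b T ^ D * β T := by
  by_contra! hcon
  have hbelow : ∀ s ∈ Set.Icc 0 T, a s * b s ^ D * β s < c - 2 * τ := by
    intro s hs
    by_contra! hle
    refine absurd (h.le_coeff_of_le hl hb hs.1 hs.2 hle fun r hr heq => ?_) (not_le.2 hcon)
    have := (abs_le.1 (hg r ⟨hs.1.trans hr.1, hr.2⟩)).1
    rw [heq] at this
    linarith
  have hz := h.le_add_of_le hl hb hT hτ.le fun s hs => by
    have h3 := (abs_le.1 (hg s hs)).1
    have h4 := hbelow s ⟨hs.1, hs.2.le⟩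
    linarith
  set E := Real.exp (b₀ ^ D * τ * T) with hE
  set z := a T + β T with hz'
  have hs0 := Real.sqrt_pos.2 hl
  have hz0 : 2 * √lam ≤ z := by nlinarith
  have hzpos : 0 < z := by linarith
  have hprod : z * (a T - β T) = lam := by
    have := h.sq_a hl.le hT
    rw [hz']; linarith
  have hw : a T - β T ≤ z / 4 := by
    by_contra! hw
    nlinarith [Real.mul_self_sqrt hl.le]
  have ha : z / 2 ≤ a T := by
    have : 0 < a T - β T := by linarith [(abs_lt.1 (h.abs_β_lt_a hl hT)).2]
    linarith
  have hβ : z / 4 ≤ β T := by linarith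
  have hbD : b₀ ^ D ≤ b T ^ D := pow_le_pow_left₀ hb.le (h.le_b hb hT) D
  have hE2 : Real.exp (2 * (b₀ ^ D * τ * T)) = E * E := by rw [two_mul, Real.exp_add]
  have h5 : lam * (E * E) ≤ z * z := by
    calc lam * (E * E) = (√lam * E) * (√lam * E) := by
          nth_rewrite 1 [← Real.mul_self_sqrt hl.le]; ring
      _ ≤ z * z := mul_self_le_mul_self (by positivity) hz
  have h6 : |c| ≤ a T * b T ^ D * β T := by
    rw [hE2] at hc
    calc |c| ≤ b₀ ^ D * (lam * (E * E)) / 8 := by linarith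
      _ ≤ b₀ ^ D * (z * z) / 8 := by gcongr
      _ = (z / 2) * b₀ ^ D * (z / 4) := by ring
      _ ≤ a T * b T ^ D * β T := by
        have := h.a_pos hl hT
        have := h.b_pos hb hT
        gcongr
  linarith [le_abs_self c]

theorem abs_coeff_sub_le_of_strong (h : ScalarFlow D lam b₀ a b β g) (hl : 0 < lam) (hb : 0 < b₀)
    {T c ν τ : ℝ} (hT : 0 ≤ T) (hντ : ν ≤ τ) (hτ : 0 < τ)
    (hg : ∀ s ∈ Set.Ico 0 T, |g s - (c - a s * b s ^ D * β s)| ≤ ν)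
    (h2 : 2 ≤ Real.exp (b₀ ^ D * τ * T))
    (hc : |c| ≤ b₀ ^ D * lam * Real.exp (2 * (b₀ ^ D * τ * T)) / 8) :
    |c - a T * b T ^ D * β T| ≤ 2 * τ := by
  have h1 := h.le_coeff_of_strong hl hb hT hντ hτ hg h2 hc
  have h3 := h.neg.le_coeff_of_strong hl hb hT hντ hτ (c := -c) (fun s hs => by
    rw [← abs_neg]; convert hg s hs using 2; ring) h2 (by rwa [abs_neg])
  exact abs_le.2 ⟨by linarith, by linarith⟩

end ScalarFlow

/-! ### Global solutions of ordinary differential equations in a Hilbert space -/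

section ODE

/-- `f` is bounded and Lipschitz continuous on each ball around the origin. -/
def LipschitzOnBalls {E G : Type*} [NormedAddCommGroup E] [NormedAddCommGroup G] (f : E → G) :
    Prop :=
  ∀ R : ℝ, ∃ K : ℝ, 0 ≤ K ∧ ∀ x y, ‖x‖ ≤ R → ‖y‖ ≤ R → ‖f x‖ ≤ K ∧ ‖f x - f y‖ ≤ K * ‖x - y‖

namespace LipschitzOnBalls

variable {E G : Type*} [NormedAddCommGroup E] [NormedAddCommGroup G]

theorem of_lipschitz {f : E → G} {K : ℝ} (hf : ∀ x y, ‖f x - f y‖ ≤ K * ‖x - y‖) :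
    LipschitzOnBalls f := by
  intro R
  refine ⟨max K 0 * (1 + |R|) + ‖f 0‖, by positivity, fun x y hx hy => ⟨?_, ?_⟩⟩
  · have h1 : ‖f x‖ ≤ ‖f x - f 0‖ + ‖f 0‖ := norm_le_norm_sub_add _ _
    have h2 := hf x 0
    rw [sub_zero] at h2
    have h3 : K * ‖x‖ ≤ max K 0 * (1 + |R|) :=
      mul_le_mul (le_max_left _ _) (by linarith [le_abs_self R]) (norm_nonneg _) (le_max_right _ _)
    linarith
  · refine (hf x y).trans (mul_le_mul_of_nonneg_right ?_ (norm_nonneg _))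
    have : max K 0 * 1 ≤ max K 0 * (1 + |R|) :=
      mul_le_mul_of_nonneg_left (by linarith [abs_nonneg R]) (le_max_right _ _)
    linarith [le_max_left K 0, norm_nonneg (f 0)]

theorem const (c : G) : LipschitzOnBalls (fun _ : E => c) :=
  of_lipschitz (K := 0) (by simp)

theorem bilin {G' G'' : Type*} [NormedSpace ℝ G] [NormedAddCommGroup G'] [NormedSpace ℝ G']
    [NormedAddCommGroup G''] [NormedSpace ℝ G''] {f : E → G} {g : E → G'}
    (B : G →L[ℝ] G' →L[ℝ] G'') (hf : LipschitzOnBalls f)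
    (hg : LipschitzOnBalls g) : LipschitzOnBalls (fun x => B (f x) (g x)) := by
  intro R
  obtain ⟨K, hK, hf⟩ := hf R
  obtain ⟨K', hK', hg⟩ := hg R
  have hB : ∀ u v, ‖u‖ ≤ K → ‖B u v‖ ≤ ‖B‖ * K * ‖v‖ := fun u v hu =>
    (B.le_opNorm₂ u v).trans (by gcongr)
  refine ⟨2 * (‖B‖ * K * K'), by positivity, fun x y hx hy => ⟨?_, ?_⟩⟩
  · have h1 : ‖B (f x) (g x)‖ ≤ ‖B‖ * K * K' := (hB _ _ (hf x y hx hy).1).trans (by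
      gcongr; exact (hg x y hx hy).1)
    have : 0 ≤ ‖B‖ * K * K' := by positivity
    linarith
  · have hsplit : B (f x) (g x) - B (f y) (g y) = B (f x) (g x - g y) + B (f x - f y) (g y) := by
      simp
    rw [hsplit]
    have h1 : ‖B (f x) (g x - g y)‖ ≤ ‖B‖ * K * (K' * ‖x - y‖) := (hB _ _ (hf x y hx hy).1).trans
      (by gcongr; exact (hg x y hx hy).2)
    have h2 : ‖B (f x - f y) (g y)‖ ≤ ‖B‖ * (K * ‖x - y‖) * K' := (B.le_opNorm₂ _ _).trans (by
      gcongr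
      · exact (hf x y hx hy).2
      · exact (hg y x hy hx).1)
    calc _ ≤ _ := norm_add_le _ _
      _ ≤ ‖B‖ * K * (K' * ‖x - y‖) + ‖B‖ * (K * ‖x - y‖) * K' := add_le_add h1 h2
      _ = _ := by ring

theorem add {f g : E → G} (hf : LipschitzOnBalls f) (hg : LipschitzOnBalls g) :
    LipschitzOnBalls (fun x => f x + g x) := by
  intro R
  obtain ⟨K, hK, hf⟩ := hf R
  obtain ⟨K', hK', hg⟩ := hg R
  refine ⟨K + K', by positivity, fun x y hx hy => ⟨?_, ?_⟩⟩
  · exact (norm_add_le _ _).trans (add_le_add (hf x y hx hy).1 (hg x y hx hy).1)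
  · rw [add_sub_add_comm, add_mul]
    exact (norm_add_le _ _).trans (add_le_add (hf x y hx hy).2 (hg x y hx hy).2)

theorem sum {ι : Type*} (s : Finset ι) {f : ι → E → G} (hf : ∀ i, LipschitzOnBalls (f i)) :
    LipschitzOnBalls (fun x => ∑ i ∈ s, f i x) := by
  classical
  induction s using Finset.induction_on with
  | empty => simpa using const (E := E) (0 : G)
  | insert i s hi ih => simpa [Finset.sum_insert hi] using (hf i).add ih

theorem congr' {f g : E → G} (hf : LipschitzOnBalls f) (h : ∀ x, f x = g x) : LipschitzOnBalls g :=
  (funext h : f = g) ▸ hf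

theorem continuous {f : E → G} (hf : LipschitzOnBalls f) : Continuous f := by
  refine continuous_iff_continuousAt.2 fun x => ?_
  obtain ⟨K, hK, hf⟩ := hf (‖x‖ + 1)
  have hx : ‖x‖ ≤ ‖x‖ + 1 := by linarith
  rw [ContinuousAt, tendsto_iff_norm_sub_tendsto_zero]
  refine squeeze_zero' (Eventually.of_forall fun _ => norm_nonneg _)
    (g := fun y => K * ‖y - x‖) ?_ ?_
  · filter_upwards [Metric.ball_mem_nhds x one_pos] with y hy
    refine (hf y x ?_ hx).2
    rw [Metric.mem_ball, dist_eq_norm] at hy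
    linarith [norm_le_norm_sub_add y x]
  · simpa using ((tendsto_iff_norm_sub_tendsto_zero.1 (tendsto_id (x := 𝓝 x))).const_mul K)

end LipschitzOnBalls

/-- The cutoff function which is `1` up to `R` and `0` from `R + 1` on. -/
noncomputable def cutoff (R r : ℝ) : ℝ := max 0 (min 1 (R + 1 - r))

theorem cutoff_nonneg (R r : ℝ) : 0 ≤ cutoff R r := le_max_left _ _

theorem cutoff_le_one (R r : ℝ) : cutoff R r ≤ 1 := max_le zero_le_one (min_le_left _ _)

theorem cutoff_eq_one {R r : ℝ} (h : r ≤ R) : cutoff R r = 1 := by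
  rw [cutoff, min_eq_left (by linarith), max_eq_right zero_le_one]

theorem cutoff_eq_zero {R r : ℝ} (h : R + 1 ≤ r) : cutoff R r = 0 := by
  rw [cutoff, max_eq_left]
  exact (min_le_right _ _).trans (by linarith)

theorem abs_cutoff_sub_le (R r s : ℝ) : |cutoff R r - cutoff R s| ≤ |r - s| := by
  unfold cutoff
  refine (abs_max_sub_max_le_max _ _ _ _).trans (max_le (by simp) ?_)
  refine (abs_min_sub_min_le_max _ _ _ _).trans (max_le (by simp) ?_)
  rw [abs_sub_comm r s]
  exact le_of_eq (congrArg abs (by ring))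

variable {H : Type*} [NormedAddCommGroup H] [InnerProductSpace ℝ H]

theorem norm_cutoff_smul_le {F : H → H} {R K : ℝ} (hK : 0 ≤ K)
    (hF : ∀ x, ‖x‖ ≤ R + 1 → ‖F x‖ ≤ K) (x : H) : ‖cutoff R ‖x‖ • F x‖ ≤ K := by
  rw [norm_smul, Real.norm_of_nonneg (cutoff_nonneg _ _)]
  by_cases hx : ‖x‖ ≤ R + 1
  · exact (mul_le_of_le_one_left (norm_nonneg _) (cutoff_le_one _ _)).trans (hF x hx)
  · rw [cutoff_eq_zero (not_le.1 hx).le, zero_mul]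
    exact hK

theorem norm_cutoff_smul_sub_le {F : H → H} {R K : ℝ} (hK : 0 ≤ K)
    (hF : ∀ x y, ‖x‖ ≤ R + 1 → ‖y‖ ≤ R + 1 → ‖F x‖ ≤ K ∧ ‖F x - F y‖ ≤ K * ‖x - y‖) (x y : H) :
    ‖cutoff R ‖x‖ • F x - cutoff R ‖y‖ • F y‖ ≤ 2 * K * ‖x - y‖ := by
  have hc : |cutoff R ‖x‖ - cutoff R ‖y‖| ≤ ‖x - y‖ :=
    (abs_cutoff_sub_le R _ _).trans (abs_norm_sub_norm_le x y)
  have hKxy : 0 ≤ K * ‖x - y‖ := by positivity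
  by_cases hy : ‖y‖ ≤ R + 1
  · by_cases hx : ‖x‖ ≤ R + 1
    · have hsplit : cutoff R ‖x‖ • F x - cutoff R ‖y‖ • F y =
          cutoff R ‖x‖ • (F x - F y) + (cutoff R ‖x‖ - cutoff R ‖y‖) • F y := by module
      rw [hsplit]
      refine (norm_add_le _ _).trans ?_
      rw [norm_smul, norm_smul, Real.norm_of_nonneg (cutoff_nonneg _ _), Real.norm_eq_abs]
      have h1 := mul_le_mul (cutoff_le_one R ‖x‖) (hF x y hx hy).2 (norm_nonneg _) zero_le_one
      have h2 := mul_le_mul hc (hF y x hy hx).1 (norm_nonneg _) (norm_nonneg _)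
      linarith
    · rw [cutoff_eq_zero (not_le.1 hx).le] at hc ⊢
      rw [zero_smul, zero_sub, norm_neg, norm_smul, Real.norm_eq_abs]
      rw [zero_sub, abs_neg] at hc
      have := mul_le_mul hc (hF y y hy hy).1 (norm_nonneg _) (norm_nonneg _)
      linarith
  · rw [cutoff_eq_zero (not_le.1 hy).le] at hc ⊢
    rw [zero_smul, sub_zero, norm_smul, Real.norm_eq_abs]
    rw [sub_zero] at hc
    by_cases hx : ‖x‖ ≤ R + 1
    · have := mul_le_mul hc (hF x x hx hx).1 (norm_nonneg _) (norm_nonneg _)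
      linarith
    · rw [cutoff_eq_zero (not_le.1 hx).le, abs_zero, zero_mul]
      linarith

variable [CompleteSpace H]

theorem exists_solution_Icc {F : H → H} (hF : LipschitzOnBalls F) {c : ℝ} (hc0 : 0 ≤ c)
    (hc : ∀ x, inner ℝ x (F x) ≤ c) (x₀ : H) {T : ℝ} (hT : 0 ≤ T) :
    ∃ u : ℝ → H, u 0 = x₀ ∧ ∀ t ∈ Set.Icc 0 T,
      HasDerivWithinAt u (F (u t)) (Set.Icc 0 T) t ∧ ‖u t‖ ≤ √(‖x₀‖ ^ 2 + (2 * c + 1) * T) := by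
  set R := √(‖x₀‖ ^ 2 + (2 * c + 1) * T) with hR
  obtain ⟨K, hK, hFK⟩ := hF (R + 1)
  have hb := norm_cutoff_smul_le (F := F) (R := R) hK fun x hx => (hFK x x hx hx).1
  have hl := norm_cutoff_smul_sub_le (F := F) (R := R) hK hFK
  have hpl : IsPicardLindelof (fun _ x => cutoff R ‖x‖ • F x) (tmin := 0) (tmax := T)
      ⟨0, ⟨le_rfl, hT⟩⟩ x₀ (⟨K, hK⟩ * ⟨T, hT⟩) 0 ⟨K, hK⟩ ⟨2 * K, by positivity⟩ := by
    refine IsPicardLindelof.of_time_independent (fun x _ => hb x) ?_ ?_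
    · exact (LipschitzWith.of_dist_le_mul fun x y => by
        rw [dist_eq_norm, dist_eq_norm]; exact hl x y).lipschitzOnWith
    · simp only [sub_zero, sub_self, max_eq_left hT, NNReal.coe_zero]
      exact le_rfl
  obtain ⟨u, hu0, hu⟩ := hpl.exists_eq_forall_mem_Icc_hasDerivWithinAt₀
  have hu0 : u 0 = x₀ := hu0
  have hR2 : R ^ 2 = ‖x₀‖ ^ 2 + (2 * c + 1) * T := Real.sq_sqrt (by positivity)
  have hbound : ∀ t ∈ Set.Icc 0 T, ‖u t‖ ≤ R := by
    have key : ∀ ⦃t⦄, t ∈ Set.Icc 0 T → ‖u t‖ ^ 2 ≤ ‖x₀‖ ^ 2 + (2 * c + 1) * t := by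
      refine image_le_of_deriv_right_lt_deriv_boundary
        (f' := fun t => 2 * inner ℝ (u t) (cutoff R ‖u t‖ • F (u t)))
        (B' := fun _ => 2 * c + 1) ?_ ?_ ?_ ?_ ?_
      · exact ContinuousOn.pow (ContinuousOn.norm fun t ht => (hu t ht).continuousWithinAt) 2
      · intro t ht
        exact ((hu t ⟨ht.1, ht.2.le⟩).mono_of_mem_nhdsWithin
          (Icc_mem_nhdsGE_of_mem ht)).norm_sq
      · simp [hu0]
      · intro t
        simpa using ((hasDerivAt_id t).const_mul (2 * c + 1)).const_add (‖x₀‖ ^ 2)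
      · intro t ht heq
        have : ‖u t‖ ≤ R := abs_le_of_sq_le_sq' (by
          rw [heq, hR2]
          have : (2 * c + 1) * t ≤ (2 * c + 1) * T :=
            mul_le_mul_of_nonneg_left ht.2.le (by positivity)
          linarith) (Real.sqrt_nonneg _) |>.2
        simp only [cutoff_eq_one this, one_smul]
        linarith [hc (u t)]
    intro t ht
    refine (abs_le_of_sq_le_sq' ?_ (Real.sqrt_nonneg _)).2
    rw [hR2]
    have : (2 * c + 1) * t ≤ (2 * c + 1) * T := mul_le_mul_of_nonneg_left ht.2 (by positivity)
    linarith [key ht]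
  refine ⟨u, hu0, fun t ht => ⟨?_, hbound t ht⟩⟩
  simpa [cutoff_eq_one (hbound t ht)] using hu t ht

/-- An ordinary differential equation with a right hand side that is Lipschitz on balls and points
outwards at most at a bounded rate has a solution for all times. -/
theorem exists_global_solution {F : H → H} (hF : LipschitzOnBalls F) {c : ℝ} (hc0 : 0 ≤ c)
    (hc : ∀ x, inner ℝ x (F x) ≤ c) (x₀ : H) :
    ∃ u : ℝ → H, u 0 = x₀ ∧ ∀ t, 0 ≤ t → HasDerivWithinAt u (F (u t)) (Set.Ici 0) t := by
  choose u hu0 hu using fun N : ℕ =>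
    exists_solution_Icc hF hc0 hc x₀ (T := (N : ℝ) + 1) (by positivity)
  have hcont : ∀ N, ContinuousOn (u N) (Set.Icc 0 ((N : ℝ) + 1)) := fun N t ht =>
    (hu N t ht).1.continuousWithinAt
  have hmono : ∀ {N M : ℕ}, N ≤ M → ∀ t ∈ Set.Icc 0 ((N : ℝ) + 1), u N t = u M t := by
    intro N M hNM
    have hNM' : (N : ℝ) + 1 ≤ (M : ℝ) + 1 := by
      have : (N : ℝ) ≤ M := Nat.cast_le.2 hNM
      linarith
    set R := √(‖x₀‖ ^ 2 + (2 * c + 1) * ((M : ℝ) + 1)) with hR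
    obtain ⟨K, hK, hFK⟩ := hF R
    have hright : ∀ (L : ℕ), ∀ t ∈ Set.Ico 0 ((L : ℝ) + 1),
        HasDerivWithinAt (u L) (F (u L t)) (Set.Ici t) t := fun L t ht =>
      (hu L t ⟨ht.1, ht.2.le⟩).1.mono_of_mem_nhdsWithin (Icc_mem_nhdsGE_of_mem ht)
    have hsub : Set.Ico (0 : ℝ) ((N : ℝ) + 1) ⊆ Set.Ico 0 ((M : ℝ) + 1) :=
      Set.Ico_subset_Ico_right hNM'
    refine ODE_solution_unique_of_mem_Icc_right (v := fun _ => F)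
      (s := fun _ => Metric.closedBall 0 R) (K := ⟨K, hK⟩) (fun t _ => ?_)
      (hcont N) (hright N) (fun t ht => ?_)
      ((hcont M).mono (Set.Icc_subset_Icc_right hNM')) (fun t ht => hright M t (hsub ht))
      (fun t ht => ?_) ((hu0 N).trans (hu0 M).symm)
    · refine LipschitzOnWith.of_dist_le_mul fun x hx y hy => ?_
      rw [dist_eq_norm, dist_eq_norm]
      exact (hFK x y (by simpa using hx) (by simpa using hy)).2
    · rw [mem_closedBall_zero_iff]
      refine (hu N t ⟨ht.1, ht.2.le⟩).2.trans ?_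
      rw [hR]
      gcongr
    · rw [mem_closedBall_zero_iff]
      exact (hu M t ⟨ht.1, (hsub ht).2.le⟩).2
  refine ⟨fun t => u ⌈t⌉₊ t, by simpa using hu0 0, fun t ht => ?_⟩
  have heq : ∀ s, 0 ≤ s → s < t + 1 → u ⌈s⌉₊ s = u (⌈t⌉₊ + 1) s := by
    intro s hs hst
    refine hmono ?_ s ⟨hs, (Nat.le_ceil s).trans (by linarith)⟩
    rw [Nat.ceil_le]
    push_cast
    linarith [Nat.le_ceil t]
  have htN : t < ((⌈t⌉₊ + 1 : ℕ) : ℝ) + 1 := by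
    push_cast
    linarith [Nat.le_ceil t]
  have hd := (hu (⌈t⌉₊ + 1) t ⟨ht, htN.le⟩).1
  have hd' : HasDerivWithinAt (u (⌈t⌉₊ + 1)) (F (u (⌈t⌉₊ + 1) t)) (Set.Ici 0) t := by
    refine hd.mono_of_mem_nhdsWithin ?_
    rw [← Set.Ici_inter_Iic]
    exact inter_mem self_mem_nhdsWithin (mem_nhdsWithin_of_mem_nhds (Iic_mem_nhds htN))
  have ht' := heq t ht (by linarith)
  simp only [ht']
  refine hd'.congr_of_eventuallyEq ?_ ht'
  filter_upwards [self_mem_nhdsWithin, mem_nhdsWithin_of_mem_nhds (Iio_mem_nhds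
    (show t < t + 1 by linarith))] with s hs hst
  exact heq s hs hst

end ODE

/-! ### Square-summable and bounded sequences -/

/-- The space `ℓ²` of real sequences. -/
abbrev SeqTwo := lp (fun _ : ℕ => ℝ) 2

/-- The space `ℓ^∞` of real sequences. -/
abbrev SeqTop := lp (fun _ : ℕ => ℝ) ∞

/-- Multiplication of a square-summable by a bounded sequence. -/
noncomputable def mulTwo : SeqTop →L[ℝ] SeqTwo →L[ℝ] SeqTwo :=
  lp.holderL 2 (fun _ => ContinuousLinearMap.mul ℝ ℝ) (K := 1) (fun _ => by simp)

@[simp] theorem mulTwo_apply (u : SeqTop) (v : SeqTwo) (j : ℕ) : mulTwo u v j = u j * v j := rfl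

/-- The product of two square-summable sequences, as a summable sequence. -/
noncomputable def mulOne : SeqTwo →L[ℝ] SeqTwo →L[ℝ] lp (fun _ : ℕ => ℝ) 1 :=
  lp.holderL 1 (fun _ => ContinuousLinearMap.mul ℝ ℝ) (K := 1) (fun _ => by simp)

@[simp] theorem mulOne_apply (u v : SeqTwo) (j : ℕ) : mulOne u v j = u j * v j := rfl

theorem summable_abs_of_lp_one (w : lp (fun _ : ℕ => ℝ) 1) : Summable fun j => |w j| := by
  simpa using (memℓp_gen_iff (p := 1) (by simp)).1 w.2

theorem norm_lp_one (w : lp (fun _ : ℕ => ℝ) 1) : ‖w‖ = ∑' j, |w j| := by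
  rw [lp.norm_eq_tsum_rpow (by simp)]
  simp

theorem summable_sq_of_seqTwo (u : SeqTwo) : Summable fun j => u j ^ 2 := by
  simpa using (memℓp_gen_iff (p := 2) (by simp)).1 u.2

theorem memℓp_two_of_summable_sq {u : ℕ → ℝ} (h : Summable fun j => u j ^ 2) : Memℓp u 2 :=
  (memℓp_gen_iff (p := 2) (by simp)).2 (by simpa using h)

theorem sq_norm_seqTwo (u : SeqTwo) : ‖u‖ ^ 2 = ∑' j, u j ^ 2 := by
  have := lp.norm_rpow_eq_tsum (p := 2) (by simp) u
  simpa using this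

theorem inner_seqTwo (u v : SeqTwo) : inner ℝ u v = ∑' j, u j * v j := by
  rw [lp.inner_eq_tsum]
  exact tsum_congr fun j => mul_comm _ _

/-! ### The gradient of the empirical loss -/

section Gradient

variable {X : Type*} {e : ℕ → X → ℝ} {D : ℕ}

theorem summable_abs_coeff (a : SeqTwo) (b : SeqTop) (β : SeqTwo) :
    Summable fun j => |a j * b j ^ D * β j| := by
  refine (summable_abs_of_lp_one (mulOne (mulTwo (b ^ D) a) β)).congr fun j => ?_
  simp [lp.infty_coeFn_pow, mul_comm]

theorem summable_predictor (a : SeqTwo) (b : SeqTop) (β : SeqTwo) {C : ℝ} {z : X}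
    (hz : ∀ j, |e j z| ≤ C) : Summable fun j => a j * b j ^ D * e j z * β j := by
  refine Summable.of_norm_bounded ((summable_abs_coeff (D := D) a b β).mul_left C) fun j => ?_
  rw [show a j * b j ^ D * e j z * β j = e j z * (a j * b j ^ D * β j) by ring, norm_mul]
  exact mul_le_mul_of_nonneg_right (hz j) (norm_nonneg _)

/-- The empirical correlation of the residual of `f` with `e j`. -/
noncomputable def signal (e : ℕ → X → ℝ) {n : ℕ} (x : Fin n → X) (y : Fin n → ℝ) (f : X → ℝ)
    (j : ℕ) : ℝ :=
  1 / n * ∑ i, (y i - f (x i)) * e j (x i)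

theorem tsum_eq_add_of_eq_off {f g : ℕ → ℝ} (hf : Summable f) (j : ℕ) (h : ∀ k, k ≠ j → g k = f k) :
    ∑' k, g k = ∑' k, f k + (g j - f j) := by
  have : g = Function.update f j (g j) := by
    ext k
    by_cases hk : k = j
    · subst hk; simp
    · simp [hk, h k hk]
  rw [this]
  have h2 := (hf.hasSum.update j (g j)).tsum_eq
  rw [h2]
  simp
  ring

theorem hasDerivAt_empLoss {n : ℕ} (x : Fin n → X) (y : Fin n → ℝ) (f : ℝ → X → ℝ) (φ : ℝ → ℝ)
    {φ' s₀ : ℝ} (hφ : HasDerivAt φ φ' s₀) (j : ℕ)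
    (hf : ∀ s i, f s (x i) = f s₀ (x i) + (φ s - φ s₀) * e j (x i)) :
    HasDerivAt (fun s => empLoss x y (f s)) (-(φ' * signal e x y (f s₀) j)) s₀ := by
  have h1 : (fun s => empLoss x y (f s)) = fun s => 1 / (2 * (n : ℝ)) *
      ∑ i, (y i - (f s₀ (x i) + (φ s - φ s₀) * e j (x i))) ^ 2 := by
    ext s
    simp only [empLoss, hf s]
  rw [h1]
  have h2 : ∀ i, HasDerivAt (fun s => (y i - (f s₀ (x i) + (φ s - φ s₀) * e j (x i))) ^ 2)
      (-(2 * ((y i - f s₀ (x i)) * e j (x i) * φ'))) s₀ := by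
    intro i
    refine ((((((hφ.sub_const (φ s₀)).mul_const (e j (x i))).const_add
      (f s₀ (x i))).const_sub (y i))).pow 2).congr_deriv ?_
    simp
    ring
  refine ((HasDerivAt.fun_sum fun i _ => h2 i).const_mul _).congr_deriv ?_
  rw [signal, Finset.sum_neg_distrib, ← Finset.mul_sum, ← Finset.sum_mul]
  rcases eq_or_ne n 0 with rfl | hn
  · simp
  · field_simp

variable {n : ℕ} {x : Fin n → X} (y : Fin n → ℝ) {C : ℝ} (hC : ∀ i j, |e j (x i)| ≤ C)
  (a : SeqTwo) (b : SeqTop) (β : SeqTwo) (j : ℕ)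
include hC

theorem partialDeriv_a :
    partialDeriv (fun u => paramLoss e D x y u b β) a j =
      -(b j ^ D * β j * signal e x y (predictor e D a b β) j) := by
  have h := hasDerivAt_empLoss (e := e) x y (fun s => predictor e D (Function.update a j s) b β)
    (fun s => s * (b j ^ D * β j)) (s₀ := a j) (φ' := b j ^ D * β j)
    (by simpa using (hasDerivAt_id (a j)).mul_const (b j ^ D * β j)) j (fun s i => by
      simp only [Function.update_eq_self]
      rw [predictor, tsum_eq_add_of_eq_off (summable_predictor (D := D) a b β (hC i)) j
        (fun k hk => by simp [hk]), predictor]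
      simp
      ring)
  simp only [Function.update_eq_self] at h
  exact h.deriv

theorem partialDeriv_b :
    partialDeriv (fun u => paramLoss e D x y a u β) b j =
      -(D * a j * b j ^ (D - 1) * β j * signal e x y (predictor e D a b β) j) := by
  have h := hasDerivAt_empLoss (e := e) x y (fun s => predictor e D a (Function.update b j s) β)
    (fun s => s ^ D * (a j * β j)) (s₀ := b j) (φ' := D * a j * b j ^ (D - 1) * β j)
    (((hasDerivAt_pow D (b j)).mul_const (a j * β j)).congr_deriv (by ring)) j (fun s i => by
      simp only [Function.update_eq_self]
      rw [predictor, tsum_eq_add_of_eq_off (summable_predictor (D := D) a b β (hC i)) j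
        (fun k hk => by simp [hk]), predictor]
      simp
      ring)
  simp only [Function.update_eq_self] at h
  exact h.deriv

theorem partialDeriv_β :
    partialDeriv (fun u => paramLoss e D x y a b u) β j =
      -(a j * b j ^ D * signal e x y (predictor e D a b β) j) := by
  have h := hasDerivAt_empLoss (e := e) x y (fun s => predictor e D a b (Function.update β j s))
    (fun s => s * (a j * b j ^ D)) (s₀ := β j) (φ' := a j * b j ^ D)
    (by simpa using (hasDerivAt_id (β j)).mul_const (a j * b j ^ D)) j (fun s i => by
      simp only [Function.update_eq_self]
      rw [predictor, tsum_eq_add_of_eq_off (summable_predictor (D := D) a b β (hC i)) j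
        (fun k hk => by simp [hk]), predictor]
      simp
      ring)
  simp only [Function.update_eq_self] at h
  exact h.deriv

end Gradient

theorem IsGradientFlow.scalarFlow {X : Type*} {e : ℕ → X → ℝ} {lam : ℕ → ℝ} {D : ℕ} {b₀ : ℝ}
    {n : ℕ} {x : Fin n → X} {y : Fin n → ℝ} {a : ℝ → SeqTwo} {b : ℝ → SeqTop} {β : ℝ → SeqTwo}
    (h : IsGradientFlow e lam D b₀ x y a b β) {C : ℝ} (hC : ∀ i j, |e j (x i)| ≤ C) (j : ℕ) :
    ScalarFlow D (lam j) b₀ (fun t => a t j) (fun t => b t j) (fun t => β t j)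
      (fun t => signal e x y (predictor e D (a t) (b t) (β t)) j) where
  init_a := h.init_a j
  init_b := h.init_b j
  init_β := h.init_β j
  deriv_a t ht := (h.flow_a t ht j).congr_deriv (by rw [partialDeriv_a y hC, neg_neg])
  deriv_b t ht := (h.flow_b t ht j).congr_deriv (by rw [partialDeriv_b y hC, neg_neg])
  deriv_β t ht := (h.flow_β t ht j).congr_deriv (by rw [partialDeriv_β y hC, neg_neg])

/-! ### Existence of the gradient flow -/

section Existence

theorem abs_sqrt_add_sq_sub_le {c : ℝ} (hc : 0 ≤ c) (u v : ℝ) :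
    |√(c + u ^ 2) - √(c + v ^ 2)| ≤ |u - v| := by
  have h : ∀ u v : ℝ, √(c + u ^ 2) ≤ √(c + v ^ 2) + |u - v| := by
    intro u v
    refine Real.sqrt_le_iff.2 ⟨by positivity, ?_⟩
    have h1 : |v| ≤ √(c + v ^ 2) := Real.abs_le_sqrt (by linarith)
    have h2 := Real.sq_sqrt (show 0 ≤ c + v ^ 2 by positivity)
    have h3 : v * (u - v) ≤ √(c + v ^ 2) * |u - v| := (le_abs_self _).trans (by
      rw [abs_mul]; gcongr)
    nlinarith [sq_abs (u - v)]
  refine abs_sub_le_iff.2 ⟨by linarith [h u v], ?_⟩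
  have := h v u
  rw [abs_sub_comm] at this
  linarith

/-- The parameter `b` as a function of `β`, from the conserved quantity `b² - Dβ²`. -/
noncomputable def bOf (D : ℕ) (b₀ u : ℝ) : ℝ := b₀ * √(1 + (√D * (u / b₀)) ^ 2)

theorem bOf_zero (D : ℕ) (b₀ : ℝ) : bOf D b₀ 0 = b₀ := by simp [bOf]

theorem abs_bOf_sub_le (D : ℕ) (b₀ u v : ℝ) : |bOf D b₀ u - bOf D b₀ v| ≤ √D * |u - v| := by
  rcases eq_or_ne b₀ 0 with rfl | hb
  · simp only [bOf, zero_mul, sub_self, abs_zero]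
    positivity
  rw [bOf, bOf, ← mul_sub, abs_mul]
  refine (mul_le_mul_of_nonneg_left (abs_sqrt_add_sq_sub_le zero_le_one _ _)
    (abs_nonneg b₀)).trans (le_of_eq ?_)
  rw [← abs_mul, ← abs_of_nonneg (Real.sqrt_nonneg D), ← abs_mul,
    abs_of_nonneg (Real.sqrt_nonneg D)]
  congr 1
  field_simp

theorem abs_bOf_le (D : ℕ) (b₀ u : ℝ) : |bOf D b₀ u| ≤ |b₀| + √D * |u| := by
  have h := abs_bOf_sub_le D b₀ u 0
  rw [bOf_zero, sub_zero] at h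
  linarith [abs_sub_abs_le_abs_sub (bOf D b₀ u) b₀]

variable {lam : ℕ → ℝ} (hlam : ∀ j, 0 < lam j) (hsum : Summable lam) (D : ℕ) (b₀ : ℝ)

/-- The parameter `a` as a function of `β`, from the conserved quantity `a² - β²`. -/
noncomputable def aSeq (β : SeqTwo) : SeqTwo :=
  ⟨fun j => √(lam j + β j ^ 2), memℓp_two_of_summable_sq
    ((hsum.add (summable_sq_of_seqTwo β)).congr fun j => by
      rw [Real.sq_sqrt (add_nonneg (hlam j).le (sq_nonneg _))])⟩

theorem norm_aSeq_sub_le (β β' : SeqTwo) :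
    ‖aSeq hlam hsum β - aSeq hlam hsum β'‖ ≤ 1 * ‖β - β'‖ := by
  rw [one_mul]
  exact lp.norm_mono two_ne_zero fun j => abs_sqrt_add_sq_sub_le (hlam j).le _ _

/-- The parameter sequence `b` as a function of `β`. -/
noncomputable def bSeq (β : SeqTwo) : SeqTop :=
  ⟨fun j => bOf D b₀ (β j), memℓp_infty ⟨|b₀| + √D * ‖β‖, by
    rintro _ ⟨j, rfl⟩
    refine (abs_bOf_le D b₀ (β j)).trans ?_
    gcongr
    exact lp.norm_apply_le_norm two_ne_zero β j⟩⟩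

theorem norm_bSeq_sub_le (β β' : SeqTwo) : ‖bSeq D b₀ β - bSeq D b₀ β'‖ ≤ √D * ‖β - β'‖ :=
  lp.norm_le_of_forall_le (by positivity) fun j => (abs_bOf_sub_le D b₀ _ _).trans (by
    gcongr
    exact lp.norm_apply_le_norm two_ne_zero (β - β') j)

theorem lipschitzOnBalls_bSeq_pow (k : ℕ) : LipschitzOnBalls (fun β => bSeq D b₀ β ^ k) := by
  induction k with
  | zero => simpa using LipschitzOnBalls.const (E := SeqTwo) (1 : SeqTop)
  | succ k ih =>
    simp only [pow_succ]
    exact ih.bilin (ContinuousLinearMap.mul ℝ SeqTop)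
      (LipschitzOnBalls.of_lipschitz (norm_bSeq_sub_le D b₀))

/-- The feature weights `a b ^ D` as a function of `β`. -/
noncomputable def weightSeq (β : SeqTwo) : SeqTwo := mulTwo (bSeq D b₀ β ^ D) (aSeq hlam hsum β)

theorem weightSeq_apply (β : SeqTwo) (j : ℕ) :
    weightSeq hlam hsum D b₀ β j = aSeq hlam hsum β j * bSeq D b₀ β j ^ D := by
  rw [weightSeq, mulTwo_apply, lp.infty_coeFn_pow, Pi.pow_apply, mul_comm]

/-- The velocity of `β` under the gradient flow. -/
noncomputable def velocity {n : ℕ} (E : Fin n → SeqTop) (y : Fin n → ℝ) (β : SeqTwo) : SeqTwo :=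
  ∑ i, (1 / (n : ℝ) * (y i - inner ℝ (mulTwo (E i) (weightSeq hlam hsum D b₀ β)) β)) •
    mulTwo (E i) (weightSeq hlam hsum D b₀ β)

theorem lipschitzOnBalls_velocity {n : ℕ} (E : Fin n → SeqTop) (y : Fin n → ℝ) :
    LipschitzOnBalls (velocity hlam hsum D b₀ E y) := by
  have hw : LipschitzOnBalls (weightSeq hlam hsum D b₀) :=
    (lipschitzOnBalls_bSeq_pow D b₀ D).bilin mulTwo
      (LipschitzOnBalls.of_lipschitz (norm_aSeq_sub_le hlam hsum))
  refine LipschitzOnBalls.sum _ fun i => ?_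
  have hm : LipschitzOnBalls fun β => mulTwo (E i) (weightSeq hlam hsum D b₀ β) :=
    (LipschitzOnBalls.const (E i)).bilin mulTwo hw
  have hid : LipschitzOnBalls (fun β : SeqTwo => β) :=
    LipschitzOnBalls.of_lipschitz (K := 1) (by simp)
  have hr : LipschitzOnBalls fun β : SeqTwo =>
      1 / (n : ℝ) * (y i - inner ℝ (mulTwo (E i) (weightSeq hlam hsum D b₀ β)) β) := by
    have h1 := ((LipschitzOnBalls.const (E := SeqTwo) (y i)).add
      ((LipschitzOnBalls.const (E := SeqTwo) (-1 : ℝ)).bilin (ContinuousLinearMap.mul ℝ ℝ)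
        (hm.bilin (innerSL ℝ) hid)))
    refine (((LipschitzOnBalls.const (E := SeqTwo) (1 / (n : ℝ))).bilin
      (ContinuousLinearMap.mul ℝ ℝ) h1)).congr' fun β => ?_
    change 1 / (n : ℝ) * (y i + -1 * inner ℝ _ β) = _
    ring
  exact hr.bilin (ContinuousLinearMap.lsmul ℝ ℝ) hm

theorem inner_velocity_le {n : ℕ} (E : Fin n → SeqTop) (y : Fin n → ℝ) (β : SeqTwo) :
    inner ℝ β (velocity hlam hsum D b₀ E y β) ≤ 1 / n * ∑ i, y i ^ 2 := by
  rw [velocity, inner_sum, Finset.mul_sum]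
  refine Finset.sum_le_sum fun i _ => ?_
  rw [inner_smul_right, mul_assoc]
  refine mul_le_mul_of_nonneg_left ?_ (by positivity)
  rw [real_inner_comm]
  generalize inner ℝ β (mulTwo (E i) (weightSeq hlam hsum D b₀ β)) = p
  nlinarith [sq_nonneg (y i - 2 * p), sq_nonneg (y i)]

variable {X : Type*} {e : ℕ → X → ℝ}

include hlam hsum in
theorem exists_isGradientFlow {n : ℕ} (x : Fin n → X) (y : Fin n → ℝ) {C : ℝ}
    (hC : ∀ i j, |e j (x i)| ≤ C) : ∃ a b β, IsGradientFlow e lam D b₀ x y a b β := by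
  set E : Fin n → SeqTop := fun i => ⟨fun j => e j (x i), memℓp_infty ⟨C, by
    rintro _ ⟨j, rfl⟩
    exact hC i j⟩⟩ with hE
  have hEapp : ∀ i j, E i j = e j (x i) := fun _ _ => rfl
  obtain ⟨β, hβ0, hβ⟩ := exists_global_solution (lipschitzOnBalls_velocity hlam hsum D b₀ E y)
    (by positivity) (inner_velocity_le hlam hsum D b₀ E y) 0
  have hβc : ContinuousOn β (Set.Ici 0) := fun t ht => (hβ t ht).continuousWithinAt
  have hac : Continuous (aSeq hlam hsum) :=
    (LipschitzOnBalls.of_lipschitz (norm_aSeq_sub_le hlam hsum)).continuous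
  have hbc : Continuous (bSeq D b₀) :=
    (LipschitzOnBalls.of_lipschitz (norm_bSeq_sub_le D b₀)).continuous
  set a : ℝ → SeqTwo := fun t => aSeq hlam hsum (β t) with ha
  set b : ℝ → SeqTop := fun t => bSeq D b₀ (β t) with hb
  have hpred : ∀ t i, predictor e D (a t) (b t) (β t) (x i) =
      inner ℝ (mulTwo (E i) (weightSeq hlam hsum D b₀ (β t))) (β t) := by
    intro t i
    rw [inner_seqTwo, predictor]
    refine tsum_congr fun j => ?_
    rw [mulTwo_apply, weightSeq_apply, hEapp]
    ring
  set g : ℝ → ℕ → ℝ := fun t j => signal e x y (predictor e D (a t) (b t) (β t)) j with hg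
  have hβj : ∀ t, 0 ≤ t → ∀ j, HasDerivWithinAt (fun s => β s j)
      (a t j * b t j ^ D * g t j) (Set.Ici 0) t := by
    intro t ht j
    refine ((lp.evalCLM ℝ (fun _ : ℕ => ℝ) 2 j).hasFDerivAt.comp_hasDerivWithinAt t
      (hβ t ht)).congr_deriv ?_
    have : (lp.evalCLM ℝ (fun _ : ℕ => ℝ) 2 j) (velocity hlam hsum D b₀ E y (β t)) =
        ∑ i, (1 / (n : ℝ) * (y i - inner ℝ (mulTwo (E i) (weightSeq hlam hsum D b₀ (β t))) (β t))) *
          (e j (x i) * (a t j * b t j ^ D)) := by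
      rw [velocity, map_sum]
      refine Finset.sum_congr rfl fun i _ => ?_
      rw [map_smul, smul_eq_mul]
      congr 1
      change mulTwo (E i) (weightSeq hlam hsum D b₀ (β t)) j = _
      rw [mulTwo_apply, weightSeq_apply]
    rw [this]
    simp only [hg, signal, hpred]
    rw [Finset.mul_sum, Finset.mul_sum]
    exact Finset.sum_congr rfl fun i _ => by ring
  have hsq : ∀ t j, a t j ^ 2 = lam j + β t j ^ 2 := fun t j =>
    Real.sq_sqrt (add_nonneg (hlam j).le (sq_nonneg _))
  have hapos : ∀ t j, 0 < a t j := fun t j =>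
    Real.sqrt_pos.2 (add_pos_of_pos_of_nonneg (hlam j) (sq_nonneg _))
  refine ⟨a, b, β, ⟨fun j => ?_, fun j => ?_, fun j => ?_, hac.comp_continuousOn hβc,
    hbc.comp_continuousOn hβc, hβc, fun t ht j => ?_, fun t ht j => ?_, fun t ht j => ?_⟩⟩
  · change √(lam j + β 0 j ^ 2) = _
    simp [hβ0]
  · change bOf D b₀ (β 0 j) = _
    simp [hβ0, bOf_zero]
  · simp [hβ0]
  · rw [partialDeriv_a y hC, neg_neg]
    have h1 : HasDerivWithinAt (fun s => a s j)
        (2 * β t j * (a t j * b t j ^ D * g t j) / (2 * a t j)) (Set.Ici 0) t := by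
      have h2 := ((((hβj t ht j).pow 2).const_add (lam j))).sqrt (by
        change lam j + β t j ^ 2 ≠ 0
        rw [← hsq]; exact pow_ne_zero 2 (hapos t j).ne')
      refine h2.congr_deriv ?_
      simp only [Pi.pow_apply]
      change _ / (2 * a t j) = _
      simp
    refine h1.congr_deriv ?_
    have := (hapos t j).ne'
    field_simp
    rfl
  · rw [partialDeriv_b y hC, neg_neg]
    rcases eq_or_ne b₀ 0 with hb0 | hb0
    · have hbz : ∀ s, b s j = 0 := fun s => by
        change bOf D b₀ (β s j) = 0
        simp [bOf, hb0]
      rcases D with _ | D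
      · simp only [hbz]
        simpa using hasDerivWithinAt_const t (Set.Ici (0 : ℝ)) (0 : ℝ)
      · have hβz : β t j = 0 := by
          have h1 : ∀ s, 0 ≤ s → HasDerivWithinAt (fun s => β s j) 0 (Set.Ici 0) s := fun s hs =>
            (hβj s hs j).congr_deriv (by simp [hbz])
          rw [eq_of_hasDerivWithinAt_Ici_zero h1 ht, hβ0]
          simp
        simp only [hbz, hβz]
        simpa using hasDerivWithinAt_const t (Set.Ici (0 : ℝ)) (0 : ℝ)
    · have hbne : √(1 + (√D * (β t j / b₀)) ^ 2) ≠ 0 := (Real.sqrt_pos.2 (by positivity)).ne'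
      have hbt : b t j = b₀ * √(1 + (√D * (β t j / b₀)) ^ 2) := rfl
      have h2 := (((((((hβj t ht j).div_const b₀).const_mul (√(D : ℝ))).pow 2).const_add
        1).sqrt (by change 1 + (√D * (β t j / b₀)) ^ 2 ≠ 0; positivity))).const_mul b₀
      refine h2.congr_deriv ?_
      change _ = D * a t j * b t j ^ (D - 1) * β t j * g t j
      simp only [Pi.pow_apply]
      have hbtne : b t j ≠ 0 := by rw [hbt]; exact mul_ne_zero hb0 hbne
      have hs : √(1 + (√D * (β t j / b₀)) ^ 2) = b t j / b₀ := by rw [hbt]; field_simp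
      rw [hs]
      have hD : √(D : ℝ) ^ 2 = D := Real.sq_sqrt (Nat.cast_nonneg D)
      rcases D with _ | D
      · simp
      · rw [Nat.add_sub_cancel, ← hD, pow_succ (b t j) D]
        field_simp
        simp
        field_simp
  · rw [partialDeriv_β y hC, neg_neg]
    exact hβj t ht j

end Existence

/-! ### Expansions in a uniformly bounded orthonormal basis -/

section Expansion

theorem summable_expansion {X : Type*} {e : ℕ → X → ℝ} {d : ℕ → ℝ}
    (hd : Summable fun j => |d j|) {C : ℝ} {z : X}
    (hz : ∀ j, |e j z| ≤ C) : Summable fun j => d j * e j z :=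
  Summable.of_norm_bounded (hd.mul_right C) fun j => by
    rw [norm_mul]
    exact mul_le_mul_of_nonneg_left (hz j) (norm_nonneg _)

variable {X : Type*} [MeasurableSpace X] {μ : Measure X} {e : ℕ → X → ℝ}

theorem integral_mul_of_basis (B : HilbertBasis ℕ ℝ (Lp ℝ 2 μ))
    (hB : ∀ j, (B j : X → ℝ) =ᵐ[μ] e j) (j k : ℕ) :
    ∫ x, e j x * e k x ∂μ = if j = k then 1 else 0 := by
  rw [← orthonormal_iff_ite.1 B.orthonormal j k, L2.inner_def]
  refine integral_congr_ae ?_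
  filter_upwards [hB j, hB k] with x hj hk
  rw [← hj, ← hk]
  exact mul_comm _ _

theorem repr_toLp (B : HilbertBasis ℕ ℝ (Lp ℝ 2 μ)) (hB : ∀ j, (B j : X → ℝ) =ᵐ[μ] e j)
    {f : X → ℝ} (hf : MemLp f 2 μ) (j : ℕ) : B.repr (hf.toLp f) j = coeff μ e f j := by
  rw [B.repr_apply_apply, L2.inner_def, coeff]
  refine integral_congr_ae ?_
  filter_upwards [hB j, hf.coeFn_toLp] with x hj hx
  rw [← hj, hx]
  rfl

theorem summable_sq_of_summable_abs {d : ℕ → ℝ} (hd : Summable fun j => |d j|) :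
    Summable fun j => d j ^ 2 := by
  have h1 : Tendsto (fun j => |d j|) cofinite (𝓝 0) := hd.tendsto_cofinite_zero
  refine hd.of_norm_bounded_eventually ?_
  filter_upwards [h1.eventually_le_const one_pos] with j hj
  rw [Real.norm_of_nonneg (sq_nonneg _), ← sq_abs, sq]
  exact mul_le_of_le_one_left (abs_nonneg _) hj

theorem repr_symm_ae_eq_tsum (B : HilbertBasis ℕ ℝ (Lp ℝ 2 μ))
    (hB : ∀ j, (B j : X → ℝ) =ᵐ[μ] e j) {C : ℝ} (hC : ∀ j, ∀ᵐ x ∂μ, |e j x| ≤ C) (w : SeqTwo)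
    (hw : Summable fun j => |w j|) :
    (B.repr.symm w : X → ℝ) =ᵐ[μ] fun z => ∑' j, w j * e j z := by
  have h1 := (B.hasSum_repr_symm w).tendsto_sum_nat
  obtain ⟨ns, hns, hae⟩ := (tendstoInMeasure_of_tendsto_Lp h1).exists_seq_tendsto_ae
  have h2 : ∀ᵐ z ∂μ, ∀ N, ((∑ j ∈ Finset.range N, w j • B j : Lp ℝ 2 μ) : X → ℝ) z =
      ∑ j ∈ Finset.range N, w j * e j z := by
    refine ae_all_iff.2 fun N => ?_
    induction N with
    | zero =>
      filter_upwards [Lp.coeFn_zero ℝ 2 μ] with z hz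
      simpa using hz
    | succ N ih =>
      rw [Finset.sum_range_succ]
      filter_upwards [ih, Lp.coeFn_add (∑ j ∈ Finset.range N, w j • B j) (w N • B N),
        Lp.coeFn_smul (w N) (B N), hB N] with z h1 h2 h3 h4
      rw [h2, Pi.add_apply, h1, h3, Finset.sum_range_succ, Pi.smul_apply, h4, smul_eq_mul]
  filter_upwards [hae, h2, ae_all_iff.2 hC] with z h3 h4 h5
  refine tendsto_nhds_unique h3 ?_
  simp only [h4]
  exact (summable_expansion hw h5).hasSum.tendsto_sum_nat.comp hns.tendsto_atTop

theorem ae_eq_tsum_coeff (B : HilbertBasis ℕ ℝ (Lp ℝ 2 μ))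
    (hB : ∀ j, (B j : X → ℝ) =ᵐ[μ] e j) {C : ℝ} (hC : ∀ j, ∀ᵐ x ∂μ, |e j x| ≤ C)
    {f : X → ℝ} (hf : MemLp f 2 μ) (hsum : Summable fun j => |coeff μ e f j|) :
    f =ᵐ[μ] fun z => ∑' j, coeff μ e f j * e j z := by
  have h := repr_symm_ae_eq_tsum B hB hC (B.repr (hf.toLp f))
    (by simpa only [repr_toLp B hB hf] using hsum)
  rw [LinearIsometryEquiv.symm_apply_apply] at h
  simp only [repr_toLp B hB hf] at h
  exact hf.coeFn_toLp.symm.trans h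

/-- Parseval's identity for the distance of `f` to an absolutely summable expansion. -/
theorem eLpNorm_sub_tsum_sq (B : HilbertBasis ℕ ℝ (Lp ℝ 2 μ))
    (hB : ∀ j, (B j : X → ℝ) =ᵐ[μ] e j) {C : ℝ} (hC : ∀ j, ∀ᵐ x ∂μ, |e j x| ≤ C)
    {f : X → ℝ} (hf : MemLp f 2 μ) {c : ℕ → ℝ} (hc : Summable fun j => |c j|) :
    eLpNorm (fun z => f z - ∑' j, c j * e j z) 2 μ ^ 2 =
      ENNReal.ofReal (∑' j, (coeff μ e f j - c j) ^ 2) := by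
  set w : SeqTwo := ⟨c, memℓp_two_of_summable_sq (summable_sq_of_summable_abs hc)⟩ with hw
  have hwc : ∀ j, w j = c j := fun _ => rfl
  have h1 := repr_symm_ae_eq_tsum B hB hC w hc
  have h2 : (fun z => f z - ∑' j, c j * e j z) =ᵐ[μ]
      ((hf.toLp f - B.repr.symm w : Lp ℝ 2 μ) : X → ℝ) := by
    filter_upwards [h1, hf.coeFn_toLp, Lp.coeFn_sub (hf.toLp f) (B.repr.symm w)] with z h3 h4 h5
    rw [h5, Pi.sub_apply, h3, h4]
  rw [eLpNorm_congr_ae h2, ← ENNReal.ofReal_toReal (Lp.eLpNorm_ne_top _), ← Lp.norm_def,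
    ← ENNReal.ofReal_pow (norm_nonneg _), ← B.repr.norm_map, map_sub,
    LinearIsometryEquiv.apply_symm_apply, sq_norm_seqTwo]
  congr 1
  refine tsum_congr fun j => ?_
  rw [lp.coeFn_sub, Pi.sub_apply, repr_toLp B hB hf, hwc]

end Expansion

/-! ### Concentration of the empirical correlations -/

/-- The empirical correlations of the `e j`, with each other and with the noise, are uniformly close
to their expectations. -/
def GoodSample {X : Type*} (e : ℕ → X → ℝ) (A : ℝ) {n : ℕ} (x : Fin n → X) (ε : Fin n → ℝ) : Prop :=
  (∀ j k, |1 / (n : ℝ) * ∑ i, e j (x i) * e k (x i) - if j = k then 1 else 0| ≤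
    A * √(Real.log (n * ((j : ℝ) + 1) * ((k : ℝ) + 1)) / n)) ∧
  ∀ j, |1 / (n : ℝ) * ∑ i, ε i * e j (x i)| ≤ A * √(Real.log (n * ((j : ℝ) + 1)) / n)

section Concentration

theorem measure_lt_abs_sum_le {Ω : Type*} [MeasurableSpace Ω] {P : Measure Ω}
    [IsProbabilityMeasure P] {Y : ℕ → Ω → ℝ} (hY : iIndepFun Y P) {c : ℝ≥0} (hc : 0 < c)
    (hsub : ∀ i, HasSubgaussianMGF (Y i) c P) {n : ℕ} (hn : 0 < n) {u : ℝ} (hu : 1 ≤ u) :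
    P {ω | √(4 * c * n * Real.log u) < |∑ i ∈ Finset.range n, Y i ω|} ≤
      ENNReal.ofReal (2 * u⁻¹ ^ 2) := by
  have hlog : 0 ≤ Real.log u := Real.log_nonneg hu
  have hn' : (0 : ℝ) < n := Nat.cast_pos.2 hn
  have hc' : (0 : ℝ) < c := hc
  have hval : Real.exp (-√(4 * c * n * Real.log u) ^ 2 / (2 * n * c)) = u⁻¹ ^ 2 := by
    rw [Real.sq_sqrt (by positivity), inv_pow, ← Real.exp_log (show 0 < u ^ 2 by positivity),
      ← Real.exp_neg, Real.log_pow]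
    congr 1
    push_cast
    field_simp
    ring
  have h1 := HasSubgaussianMGF.measure_sum_range_ge_le_of_iIndepFun hY (n := n)
    (fun i _ => hsub i) (Real.sqrt_nonneg (4 * c * n * Real.log u))
  have hYneg : iIndepFun (fun i ω => -Y i ω) P := hY.comp (fun _ r => -r) fun _ => measurable_neg
  have h2 := HasSubgaussianMGF.measure_sum_range_ge_le_of_iIndepFun hYneg (n := n)
    (fun i _ => (hsub i).neg) (Real.sqrt_nonneg (4 * c * n * Real.log u))
  rw [hval] at h1 h2
  have hcover : {ω | √(4 * c * n * Real.log u) < |∑ i ∈ Finset.range n, Y i ω|} ⊆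
      {ω | √(4 * c * n * Real.log u) ≤ ∑ i ∈ Finset.range n, Y i ω} ∪
      {ω | √(4 * c * n * Real.log u) ≤ ∑ i ∈ Finset.range n, -Y i ω} := by
    intro ω hω
    have hω : √(4 * c * n * Real.log u) < |∑ i ∈ Finset.range n, Y i ω| := hω
    rcases lt_abs.1 hω with h | h
    · exact Or.inl (le_of_lt h)
    · right
      rw [Set.mem_ofPred_eq, Finset.sum_neg_distrib]
      exact le_of_lt h
  refine (measure_mono hcover).trans ((measure_union_le _ _).trans ?_)
  rw [two_mul, ENNReal.ofReal_add (by positivity) (by positivity)]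
  exact add_le_add ((ENNReal.le_ofReal_iff_toReal_le (measure_ne_top _ _) (by positivity)).2 h1)
    ((ENNReal.le_ofReal_iff_toReal_le (measure_ne_top _ _) (by positivity)).2 h2)

variable {X : Type*} [MeasurableSpace X] {μ : Measure X} [IsProbabilityMeasure μ]
  {κ : Kernel X ℝ} [IsMarkovKernel κ] {σ : ℝ≥0}

theorem hasSubgaussianMGF_noise_mul (hκ : IsSubGaussianNoise μ κ σ) {f : X → ℝ}
    (hf : Measurable f) {C : ℝ≥0} (hC : ∀ x, |f x| ≤ C) :
    HasSubgaussianMGF (fun p : X × ℝ => p.2 * f p.1) (σ ^ 2 * C ^ 2) (μ ⊗ₘ κ) := by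
  have hmeas : ∀ t : ℝ, Measurable fun p : X × ℝ => Real.exp (t * (p.2 * f p.1)) := by
    intro t
    fun_prop
  have hle : ∀ t : ℝ, ∫⁻ p, ENNReal.ofReal (Real.exp (t * (p.2 * f p.1))) ∂(μ ⊗ₘ κ) ≤
      ENNReal.ofReal (Real.exp ((σ ^ 2 * C ^ 2 : ℝ≥0) * t ^ 2 / 2)) := by
    intro t
    rw [Measure.lintegral_compProd (hmeas t).ennreal_ofReal]
    calc _ ≤ ∫⁻ _, ENNReal.ofReal (Real.exp ((σ ^ 2 * C ^ 2 : ℝ≥0) * t ^ 2 / 2)) ∂μ := by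
          refine lintegral_mono_ae ?_
          filter_upwards [hκ] with x hx
          have h1 : ∀ z, Real.exp (t * (z * f x)) = Real.exp (t * f x * z) := fun z => by
            congr 1; ring
          simp only [h1]
          rw [← ofReal_integral_eq_lintegral_ofReal (hx.integrable_exp_mul _)
            (Eventually.of_forall fun _ => (Real.exp_pos _).le)]
          refine ENNReal.ofReal_le_ofReal ((hx.mgf_le (t * f x)).trans ?_)
          refine Real.exp_le_exp.2 ?_
          have h2 : f x ^ 2 ≤ (C : ℝ) ^ 2 := sq_le_sq.2 (by simpa using hC x)
          push_cast
          have h3 : (σ : ℝ) ^ 2 * t ^ 2 * f x ^ 2 ≤ (σ : ℝ) ^ 2 * t ^ 2 * C ^ 2 := by gcongr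
          nlinarith
      _ = _ := by simp
  have hint : ∀ t : ℝ, Integrable (fun p : X × ℝ => Real.exp (t * (p.2 * f p.1))) (μ ⊗ₘ κ) := by
    intro t
    refine ⟨(hmeas t).aestronglyMeasurable, ?_⟩
    rw [hasFiniteIntegral_iff_ofReal (Eventually.of_forall fun _ => (Real.exp_pos _).le)]
    exact (hle t).trans_lt ENNReal.ofReal_lt_top
  refine ⟨hint, fun t => ?_⟩
  rw [mgf, ← ENNReal.ofReal_le_ofReal_iff (Real.exp_pos _).le,
    ofReal_integral_eq_lintegral_ofReal (hint t)
      (Eventually.of_forall fun _ => (Real.exp_pos _).le)]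
  exact hle t

theorem hasSubgaussianMGF_mul_sub {f g : X → ℝ} (hf : Measurable f) (hg : Measurable g) {C : ℝ≥0}
    (hfC : ∀ x, |f x| ≤ C) (hgC : ∀ x, |g x| ≤ C) {m : ℝ} (hm : |m| ≤ 1)
    (hint : ∫ x, f x * g x ∂μ = m) :
    HasSubgaussianMGF (fun p : X × ℝ => f p.1 * g p.1 - m) ((C ^ 2 + 1) ^ 2) (μ ⊗ₘ κ) := by
  have hbd : ∀ x, |f x * g x| ≤ (C : ℝ) ^ 2 := fun x => by
    rw [abs_mul, sq]
    exact mul_le_mul (hfC x) (hgC x) (abs_nonneg _) C.2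
  have hintegrable : Integrable (fun x => f x * g x) μ :=
    Integrable.of_bound (hf.mul hg).aestronglyMeasurable _ (Eventually.of_forall hbd)
  have h1 : HasSubgaussianMGF (fun x => f x * g x - m) ((C ^ 2 + 1) ^ 2) μ := by
    have h2 := hasSubgaussianMGF_of_mem_Icc_of_integral_eq_zero (μ := μ)
      (X := fun x => f x * g x - m) (a := -((C : ℝ) ^ 2 + 1)) (b := (C : ℝ) ^ 2 + 1)
      ((hf.mul hg).sub_const m).aemeasurable (Eventually.of_forall fun x => by
        have h3 := abs_le.1 (hbd x)
        have h4 := abs_le.1 hm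
        exact ⟨by linarith, by linarith⟩)
      (by rw [integral_sub hintegrable (integrable_const m), hint]; simp)
    have hpar : (‖((C : ℝ) ^ 2 + 1) - -((C : ℝ) ^ 2 + 1)‖₊ / 2) ^ 2 = (C ^ 2 + 1) ^ 2 := by
      congr 1
      ext
      push_cast
      rw [sub_neg_eq_add, Real.norm_of_nonneg (by positivity)]
      ring
    rwa [hpar] at h2
  have h5 : (μ ⊗ₘ κ).map Prod.fst = μ := Measure.fst_compProd μ κ
  have h6 : HasSubgaussianMGF (fun x => f x * g x - m) ((C ^ 2 + 1) ^ 2)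
      ((μ ⊗ₘ κ).map Prod.fst) := by rwa [h5]
  exact HasSubgaussianMGF.of_map measurable_fst.aemeasurable h6

variable {Ω : Type*} [MeasurableSpace Ω] {P : Measure Ω} [IsProbabilityMeasure P]
  {x : ℕ → Ω → X} {ε : ℕ → Ω → ℝ}

omit [IsProbabilityMeasure μ] [IsMarkovKernel κ] in
theorem IsSample.measure_lt_abs_sum_le (hS : IsSample P μ κ x ε) {φ : X × ℝ → ℝ}
    (hφ : Measurable φ) {c : ℝ≥0} (hc : 0 < c) (hsub : HasSubgaussianMGF φ c (μ ⊗ₘ κ))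
    {n : ℕ} (hn : 0 < n) {u : ℝ} (hu : 1 ≤ u) :
    P {ω | 2 * √c * √(Real.log u / n) < |1 / (n : ℝ) * ∑ i : Fin n, φ (x i ω, ε i ω)|} ≤
      ENNReal.ofReal (2 * u⁻¹ ^ 2) := by
  have h := AdaptiveKernel.measure_lt_abs_sum_le (P := P) (Y := fun i ω => φ (x i ω, ε i ω))
    (hS.indep.comp (fun _ => φ) fun _ => hφ) hc (fun i => by
      have h1 : HasSubgaussianMGF φ c (P.map fun ω => (x i ω, ε i ω)) := by
        rwa [(hS.law i).map_eq]
      exact HasSubgaussianMGF.of_map (hS.law i).aemeasurable h1) hn hu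
  refine (measure_mono fun ω hω => ?_).trans h
  have hn' : (0 : ℝ) < n := Nat.cast_pos.2 hn
  have hω : 2 * √c * √(Real.log u / n) < |1 / (n : ℝ) * ∑ i : Fin n, φ (x i ω, ε i ω)| := hω
  rw [abs_mul, abs_of_pos (by positivity : 0 < 1 / (n : ℝ)),
    Fin.sum_univ_eq_sum_range (fun i => φ (x i ω, ε i ω)) n] at hω
  rw [Set.mem_ofPred_eq]
  have hsq : √(4 * c * n * Real.log u) = n * (2 * √c * √(Real.log u / n)) := by
    rw [show 4 * (c : ℝ) * n * Real.log u = (n * 2) ^ 2 * (c * (Real.log u / n)) by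
      field_simp; ring, Real.sqrt_mul (by positivity), Real.sqrt_sq (by positivity),
      Real.sqrt_mul (NNReal.coe_nonneg c)]
    ring
  rw [hsq]
  calc _ < n * (1 / n * |∑ i ∈ Finset.range n, φ (x i ω, ε i ω)|) :=
        mul_lt_mul_of_pos_left hω hn'
    _ = _ := by field_simp

omit [IsProbabilityMeasure P] in
theorem IsSample.ae_forall (hS : IsSample P μ κ x ε) {p : X → Prop} (hp : ∀ᵐ z ∂μ, p z) :
    ∀ᵐ ω ∂P, ∀ i, p (x i ω) := by
  refine ae_all_iff.2 fun i => ?_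
  have h1 : ∀ᵐ q ∂(μ ⊗ₘ κ), p q.1 := by
    have h5 : (μ ⊗ₘ κ).map Prod.fst = μ := Measure.fst_compProd μ κ
    refine ae_of_ae_map measurable_fst.aemeasurable ?_
    rwa [h5]
  rw [← (hS.law i).map_eq] at h1
  exact ae_of_ae_map (hS.law i).aemeasurable h1

omit [IsProbabilityMeasure μ] in
theorem exists_measurable_bounded {f : X → ℝ} (hf : AEStronglyMeasurable f μ) {C : ℝ≥0}
    (hC : ∀ᵐ x ∂μ, |f x| ≤ C) : ∃ g : X → ℝ, Measurable g ∧ (∀ x, |g x| ≤ C) ∧ f =ᵐ[μ] g := by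
  refine ⟨fun x => max (-C) (min C (hf.mk f x)), ?_, fun x => ?_, ?_⟩
  · exact measurable_const.max (measurable_const.min hf.stronglyMeasurable_mk.measurable)
  · have : (0 : ℝ) ≤ C := C.2
    exact abs_le.2 ⟨le_max_left _ _, max_le (by linarith) (min_le_left _ _)⟩
  · filter_upwards [hf.ae_eq_mk, hC] with x h1 h2
    rw [← h1, min_eq_right (abs_le.1 h2).2, max_eq_right (abs_le.1 h2).1]

theorem summable_inv_sq : Summable fun j : ℕ => ((j : ℝ) + 1)⁻¹ ^ 2 := by
  have := (summable_nat_add_iff 1).2 (Real.summable_nat_pow_inv (p := 2) |>.2 one_lt_two)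
  simpa using this

theorem measure_not_goodSample_le_of_measurable (hκ : IsSubGaussianNoise μ κ σ)
    (hS : IsSample P μ κ x ε) {e : ℕ → X → ℝ} (he : ∀ j, Measurable (e j)) {C : ℝ≥0}
    (hC : ∀ j z, |e j z| ≤ C)
    (hint : ∀ j k, ∫ z, e j z * e k z ∂μ = if j = k then 1 else 0) :
    ∃ A > 0, ∃ K, ∀ n : ℕ, 0 < n →
      P {ω | ¬ GoodSample e A (fun i : Fin n => x i ω) (fun i : Fin n => ε i ω)} ≤
        ENNReal.ofReal (K / (n : ℝ) ^ 2) := by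
  set c : ℝ≥0 := (C ^ 2 + 1) ^ 2 + σ ^ 2 * C ^ 2 with hc
  have hc0 : 0 < c := by positivity
  have hmono : ∀ {c' : ℝ≥0} {φ : X × ℝ → ℝ}, c' ≤ c → HasSubgaussianMGF φ c' (μ ⊗ₘ κ) →
      HasSubgaussianMGF φ c (μ ⊗ₘ κ) := fun hle h => ⟨h.integrable_exp_mul, fun t =>
    (h.mgf_le t).trans (Real.exp_le_exp.2 (by gcongr))⟩
  have hS2 := summable_inv_sq
  have hS4 : Summable fun q : ℕ × ℕ => ((q.1 : ℝ) + 1)⁻¹ ^ 2 * ((q.2 : ℝ) + 1)⁻¹ ^ 2 :=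
    hS2.mul_of_nonneg hS2 (fun _ => by positivity) (fun _ => by positivity)
  refine ⟨2 * √c, by positivity, 2 * (∑' q : ℕ × ℕ, ((q.1 : ℝ) + 1)⁻¹ ^ 2 * ((q.2 : ℝ) + 1)⁻¹ ^ 2) +
    2 * ∑' j : ℕ, ((j : ℝ) + 1)⁻¹ ^ 2, fun n hn => ?_⟩
  have hn' : (0 : ℝ) < n := Nat.cast_pos.2 hn
  have hn1 : (1 : ℝ) ≤ n := Nat.one_le_cast.2 hn
  have hj1 : ∀ j : ℕ, (1 : ℝ) ≤ n * ((j : ℝ) + 1) := fun j =>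
    one_le_mul_of_one_le_of_one_le hn1 (by linarith [(Nat.cast_nonneg j : (0 : ℝ) ≤ j)])
  have hjk1 : ∀ j k : ℕ, (1 : ℝ) ≤ n * ((j : ℝ) + 1) * ((k : ℝ) + 1) := fun j k =>
    one_le_mul_of_one_le_of_one_le (hj1 j) (by linarith [(Nat.cast_nonneg k : (0 : ℝ) ≤ k)])
  set S₁ : ℕ × ℕ → Set Ω := fun q => {ω |
    2 * √c * √(Real.log (n * ((q.1 : ℝ) + 1) * ((q.2 : ℝ) + 1)) / n) <
      |1 / (n : ℝ) * ∑ i : Fin n,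
        (e q.1 (x i ω) * e q.2 (x i ω) - if q.1 = q.2 then 1 else 0)|} with hS₁
  set S₂ : ℕ → Set Ω := fun j => {ω | 2 * √c * √(Real.log (n * ((j : ℝ) + 1)) / n) <
      |1 / (n : ℝ) * ∑ i : Fin n, ε i ω * e j (x i ω)|} with hS₂
  have h1 : ∀ q, P (S₁ q) ≤ ENNReal.ofReal
      (2 / (n : ℝ) ^ 2 * (((q.1 : ℝ) + 1)⁻¹ ^ 2 * ((q.2 : ℝ) + 1)⁻¹ ^ 2)) := by
    intro q
    refine (hS.measure_lt_abs_sum_le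
      (φ := fun p => e q.1 p.1 * e q.2 p.1 - if q.1 = q.2 then 1 else 0)
      ((((he q.1).comp measurable_fst).mul ((he q.2).comp measurable_fst)).sub_const _) hc0
      (hmono le_self_add (hasSubgaussianMGF_mul_sub (he q.1) (he q.2) (hC q.1) (hC q.2)
        (by split_ifs <;> simp) (hint q.1 q.2))) hn (hjk1 q.1 q.2)).trans
      (ENNReal.ofReal_le_ofReal (le_of_eq ?_))
    rw [mul_inv, mul_inv, mul_pow, mul_pow]
    ring
  have h2 : ∀ j, P (S₂ j) ≤ ENNReal.ofReal (2 / (n : ℝ) ^ 2 * ((j : ℝ) + 1)⁻¹ ^ 2) := by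
    intro j
    refine (hS.measure_lt_abs_sum_le (φ := fun p => p.2 * e j p.1)
      (measurable_snd.mul ((he j).comp measurable_fst)) hc0
      (hmono le_add_self (hasSubgaussianMGF_noise_mul hκ (he j) (hC j))) hn (hj1 j)).trans
      (ENNReal.ofReal_le_ofReal (le_of_eq ?_))
    rw [mul_inv, mul_pow]
    ring
  have hcover : {ω | ¬ GoodSample e (2 * √c) (fun i : Fin n => x i ω) (fun i : Fin n => ε i ω)} ⊆
      (⋃ q, S₁ q) ∪ ⋃ j, S₂ j := by
    intro ω hω
    by_contra hcon
    simp only [Set.mem_union, Set.mem_iUnion, not_or, not_exists] at hcon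
    refine hω ⟨fun j k => ?_, fun j => not_lt.1 (hcon.2 j)⟩
    have h4 : |1 / (n : ℝ) * ∑ i : Fin n,
        (e j (x i ω) * e k (x i ω) - if j = k then 1 else 0)| ≤
        2 * √c * √(Real.log (n * ((j : ℝ) + 1) * ((k : ℝ) + 1)) / n) := not_lt.1 (hcon.1 (j, k))
    simp only [Finset.sum_sub_distrib, Finset.sum_const, Finset.card_univ, Fintype.card_fin,
      nsmul_eq_mul, mul_sub] at h4
    rwa [← mul_assoc, one_div_mul_cancel hn'.ne', one_mul] at h4
  refine (measure_mono hcover).trans ((measure_union_le _ _).trans ?_)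
  have h5 : P (⋃ q, S₁ q) ≤ ENNReal.ofReal (2 / (n : ℝ) ^ 2 *
      ∑' q : ℕ × ℕ, ((q.1 : ℝ) + 1)⁻¹ ^ 2 * ((q.2 : ℝ) + 1)⁻¹ ^ 2) := by
    refine (measure_iUnion_le _).trans ((ENNReal.tsum_le_tsum h1).trans (le_of_eq ?_))
    rw [← ENNReal.ofReal_tsum_of_nonneg (fun _ => by positivity) (hS4.mul_left _), tsum_mul_left]
  have h6 : P (⋃ j, S₂ j) ≤ ENNReal.ofReal (2 / (n : ℝ) ^ 2 * ∑' j : ℕ, ((j : ℝ) + 1)⁻¹ ^ 2) := by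
    refine (measure_iUnion_le _).trans ((ENNReal.tsum_le_tsum h2).trans (le_of_eq ?_))
    rw [← ENNReal.ofReal_tsum_of_nonneg (fun _ => by positivity) (hS2.mul_left _), tsum_mul_left]
  refine (add_le_add h5 h6).trans ?_
  rw [← ENNReal.ofReal_add (by positivity) (by positivity)]
  exact ENNReal.ofReal_le_ofReal (le_of_eq (by ring))

theorem measure_not_goodSample_le (hκ : IsSubGaussianNoise μ κ σ) (hS : IsSample P μ κ x ε)
    {e : ℕ → X → ℝ} (he : ∀ j, AEStronglyMeasurable (e j) μ) {C : ℝ≥0}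
    (hC : ∀ j, ∀ᵐ z ∂μ, |e j z| ≤ C)
    (hint : ∀ j k, ∫ z, e j z * e k z ∂μ = if j = k then 1 else 0) :
    ∃ A > 0, ∃ K, ∀ n : ℕ, 0 < n →
      P {ω | ¬ GoodSample e A (fun i : Fin n => x i ω) (fun i : Fin n => ε i ω)} ≤
        ENNReal.ofReal (K / (n : ℝ) ^ 2) := by
  choose g hg hgC hge using fun j => exists_measurable_bounded (he j) (hC j)
  obtain ⟨A, hA, K, hK⟩ := measure_not_goodSample_le_of_measurable hκ hS hg hgC fun j k => by
    rw [← hint j k]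
    exact integral_congr_ae ((hge j).symm.mul (hge k).symm)
  refine ⟨A, hA, K, fun n hn => le_trans (measure_mono_ae ?_) (hK n hn)⟩
  filter_upwards [hS.ae_forall (ae_all_iff.2 hge)] with ω hω hbad
  intro hgood
  refine hbad ?_
  simp only [GoodSample] at hgood ⊢
  simpa only [hω] using hgood

end Concentration

/-! ### Consequences of the misalignment model -/

section Misalignment

theorem sum_Ico_inv_sq_le {M N : ℕ} (h : M ≤ N) :
    ∑ i ∈ Finset.Ico M N, ((i : ℝ) + 1)⁻¹ ^ 2 ≤ 2 / ((M : ℝ) + 1) - 2 / ((N : ℝ) + 1) := by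
  induction N, h using Nat.le_induction with
  | base => simp
  | succ N hMN ih =>
    rw [Finset.sum_Ico_succ_top hMN]
    have hN : (0 : ℝ) ≤ N := Nat.cast_nonneg N
    have : ((N : ℝ) + 1)⁻¹ ^ 2 ≤ 2 / ((N : ℝ) + 1) - 2 / ((N : ℝ) + 1 + 1) := by
      rw [div_sub_div _ _ (by positivity) (by positivity), inv_pow, ← one_div,
        div_le_div_iff₀ (by positivity) (by positivity)]
      nlinarith
    push_cast
    linarith

/-- The tail of the series `∑ (i + 1) ^ (-(p + 1))`. -/
theorem tsum_tail_rpow_le {p : ℝ} (hp : 1 < p) {m : ℝ} (hm : 0 < m) {M : ℕ} (hM : m ≤ M + 1) :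
    Summable (fun i : ℕ => if M ≤ i then ((i : ℝ) + 1) ^ (-(p + 1)) else 0) ∧
    ∑' i : ℕ, (if M ≤ i then ((i : ℝ) + 1) ^ (-(p + 1)) else 0) ≤ 2 * m ^ (-p) := by
  have hterm : ∀ i : ℕ, (if M ≤ i then ((i : ℝ) + 1) ^ (-(p + 1)) else 0) ≤
      m ^ (-(p - 1)) * (if M ≤ i then ((i : ℝ) + 1)⁻¹ ^ 2 else 0) := by
    intro i
    split_ifs with h
    · have hi : m ≤ (i : ℝ) + 1 := hM.trans (by
        have : (M : ℝ) ≤ i := Nat.cast_le.2 h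
        linarith)
      have hi0 : 0 < (i : ℝ) + 1 := by positivity
      rw [show -(p + 1) = -(p - 1) + -2 by ring, Real.rpow_add hi0]
      refine mul_le_mul (Real.rpow_le_rpow_of_nonpos hm hi (by linarith)) (le_of_eq ?_)
        (by positivity) (by positivity)
      rw [Real.rpow_neg hi0.le, inv_pow, Real.rpow_ofNat]
    · simp
  have hbound : ∀ s : Finset ℕ,
      ∑ i ∈ s, (if M ≤ i then ((i : ℝ) + 1) ^ (-(p + 1)) else 0) ≤ 2 * m ^ (-p) := by
    intro s
    obtain ⟨N, hN⟩ := s.exists_nat_subset_range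
    calc ∑ i ∈ s, (if M ≤ i then ((i : ℝ) + 1) ^ (-(p + 1)) else 0)
        ≤ ∑ i ∈ s, m ^ (-(p - 1)) * (if M ≤ i then ((i : ℝ) + 1)⁻¹ ^ 2 else 0) :=
          Finset.sum_le_sum fun i _ => hterm i
      _ = m ^ (-(p - 1)) * ∑ i ∈ s.filter (M ≤ ·), ((i : ℝ) + 1)⁻¹ ^ 2 := by
          rw [← Finset.mul_sum, Finset.sum_filter]
      _ ≤ m ^ (-(p - 1)) * ∑ i ∈ Finset.Ico M (max M N), ((i : ℝ) + 1)⁻¹ ^ 2 := by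
          refine mul_le_mul_of_nonneg_left (Finset.sum_le_sum_of_subset_of_nonneg ?_
            fun _ _ _ => by positivity) (by positivity)
          intro i hi
          rw [Finset.mem_filter] at hi
          have := Finset.mem_range.1 (hN hi.1)
          exact Finset.mem_Ico.2 ⟨hi.2, this.trans_le (le_max_right _ _)⟩
      _ ≤ m ^ (-(p - 1)) * (2 / m) := by
          refine mul_le_mul_of_nonneg_left ((sum_Ico_inv_sq_le (le_max_left M N)).trans ?_)
            (by positivity)
          have h1 : 2 / ((M : ℝ) + 1) ≤ 2 / m := by gcongr
          have h2 : 0 ≤ 2 / (((max M N : ℕ) : ℝ) + 1) := by positivity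
          linarith
      _ = 2 * m ^ (-p) := by
          rw [show -p = -(p - 1) + -1 by ring, Real.rpow_add hm, Real.rpow_neg_one]
          ring
  have hnn : ∀ i : ℕ, 0 ≤ (if M ≤ i then ((i : ℝ) + 1) ^ (-(p + 1)) else 0) := fun i => by
    split_ifs <;> positivity
  have hs := summable_of_sum_le hnn hbound
  exact ⟨hs, hs.tsum_le_of_sum_le hbound⟩

/-- The logarithmic weight. -/
noncomputable def logWeight (k : ℕ) : ℝ := √(1 + Real.log ((k : ℝ) + 1))

theorem log_succ_nonneg (k : ℕ) : 0 ≤ Real.log ((k : ℝ) + 1) :=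
  Real.log_nonneg (by linarith [(Nat.cast_nonneg k : (0 : ℝ) ≤ k)])

theorem one_le_logWeight (k : ℕ) : 1 ≤ logWeight k := by
  rw [logWeight, Real.one_le_sqrt]
  linarith [log_succ_nonneg k]

theorem logWeight_le {η : ℝ} (hη : 0 < η) (k : ℕ) :
    logWeight k ≤ (1 + 1 / η) * ((k : ℝ) + 1) ^ η := by
  have hk : (1 : ℝ) ≤ (k : ℝ) + 1 := by linarith [(Nat.cast_nonneg k : (0 : ℝ) ≤ k)]
  have h1 := Real.log_le_rpow_div (zero_le_one.trans hk) hη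
  have h2 := Real.one_le_rpow hk hη.le
  have h3 := log_succ_nonneg k
  calc logWeight k ≤ 1 + Real.log ((k : ℝ) + 1) :=
        (Real.sqrt_le_left (by linarith)).2 (by nlinarith)
    _ ≤ ((k : ℝ) + 1) ^ η + ((k : ℝ) + 1) ^ η / η := add_le_add h2 h1
    _ = _ := by ring

variable {θ : ℕ → ℝ} {p q : ℝ}

theorem one_lt_of_misaligned (hp : 0 < p) (hmis : Misaligned θ p q) (hfast : FastDecay θ) :
    1 < p := by
  obtain ⟨ℓ, hinj, -, -, ⟨c, hc, C, hC, hθ⟩, -⟩ := hmis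
  obtain ⟨s₀, hs₀, B, hB, hfast⟩ := hfast
  by_contra! hp1
  set r := (p + 1) / 2 * (1 - s₀) with hr
  have hr1 : r < 1 := by
    rcases le_or_gt 0 (1 - s₀) with h | h <;> nlinarith
  rw [eventually_top] at hθ
  have key : ∀ m : ℕ, 0 < m → (m : ℝ) ^ (1 - r) ≤ B * c ^ (-(1 - s₀)) := by
    intro m hm
    have hm0 : (0 : ℝ) < m := Nat.cast_pos.2 hm
    obtain ⟨hfin, hcard⟩ := hfast (c * (m : ℝ) ^ (-(p + 1) / 2)) (by positivity)
    have hsub : ((Finset.range m).image ℓ : Set ℕ) ⊆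
        {j | c * (m : ℝ) ^ (-(p + 1) / 2) ≤ |θ j|} := by
      intro j hj
      obtain ⟨i, hi, rfl⟩ := Finset.mem_image.1 (Finset.mem_coe.1 hj)
      refine le_trans ?_ (hθ i).1
      have : (i : ℝ) + 1 ≤ m := by exact_mod_cast Finset.mem_range.1 hi
      exact mul_le_mul_of_nonneg_left
        (Real.rpow_le_rpow_of_nonpos (by positivity) this (by linarith)) hc.le
    have h1 := Set.ncard_le_ncard hsub hfin
    rw [Set.ncard_coe_finset, Finset.card_image_of_injective _ hinj, Finset.card_range] at h1
    have h2 : (m : ℝ) ≤ B * (c * (m : ℝ) ^ (-(p + 1) / 2)) ^ (-(1 - s₀)) :=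
      le_trans (by exact_mod_cast h1) hcard
    rw [Real.mul_rpow hc.le (by positivity), ← Real.rpow_mul hm0.le,
      show -(p + 1) / 2 * -(1 - s₀) = r by rw [hr]; ring] at h2
    rw [Real.rpow_sub hm0, Real.rpow_one, div_le_iff₀ (by positivity)]
    linarith
  have htend : Tendsto (fun m : ℕ => (m : ℝ) ^ (1 - r)) atTop atTop :=
    (tendsto_rpow_atTop (by linarith)).comp tendsto_natCast_atTop_atTop
  obtain ⟨m, hm, hm0⟩ := ((htend.eventually_gt_atTop (B * c ^ (-(1 - s₀)))).and
    (eventually_gt_atTop 0)).exists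
  exact absurd (key m hm0) (not_le.2 hm)

theorem summable_logWeight_mul_abs (hp : 1 < p) (hq : 1 ≤ q) (hmis : Misaligned θ p q) :
    Summable fun j => logWeight j * |θ j| := by
  obtain ⟨ℓ, hinj, -, hzero, ⟨c, hc, C, hC, hθ⟩, ⟨c', hc', C', hC', hℓ⟩⟩ := hmis
  rw [eventually_top] at hθ hℓ
  rw [← hinj.summable_iff (fun j hj => by simp [hzero j hj])]
  set η := (p - 1) / (4 * q) with hη
  have hη0 : 0 < η := div_pos (by linarith) (by linarith)
  have hqη : q * η = (p - 1) / 4 := by rw [hη]; field_simp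
  have hmain : Summable fun i : ℕ =>
      (1 + 1 / η) * (C' ^ η * C) * ((i : ℝ) + 1) ^ (-((p + 3) / 4)) := by
    refine Summable.mul_left _ ?_
    have := (summable_nat_add_iff 1).2
      (Real.summable_nat_rpow.2 (show -((p + 3) / 4) < -1 by linarith))
    simpa using this
  refine Summable.of_nonneg_of_le (fun i => mul_nonneg
    (zero_le_one.trans (one_le_logWeight _)) (abs_nonneg _)) (fun i => ?_) hmain
  have hi : (0 : ℝ) < (i : ℝ) + 1 := by positivity
  calc logWeight (ℓ i) * |θ (ℓ i)|
      ≤ ((1 + 1 / η) * ((ℓ i : ℝ) + 1) ^ η) * (C * ((i : ℝ) + 1) ^ (-(p + 1) / 2)) :=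
        mul_le_mul (logWeight_le hη0 _) (hθ i).2 (abs_nonneg _) (by positivity)
    _ ≤ ((1 + 1 / η) * (C' * ((i : ℝ) + 1) ^ q) ^ η) * (C * ((i : ℝ) + 1) ^ (-(p + 1) / 2)) := by
        gcongr
        exact (hℓ i).2
    _ = (1 + 1 / η) * (C' ^ η * C) *
        (((i : ℝ) + 1) ^ (q * η) * ((i : ℝ) + 1) ^ (-(p + 1) / 2)) := by
        rw [Real.mul_rpow hC'.le (by positivity), ← Real.rpow_mul hi.le]
        ring
    _ = _ := by
        rw [← Real.rpow_add hi, hqη]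
        congr 2
        ring

/-- The set of indices which carry the signal at sample size `n`. -/
theorem exists_head (hp : 1 < p) (hq : 1 ≤ q) (hmis : Misaligned θ p q) {ρ : ℝ}
    (hρ : ρ ≤ 1 / (p + 1)) :
    ∃ C > 0, ∀ n : ℕ, 0 < n → ∃ s : Finset ℕ, (s.card : ℝ) ≤ C * (n : ℝ) ^ (1 / (p + 1)) ∧
      (∀ j ∈ s, (j : ℝ) + 1 ≤ C * (n : ℝ) ^ q) ∧
      (∀ j ∉ s, (n : ℝ) ^ ρ < (j : ℝ) + 1 ∧ |θ j| ≤ (n : ℝ) ^ (-(1 / 2) : ℝ)) ∧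
      Summable (fun j => if j ∈ s then 0 else θ j ^ 2) ∧
      ∑' j, (if j ∈ s then 0 else θ j ^ 2) ≤ C * (n : ℝ) ^ (-(p / (p + 1))) := by
  obtain ⟨ℓ, hinj, -, hzero, ⟨c, hc, C, hC, hθ⟩, ⟨c', hc', C', hC', hℓ⟩⟩ := hmis
  rw [eventually_top] at hθ hℓ
  have hp1 : 0 < p + 1 := by linarith
  set H := C ^ (2 / (p + 1)) with hH
  have hH0 : 0 < H := by positivity
  refine ⟨1 + H + C' * (H ^ q + 1) + C ^ 2 * (2 * H ^ (-p)), by positivity, fun n hn => ?_⟩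
  have hn0 : (0 : ℝ) < n := Nat.cast_pos.2 hn
  have hn1 : (1 : ℝ) ≤ n := Nat.one_le_cast.2 hn
  set m := H * (n : ℝ) ^ (1 / (p + 1)) with hm
  have hm0 : 0 < m := by positivity
  have hle_n : ∀ r : ℝ, r ≤ 1 → (n : ℝ) ^ r ≤ n := fun r hr => by
    simpa using Real.rpow_le_rpow_of_exponent_le hn1 hr
  have hp1' : 1 / (p + 1) ≤ 1 := (div_le_one hp1).2 (by linarith)
  have hnq : (n : ℝ) ≤ (n : ℝ) ^ q := by simpa using Real.rpow_le_rpow_of_exponent_le hn1 hq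
  set M := ⌊m⌋₊ with hM
  have hMlt : m < M + 1 := Nat.lt_floor_add_one m
  have hMle : (M : ℝ) ≤ m := Nat.floor_le hm0.le
  refine ⟨Finset.range ⌊(n : ℝ) ^ ρ⌋₊ ∪ (Finset.range M).image ℓ, ?_, ?_, ?_, ?_⟩
  · have h1 : ((Finset.range ⌊(n : ℝ) ^ ρ⌋₊ ∪ (Finset.range M).image ℓ).card : ℝ) ≤
        (⌊(n : ℝ) ^ ρ⌋₊ : ℝ) + M := by
      have := (Finset.card_union_le (Finset.range ⌊(n : ℝ) ^ ρ⌋₊) ((Finset.range M).image ℓ)).trans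
        (add_le_add le_rfl Finset.card_image_le)
      rw [Finset.card_range, Finset.card_range] at this
      exact_mod_cast this
    have h2 : (⌊(n : ℝ) ^ ρ⌋₊ : ℝ) ≤ (n : ℝ) ^ (1 / (p + 1)) :=
      (Nat.floor_le (by positivity)).trans (Real.rpow_le_rpow_of_exponent_le hn1 hρ)
    calc _ ≤ (n : ℝ) ^ (1 / (p + 1)) + H * (n : ℝ) ^ (1 / (p + 1)) := by linarith
      _ = (1 + H) * (n : ℝ) ^ (1 / (p + 1)) := by ring
      _ ≤ _ := by
        have : 0 ≤ C' * (H ^ q + 1) + C ^ 2 * (2 * H ^ (-p)) := by positivity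
        exact mul_le_mul_of_nonneg_right (by linarith) (by positivity)
  · intro j hj
    rcases Finset.mem_union.1 hj with hj | hj
    · have h1 : ((j + 1 : ℕ) : ℝ) ≤ (n : ℝ) ^ ρ :=
        (Nat.le_floor_iff (by positivity)).1 (Nat.succ_le_of_lt (Finset.mem_range.1 hj))
      push_cast at h1
      have h2 := hle_n ρ (hρ.trans hp1')
      have h3 : 0 ≤ (H + C' * (H ^ q + 1) + C ^ 2 * (2 * H ^ (-p))) * (n : ℝ) ^ q := by positivity
      linarith
    · obtain ⟨i, hi, rfl⟩ := Finset.mem_image.1 hj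
      have h1 : (i : ℝ) + 1 ≤ m := le_trans (by exact_mod_cast Finset.mem_range.1 hi) hMle
      calc (ℓ i : ℝ) + 1 ≤ C' * ((i : ℝ) + 1) ^ q := (hℓ i).2
        _ ≤ C' * m ^ q := by gcongr
        _ = C' * H ^ q * ((n : ℝ) ^ (1 / (p + 1))) ^ q := by
            rw [hm, Real.mul_rpow hH0.le (by positivity)]; ring
        _ ≤ C' * H ^ q * (n : ℝ) ^ q := by
            gcongr
            exact hle_n _ hp1'
        _ ≤ _ := by
            gcongr
            have h2 : 0 ≤ C ^ 2 * (2 * H ^ (-p)) := by positivity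
            linarith
  · intro j hj
    rw [Finset.mem_union, not_or, Finset.mem_range, not_lt] at hj
    refine ⟨?_, ?_⟩
    · have h1 : (⌊(n : ℝ) ^ ρ⌋₊ : ℝ) ≤ j := Nat.cast_le.2 hj.1
      linarith [Nat.lt_floor_add_one ((n : ℝ) ^ ρ)]
    · by_cases hr : j ∈ Set.range ℓ
      · obtain ⟨i, rfl⟩ := hr
        have hi : M ≤ i := by
          by_contra! hlt
          exact hj.2 (Finset.mem_image_of_mem ℓ (Finset.mem_range.2 hlt))
        have h1 : m ≤ (i : ℝ) + 1 := by
          have : (M : ℝ) ≤ i := Nat.cast_le.2 hi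
          linarith
        calc |θ (ℓ i)| ≤ C * ((i : ℝ) + 1) ^ (-(p + 1) / 2) := (hθ i).2
          _ ≤ C * m ^ (-(p + 1) / 2) := mul_le_mul_of_nonneg_left
              (Real.rpow_le_rpow_of_nonpos hm0 h1 (by linarith)) hC.le
          _ = (n : ℝ) ^ (-(1 / 2) : ℝ) := by
              rw [hm, Real.mul_rpow hH0.le (by positivity), hH, ← Real.rpow_mul hC.le,
                ← Real.rpow_mul hn0.le, show 2 / (p + 1) * (-(p + 1) / 2) = -1 by field_simp,
                show 1 / (p + 1) * (-(p + 1) / 2) = (-(1 / 2) : ℝ) by field_simp,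
                Real.rpow_neg_one, ← mul_assoc, mul_inv_cancel₀ hC.ne', one_mul]
      · rw [hzero j hr, abs_zero]
        positivity
  · obtain ⟨hts, htb⟩ := tsum_tail_rpow_le hp hm0 hMlt.le
    set s := Finset.range ⌊(n : ℝ) ^ ρ⌋₊ ∪ (Finset.range M).image ℓ with hs
    set h : ℕ → ℝ := fun j => if j ∈ s then 0 else θ j ^ 2 with hh
    have hterm : ∀ i, h (ℓ i) ≤ C ^ 2 * (if M ≤ i then ((i : ℝ) + 1) ^ (-(p + 1)) else 0) := by
      intro i
      by_cases hi : M ≤ i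
      · rw [if_pos hi]
        have h1 : θ (ℓ i) ^ 2 ≤ C ^ 2 * ((i : ℝ) + 1) ^ (-(p + 1)) := by
          calc θ (ℓ i) ^ 2 = |θ (ℓ i)| ^ 2 := (sq_abs _).symm
            _ ≤ (C * ((i : ℝ) + 1) ^ (-(p + 1) / 2)) ^ 2 :=
              pow_le_pow_left₀ (abs_nonneg _) (hθ i).2 2
            _ = _ := by
              rw [mul_pow, ← Real.rpow_mul_natCast (by positivity)]
              congr 2
              push_cast
              ring
        simp only [hh]
        split_ifs
        · positivity
        · exact h1
      · have : ℓ i ∈ s := Finset.mem_union_right _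
          (Finset.mem_image_of_mem ℓ (Finset.mem_range.2 (not_le.1 hi)))
        simp [hh, this, hi]
    have hnn : ∀ j, 0 ≤ h j := fun j => by
      simp only [hh]
      split_ifs <;> positivity
    have hoff : ∀ j, j ∉ Set.range ℓ → h j = 0 := fun j hj => by simp [hh, hzero j hj]
    have hsum : Summable (h ∘ ℓ) :=
      Summable.of_nonneg_of_le (fun i => hnn _) hterm (hts.mul_left _)
    refine ⟨(hinj.summable_iff hoff).1 hsum, ?_⟩
    rw [← hinj.tsum_eq (f := h) (Function.support_subset_iff'.2 hoff)]
    calc ∑' i, h (ℓ i) ≤ ∑' i : ℕ, C ^ 2 * (if M ≤ i then ((i : ℝ) + 1) ^ (-(p + 1)) else 0) :=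
          hsum.tsum_le_tsum hterm (hts.mul_left _)
      _ ≤ C ^ 2 * (2 * m ^ (-p)) := by
          rw [tsum_mul_left]
          gcongr
      _ = C ^ 2 * (2 * H ^ (-p)) * (n : ℝ) ^ (-(p / (p + 1))) := by
          rw [hm, Real.mul_rpow hH0.le (by positivity), ← Real.rpow_mul hn0.le,
            show 1 / (p + 1) * -p = -(p / (p + 1)) by ring]
          ring
      _ ≤ _ := by
          gcongr
          have : 0 ≤ C' * (H ^ q + 1) := by positivity
          linarith

end Misalignment

/-! ### Elementary asymptotics -/

section Asymptotics

theorem exp_mul_sqrt_log_le (Γ : ℝ) {η x : ℝ} (hη : 0 < η) (hx : 1 ≤ x) :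
    Real.exp (Γ * √(Real.log x)) ≤ Real.exp (Γ ^ 2 / (4 * η)) * x ^ η := by
  have hx0 : 0 < x := by linarith
  rw [Real.rpow_def_of_pos hx0, ← Real.exp_add, Real.exp_le_exp]
  have h1 := Real.sq_sqrt (Real.log_nonneg hx)
  set s := √(Real.log x)
  rw [← h1]
  have h2 : Γ ^ 2 / (4 * η) + s ^ 2 * η - Γ * s = (Γ - 2 * η * s) ^ 2 / (4 * η) := by
    field_simp
    ring
  have h3 : 0 ≤ (Γ - 2 * η * s) ^ 2 / (4 * η) := by positivity
  linarith

theorem rpow_neg_le_of_lt {N x r η : ℝ} (hN : 0 < N) (hx : N < x) (hr : 1 + η ≤ r) :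
    x ^ (-r) ≤ N ^ (-(r - 1 - η)) * x ^ (-(1 + η)) := by
  have hx0 : 0 < x := hN.trans hx
  rw [show -r = -(r - 1 - η) + -(1 + η) by ring, Real.rpow_add hx0]
  exact mul_le_mul_of_nonneg_right
    (Real.rpow_le_rpow_of_nonpos hN hx.le (by linarith)) (by positivity)

theorem summable_succ_rpow {η : ℝ} (hη : 0 < η) :
    Summable fun j : ℕ => ((j : ℝ) + 1) ^ (-(1 + η)) := by
  have := (summable_nat_add_iff 1).2
    (Real.summable_nat_rpow.2 (show -(1 + η) < -1 by linarith))
  simpa using this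

theorem tendsto_const_mul_rpow_neg (K : ℝ) {δ : ℝ} (hδ : δ < 0) :
    Tendsto (fun n : ℕ => K * (n : ℝ) ^ δ) atTop (𝓝 0) := by
  have h := (tendsto_rpow_neg_atTop (neg_pos.2 hδ)).comp tendsto_natCast_atTop_atTop (α := ℕ)
  simpa using h.const_mul K

theorem tendsto_log_mul_rpow_neg (K : ℝ) {δ : ℝ} (hδ : δ < 0) :
    Tendsto (fun n : ℕ => K * Real.log n * (n : ℝ) ^ δ) atTop (𝓝 0) := by
  have h := (isLittleO_log_rpow_atTop (neg_pos.2 hδ)).tendsto_div_nhds_zero.comp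
    (tendsto_natCast_atTop_atTop (R := ℝ))
  have h2 := h.const_mul K
  rw [mul_zero] at h2
  refine h2.congr fun n => ?_
  simp only [Function.comp]
  rw [Real.rpow_neg (Nat.cast_nonneg n), div_inv_eq_mul, mul_assoc]

/-- The growth exponent of the weakly driven coordinates: the powers of `n` cancel up to a square
root. -/
theorem pow_mul_rpow_scale (D : ℕ) {n : ℝ} (hn : 0 < n) :
    (n ^ (-(1 / (2 * ((D : ℝ) + 2))))) ^ D * n ^ (((D : ℝ) + 1) / ((D : ℝ) + 2)) = √n := by
  rw [← Real.rpow_mul_natCast hn.le, ← Real.rpow_add hn, Real.sqrt_eq_rpow]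
  congr 1
  field_simp
  ring

theorem weak_exponent_le (D : ℕ) {n : ℝ} (hn : 0 < n) {b₀ T Cb Ct G L : ℝ} (hb0 : 0 ≤ b₀)
    (hT0 : 0 ≤ T) (hCb : 0 ≤ Cb) (hG : 0 ≤ G)
    (hb : b₀ ≤ Cb * n ^ (-(1 / (2 * ((D : ℝ) + 2)))))
    (hT : T ≤ Ct * n ^ (((D : ℝ) + 1) / ((D : ℝ) + 2))) :
    (√(1 + D) * b₀) ^ D * (G * √(L / n)) * T ≤ (√(1 + D) * Cb) ^ D * Ct * G * √L := by
  have h1 : (√(1 + D) * b₀) ^ D * T ≤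
      (√(1 + D) * (Cb * n ^ (-(1 / (2 * ((D : ℝ) + 2)))))) ^ D *
        (Ct * n ^ (((D : ℝ) + 1) / ((D : ℝ) + 2))) := by gcongr
  have h2 : (√(1 + D) * (Cb * n ^ (-(1 / (2 * ((D : ℝ) + 2)))))) ^ D *
      (Ct * n ^ (((D : ℝ) + 1) / ((D : ℝ) + 2))) = (√(1 + D) * Cb) ^ D * Ct * √n := by
    rw [← pow_mul_rpow_scale D hn]
    ring
  have hn2 : 0 < √n := Real.sqrt_pos.2 hn
  rw [Real.sqrt_div' _ hn.le]
  calc (√(1 + D) * b₀) ^ D * (G * (√L / √n)) * T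
      = (√(1 + D) * b₀) ^ D * T * (G * (√L / √n)) := by ring
    _ ≤ (√(1 + D) * Cb) ^ D * Ct * √n * (G * (√L / √n)) :=
        mul_le_mul_of_nonneg_right (h1.trans h2.le) (by positivity)
    _ = _ := by field_simp

/-- Small slack in the exponents. -/
theorem exists_exponent_slack {γ ρ p ω d : ℝ} (hγ : 1 < γ) (hρ0 : 0 < ρ)
    (h1 : ω < ρ * (γ / 2)) (h2 : -d - ρ * (2 * γ - 1) < -(p / (p + 1))) :
    ∃ η > 0, η < ρ * (γ / 2 - η) - ω ∧ 2 * η < ρ * (γ - 1 - 4 * η) ∧ 0 < γ - 1 - 4 * η ∧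
      4 * η - d - ρ * (2 * γ - 1 - 5 * η) < -(p / (p + 1)) ∧ 0 < γ / 2 - η := by
  have key : ∀ f g : ℝ → ℝ, Continuous f → Continuous g → f 0 < g 0 →
      ∀ᶠ η in 𝓝[>] (0 : ℝ), f η < g η := fun f g hf hg h0 =>
    nhdsWithin_le_nhds (hf.continuousAt.eventually_lt hg.continuousAt h0)
  have e1 := key (fun η => η) (fun η => ρ * (γ / 2 - η) - ω) (by fun_prop) (by fun_prop)
    (by simp; linarith)
  have e2 := key (fun η => 2 * η) (fun η => ρ * (γ - 1 - 4 * η)) (by fun_prop) (by fun_prop)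
    (by simp; exact mul_pos hρ0 (by linarith))
  have e3 := key (fun η => 0) (fun η => γ - 1 - 4 * η) (by fun_prop) (by fun_prop)
    (by simp; linarith)
  have e4 := key (fun η => 4 * η - d - ρ * (2 * γ - 1 - 5 * η)) (fun _ => -(p / (p + 1)))
    (by fun_prop) (by fun_prop) (by simpa using h2)
  have e5 := key (fun η => 0) (fun η => γ / 2 - η) (by fun_prop) (by fun_prop)
    (by simp; linarith)
  obtain ⟨η, h⟩ := (e1.and (e2.and (e3.and (e4.and (e5.and self_mem_nhdsWithin))))).exists
  exact ⟨η, h.2.2.2.2.2, h.1, h.2.1, h.2.2.1, h.2.2.2.1, h.2.2.2.2.1⟩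

end Asymptotics

/-! ### The rate for families of driven scalar flows -/

/-- The (truncated) weighted distance of the coefficients to the truth. -/
noncomputable def deviation (D : ℕ) (θ : ℕ → ℝ) (n : ℕ) (a b β : ℕ → ℝ → ℝ) (t : ℝ) : ℝ :=
  ∑' k, min (logWeight k) √n * |θ k - a k t * b k t ^ D * β k t|

/-- The size of the random fluctuations in the `j`-th coordinate. -/
noncomputable def fluct (n : ℕ) (j : ℕ) : ℝ := √(Real.log (n * ((j : ℝ) + 1)) / n)

/-- A family of scalar flows, each of which is driven to the coefficient `θ j` up to an error that
is controlled by the deviation of the whole family. -/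
structure DrivenFamily (D : ℕ) (lam θ : ℕ → ℝ) (A : ℝ) (n : ℕ) (b₀ : ℝ) (a b β g : ℕ → ℝ → ℝ) :
    Prop where
  flow : ∀ j, ScalarFlow D (lam j) b₀ (a j) (b j) (β j) (g j)
  cont : ContinuousOn (deviation D θ n a b β) (Set.Ici 0)
  pert : ∀ t, 0 ≤ t → ∀ j, |g j t - (θ j - a j t * b j t ^ D * β j t)| ≤
    A * fluct n j * (1 + deviation D θ n a b β t)

theorem fluct_nonneg (n j : ℕ) : 0 ≤ fluct n j := Real.sqrt_nonneg _

theorem one_le_log_mul_succ {n : ℕ} (hn : 3 ≤ n) (j : ℕ) :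
    1 ≤ Real.log ((n : ℝ) * ((j : ℝ) + 1)) := by
  have h3 : (3 : ℝ) ≤ n := by exact_mod_cast hn
  rw [Real.le_log_iff_exp_le (by positivity)]
  have : (n : ℝ) * 1 ≤ n * ((j : ℝ) + 1) := by
    gcongr
    linarith [(Nat.cast_nonneg j : (0 : ℝ) ≤ j)]
  linarith [Real.exp_one_lt_d9]

theorem rpow_neg_half_le_fluct {n : ℕ} (hn : 3 ≤ n) (j : ℕ) :
    (n : ℝ) ^ (-(1 / 2) : ℝ) ≤ fluct n j := by
  have hn0 : (0 : ℝ) < n := Nat.cast_pos.2 (by omega)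
  rw [Real.rpow_neg hn0.le, ← Real.sqrt_eq_rpow, ← Real.sqrt_inv, fluct]
  refine Real.sqrt_le_sqrt ?_
  rw [inv_eq_one_div]
  exact div_le_div_of_nonneg_right (one_le_log_mul_succ hn j) hn0.le

namespace DrivenFamily

variable {D : ℕ} {lam θ : ℕ → ℝ} {A : ℝ} {n : ℕ} {b₀ : ℝ} {a b β g : ℕ → ℝ → ℝ}

theorem abs_signal_sub_le (h : DrivenFamily D lam θ A n b₀ a b β g) (hA : 0 ≤ A) {V s : ℝ}
    (hs : 0 ≤ s) (hV : deviation D θ n a b β s < V) (j : ℕ) :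
    |g j s - (θ j - a j s * b j s ^ D * β j s)| ≤ A * (1 + V) * fluct n j := by
  refine (h.pert s hs j).trans ?_
  have h0 := fluct_nonneg n j
  have : A * fluct n j * (1 + deviation D θ n a b β s) ≤ A * fluct n j * (1 + V) := by gcongr
  linarith

theorem abs_coeff_sub_le (h : DrivenFamily D lam θ A n b₀ a b β g) (hA : 0 ≤ A)
    (hlam : ∀ j, 0 < lam j) (hb : 0 < b₀) {t V : ℝ} (ht : 0 ≤ t) (hV : 0 ≤ V)
    (hdev : ∀ s ∈ Set.Ico 0 t, deviation D θ n a b β s < V) (j : ℕ) :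
    |θ j - a j t * b j t ^ D * β j t| ≤ |θ j| + A * (1 + V) * fluct n j :=
  ((h.flow j).abs_coeff_sub_le (hlam j) hb ht
    (mul_nonneg (by positivity) (fluct_nonneg n j))
    fun s hs => h.abs_signal_sub_le hA hs.1 (hdev s hs) j).2

theorem abs_coeff_le (h : DrivenFamily D lam θ A n b₀ a b β g) (hA : 0 ≤ A)
    (hlam : ∀ j, 0 < lam j) (hb : 0 < b₀) {t T V : ℝ} (ht : 0 ≤ t) (htT : t ≤ T) (hV : 0 ≤ V)
    (hdev : ∀ s ∈ Set.Ico 0 t, deviation D θ n a b β s < V) {j : ℕ} (hθ : |θ j| ≤ fluct n j)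
    (hsmall : √(lam j) * Real.exp ((√(1 + D) * b₀) ^ D * ((1 + 2 * (A * (1 + V))) * fluct n j) * T)
      < b₀) :
    |a j t * b j t ^ D * β j t| ≤ lam j * Real.exp (2 * ((√(1 + D) * b₀) ^ D *
      ((1 + 2 * (A * (1 + V))) * fluct n j) * T)) * (√(1 + D) * b₀) ^ D := by
  refine (h.flow j).abs_coeff_le_of_weak (hlam j) hb ht htT
    (mul_nonneg (by positivity) (fluct_nonneg n j)) (fun s hs => ?_) hsmall
  have h1 := h.abs_signal_sub_le hA hs.1 (hdev s hs) j
  have h2 := h.abs_coeff_sub_le hA hlam hb hs.1 hV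
    (fun r hr => hdev r ⟨hr.1, hr.2.trans hs.2⟩) j
  have h3 := abs_sub_abs_le_abs_sub (g j s) (θ j - a j s * b j s ^ D * β j s)
  linarith

theorem deviation_lt (h : DrivenFamily D lam θ A n b₀ a b β g) (hA : 0 ≤ A)
    (hlam : ∀ j, 0 < lam j) (hb : 0 < b₀) {T V : ℝ} (hV : 0 ≤ V) (s : Finset ℕ) {U : ℕ → ℝ}
    (hθs : ∀ j ∉ s, |θ j| ≤ fluct n j)
    (hsmall : ∀ j ∉ s, √(lam j) * Real.exp ((√(1 + D) * b₀) ^ D *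
      ((1 + 2 * (A * (1 + V))) * fluct n j) * T) < b₀)
    (hU : ∀ j ∉ s, lam j * Real.exp (2 * ((√(1 + D) * b₀) ^ D *
      ((1 + 2 * (A * (1 + V))) * fluct n j) * T)) * (√(1 + D) * b₀) ^ D ≤ U j)
    (hsumθ : Summable fun j => logWeight j * |θ j|)
    (hsumU : Summable fun j => if j ∈ s then 0 else logWeight j * U j)
    (hlt : ∑' j, logWeight j * |θ j| + ∑ j ∈ s, logWeight j * (A * (1 + V) * fluct n j) +
      ∑' j, (if j ∈ s then 0 else logWeight j * U j) < V) :
    ∀ t ∈ Set.Icc 0 T, deviation D θ n a b β t < V := by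
  refine forall_lt_of_continuousOn_of_bootstrap (h.cont.mono Set.Icc_subset_Ici_self)
    fun t ht hdev => lt_of_le_of_lt ?_ hlt
  have hw : ∀ j, 0 ≤ logWeight j := fun j => zero_le_one.trans (one_le_logWeight j)
  have hbd : ∀ j, min (logWeight j) √n * |θ j - a j t * b j t ^ D * β j t| ≤
      logWeight j * |θ j| + (if j ∈ s then logWeight j * (A * (1 + V) * fluct n j) else 0) +
        (if j ∈ s then 0 else logWeight j * U j) := by
    intro j
    refine (mul_le_mul_of_nonneg_right (min_le_left _ _) (abs_nonneg _)).trans ?_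
    by_cases hj : j ∈ s
    · rw [if_pos hj, if_pos hj, add_zero, ← mul_add]
      exact mul_le_mul_of_nonneg_left (h.abs_coeff_sub_le hA hlam hb ht.1 hV hdev j) (hw j)
    · rw [if_neg hj, if_neg hj, add_zero, ← mul_add]
      refine mul_le_mul_of_nonneg_left ((abs_sub _ _).trans ?_) (hw j)
      gcongr
      exact (h.abs_coeff_le hA hlam hb ht.1 ht.2 hV hdev (hθs j hj) (hsmall j hj)).trans (hU j hj)
  have hsumh : HasSum (fun j => if j ∈ s then logWeight j * (A * (1 + V) * fluct n j) else 0)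
      (∑ j ∈ s, logWeight j * (A * (1 + V) * fluct n j)) := by
    have : HasSum (fun j => if j ∈ s then logWeight j * (A * (1 + V) * fluct n j) else 0)
        (∑ j ∈ s, if j ∈ s then logWeight j * (A * (1 + V) * fluct n j) else 0) :=
      hasSum_sum_of_ne_finset_zero fun j hj => if_neg hj
    rwa [Finset.sum_congr rfl fun j hj => if_pos hj] at this
  have htot := (hsumθ.hasSum.add hsumh).add hsumU.hasSum
  refine (Summable.tsum_le_tsum hbd (Summable.of_nonneg_of_le (fun j => ?_) hbd htot.summable)
    htot.summable).trans htot.tsum_eq.le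
  exact mul_nonneg (le_min (hw j) (Real.sqrt_nonneg _)) (abs_nonneg _)

end DrivenFamily

/-! ### Large sample sizes -/

section Large

variable {lam : ℕ → ℝ} {γ Cl : ℝ} (D : ℕ)

/-- The order of the weakly driven coefficients. -/
noncomputable def weakBound (D : ℕ) (γ η K : ℝ) (n : ℕ) (j : ℕ) : ℝ :=
  K * (n : ℝ) ^ (2 * η - D / (2 * ((D : ℝ) + 2))) * ((j : ℝ) + 1) ^ (-γ + 2 * η)

theorem weakBound_nonneg {D : ℕ} {γ η K : ℝ} (hK : 0 ≤ K) (n j : ℕ) :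
    0 ≤ weakBound D γ η K n j := by
  unfold weakBound
  positivity

theorem eventually_weak (hlam0 : ∀ j, 0 < lam j) (hCl : 0 < Cl)
    (hlam : ∀ j : ℕ, lam j ≤ Cl * ((j : ℝ) + 1) ^ (-γ)) {ρ η : ℝ} (hη : 0 < η)
    (hη1 : η < ρ * (γ / 2 - η) - 1 / (2 * ((D : ℝ) + 2))) (hη2 : 0 < γ / 2 - η)
    {cb Cb Ct G : ℝ} (hcb : 0 < cb) (hCb : 0 ≤ Cb) (hG : 0 ≤ G) :
    ∃ K > 0, ∀ᶠ n : ℕ in atTop, ∀ b₀ T : ℝ, 0 ≤ T →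
      cb * (n : ℝ) ^ (-(1 / (2 * ((D : ℝ) + 2)))) ≤ b₀ →
      b₀ ≤ Cb * (n : ℝ) ^ (-(1 / (2 * ((D : ℝ) + 2)))) →
      T ≤ Ct * (n : ℝ) ^ (((D : ℝ) + 1) / ((D : ℝ) + 2)) →
      ∀ j : ℕ, (n : ℝ) ^ ρ < (j : ℝ) + 1 →
        √(lam j) * Real.exp ((√(1 + D) * b₀) ^ D * (G * fluct n j) * T) < b₀ ∧
        lam j * Real.exp (2 * ((√(1 + D) * b₀) ^ D * (G * fluct n j) * T)) *
          (√(1 + D) * b₀) ^ D ≤ weakBound D γ η K n j := by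
  set Γ := (√(1 + D) * Cb) ^ D * Ct * G with hΓ
  set K₀ := Real.exp (Γ ^ 2 / (4 * η)) with hK₀
  set ω : ℝ := 1 / (2 * ((D : ℝ) + 2)) with hω
  refine ⟨Cl * K₀ ^ 2 * (√(1 + D) * Cb) ^ D + 1, by positivity, ?_⟩
  have hev := (tendsto_const_mul_rpow_neg (√Cl * K₀)
    (show η - ρ * (γ / 2 - η) + ω < 0 by linarith)).eventually_lt_const hcb
  filter_upwards [hev, eventually_ge_atTop 3] with n hn hn3 b₀ T hT0 hb1 hb2 hT j hj
  have hn0 : (0 : ℝ) < n := Nat.cast_pos.2 (by omega)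
  have hn1 : (1 : ℝ) ≤ n := Nat.one_le_cast.2 (by omega)
  have hj0 : (0 : ℝ) < (j : ℝ) + 1 := by positivity
  have hb0 : 0 < b₀ := lt_of_lt_of_le (by positivity) hb1
  have hnj : 1 ≤ (n : ℝ) * ((j : ℝ) + 1) :=
    one_le_mul_of_one_le_of_one_le hn1 (by linarith [(Nat.cast_nonneg j : (0 : ℝ) ≤ j)])
  set κ := (√(1 + D) * b₀) ^ D * (G * fluct n j) * T with hκ
  have hexp : Real.exp κ ≤ K₀ * ((n : ℝ) * ((j : ℝ) + 1)) ^ η :=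
    (Real.exp_le_exp.2 (weak_exponent_le D hn0 hb0.le hT0 hCb hG hb2 hT)).trans
      (exp_mul_sqrt_log_le Γ hη hnj)
  rw [Real.mul_rpow hn0.le hj0.le] at hexp
  refine ⟨lt_of_le_of_lt ?_ (lt_of_lt_of_le (mul_lt_mul_of_pos_right hn
    (show 0 < (n : ℝ) ^ (-ω) by positivity)) hb1), ?_⟩
  · have h1 : √(lam j) ≤ √Cl * ((j : ℝ) + 1) ^ (-γ / 2) := by
      refine (Real.sqrt_le_sqrt (hlam j)).trans (le_of_eq ?_)
      rw [Real.sqrt_mul hCl.le, Real.sqrt_eq_rpow (((j : ℝ) + 1) ^ (-γ)), ← Real.rpow_mul hj0.le]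
      congr 2
      ring
    calc √(lam j) * Real.exp κ
        ≤ (√Cl * ((j : ℝ) + 1) ^ (-γ / 2)) * (K₀ * ((n : ℝ) ^ η * ((j : ℝ) + 1) ^ η)) := by gcongr
      _ = √Cl * K₀ * (n : ℝ) ^ η * ((j : ℝ) + 1) ^ (-(γ / 2 - η)) := by
          rw [show -(γ / 2 - η) = -γ / 2 + η by ring, Real.rpow_add hj0]
          ring
      _ ≤ √Cl * K₀ * (n : ℝ) ^ η * ((n : ℝ) ^ ρ) ^ (-(γ / 2 - η)) := by
          refine mul_le_mul_of_nonneg_left ?_ (by positivity)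
          exact Real.rpow_le_rpow_of_nonpos (by positivity) hj.le (by linarith)
      _ = _ := by
          rw [← Real.rpow_mul hn0.le, mul_assoc, ← Real.rpow_add hn0, mul_assoc (√Cl * K₀),
            ← Real.rpow_add hn0]
          congr 2
          ring
  · rw [two_mul, Real.exp_add]
    calc lam j * (Real.exp κ * Real.exp κ) * (√(1 + D) * b₀) ^ D
        ≤ (Cl * ((j : ℝ) + 1) ^ (-γ)) * ((K₀ * ((n : ℝ) ^ η * ((j : ℝ) + 1) ^ η)) *
            (K₀ * ((n : ℝ) ^ η * ((j : ℝ) + 1) ^ η))) * (√(1 + D) * (Cb * (n : ℝ) ^ (-ω))) ^ D := by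
          have := hlam j
          have := (hlam0 j).le
          gcongr
      _ = Cl * K₀ ^ 2 * (√(1 + D) * Cb) ^ D * ((n : ℝ) ^ η * (n : ℝ) ^ η * ((n : ℝ) ^ (-ω)) ^ D) *
            (((j : ℝ) + 1) ^ (-γ) * ((j : ℝ) + 1) ^ η * ((j : ℝ) + 1) ^ η) := by ring
      _ = Cl * K₀ ^ 2 * (√(1 + D) * Cb) ^ D * (n : ℝ) ^ (2 * η - D / (2 * ((D : ℝ) + 2))) *
            ((j : ℝ) + 1) ^ (-γ + 2 * η) := by
          rw [show 2 * η - D / (2 * ((D : ℝ) + 2)) = η + η + -ω * D by rw [hω]; ring,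
            show -γ + 2 * η = -γ + η + η by ring, Real.rpow_add hn0, Real.rpow_add hn0,
            Real.rpow_mul_natCast hn0.le, Real.rpow_add hj0, Real.rpow_add hj0]
      _ ≤ _ := by
          unfold weakBound
          gcongr
          linarith

theorem tail_weight_mul_weakBound {ρ η K : ℝ} (hη : 0 < η) (hη3 : 0 < γ - 1 - 4 * η)
    (hη2 : 2 * η < ρ * (γ - 1 - 4 * η)) (hK : 0 ≤ K) {δ : ℝ} (hδ : 0 < δ) :
    ∀ᶠ n : ℕ in atTop, ∀ s : Finset ℕ, (∀ j ∉ s, (n : ℝ) ^ ρ < (j : ℝ) + 1) →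
      Summable (fun j => if j ∈ s then 0 else logWeight j * weakBound D γ η K n j) ∧
      ∑' j, (if j ∈ s then 0 else logWeight j * weakBound D γ η K n j) < δ := by
  have hS := summable_succ_rpow hη
  set S := ∑' j : ℕ, ((j : ℝ) + 1) ^ (-(1 + η)) with hSdef
  have hev := (tendsto_const_mul_rpow_neg ((1 + 1 / η) * K * S)
    (show 2 * η - ρ * (γ - 1 - 4 * η) < 0 by linarith)).eventually_lt_const hδ
  filter_upwards [hev, eventually_gt_atTop 0] with n hn hn0' s hs
  have hn0 : (0 : ℝ) < n := Nat.cast_pos.2 hn0'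
  have hn1 : (1 : ℝ) ≤ n := Nat.one_le_cast.2 hn0'
  have hterm : ∀ j, (if j ∈ s then 0 else logWeight j * weakBound D γ η K n j) ≤
      (1 + 1 / η) * K * (n : ℝ) ^ (2 * η - ρ * (γ - 1 - 4 * η)) * ((j : ℝ) + 1) ^ (-(1 + η)) := by
    intro j
    have hj0 : (0 : ℝ) < (j : ℝ) + 1 := by positivity
    split_ifs with hj
    · positivity
    · have h1 := rpow_neg_le_of_lt (r := γ - 3 * η) (η := η) (by positivity) (hs j hj) (by linarith)
      have h2 : (n : ℝ) ^ (2 * η - D / (2 * ((D : ℝ) + 2))) ≤ (n : ℝ) ^ (2 * η) :=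
        Real.rpow_le_rpow_of_exponent_le hn1 (by
          have : 0 ≤ (D : ℝ) / (2 * ((D : ℝ) + 2)) := by positivity
          linarith)
      calc logWeight j * weakBound D γ η K n j
          ≤ ((1 + 1 / η) * ((j : ℝ) + 1) ^ η) *
            (K * (n : ℝ) ^ (2 * η) * ((j : ℝ) + 1) ^ (-γ + 2 * η)) := by
            unfold weakBound
            gcongr
            exact logWeight_le hη j
        _ = (1 + 1 / η) * K * (n : ℝ) ^ (2 * η) * ((j : ℝ) + 1) ^ (-(γ - 3 * η)) := by
            rw [show -(γ - 3 * η) = η + (-γ + 2 * η) by ring, Real.rpow_add hj0 η]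
            ring
        _ ≤ (1 + 1 / η) * K * (n : ℝ) ^ (2 * η) *
            (((n : ℝ) ^ ρ) ^ (-(γ - 3 * η - 1 - η)) * ((j : ℝ) + 1) ^ (-(1 + η))) := by gcongr
        _ = _ := by
            rw [← Real.rpow_mul hn0.le, ← mul_assoc, mul_assoc ((1 + 1 / η) * K),
              ← Real.rpow_add hn0]
            congr 3
            ring
  have hmaj := hS.mul_left ((1 + 1 / η) * K * (n : ℝ) ^ (2 * η - ρ * (γ - 1 - 4 * η)))
  have hsum : Summable (fun j => if j ∈ s then 0 else logWeight j * weakBound D γ η K n j) := by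
    refine Summable.of_nonneg_of_le (fun j => ?_) hterm hmaj
    split_ifs
    · exact le_rfl
    · exact mul_nonneg (zero_le_one.trans (one_le_logWeight j)) (weakBound_nonneg hK n j)
  refine ⟨hsum, lt_of_le_of_lt ((hsum.tsum_le_tsum hterm hmaj).trans (le_of_eq ?_)) hn⟩
  rw [tsum_mul_left, ← hSdef]
  ring

theorem tail_sq_weakBound {ρ η K p : ℝ} (hη : 0 < η) (hη3 : 0 < γ - 1 - 4 * η)
    (hη4 : 4 * η - D / ((D : ℝ) + 2) - ρ * (2 * γ - 1 - 5 * η) < -(p / (p + 1))) :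
    ∃ K', ∀ n : ℕ, 0 < n → ∀ s : Finset ℕ, (∀ j ∉ s, (n : ℝ) ^ ρ < (j : ℝ) + 1) →
      Summable (fun j => if j ∈ s then 0 else weakBound D γ η K n j ^ 2) ∧
      ∑' j, (if j ∈ s then 0 else weakBound D γ η K n j ^ 2) ≤ K' * (n : ℝ) ^ (-(p / (p + 1))) := by
  have hS := summable_succ_rpow hη
  refine ⟨K ^ 2 * ∑' j : ℕ, ((j : ℝ) + 1) ^ (-(1 + η)), fun n hn s hs => ?_⟩
  have hn0 : (0 : ℝ) < n := Nat.cast_pos.2 hn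
  have hn1 : (1 : ℝ) ≤ n := Nat.one_le_cast.2 hn
  have hterm : ∀ j, (if j ∈ s then 0 else weakBound D γ η K n j ^ 2) ≤
      K ^ 2 * (n : ℝ) ^ (-(p / (p + 1))) * ((j : ℝ) + 1) ^ (-(1 + η)) := by
    intro j
    have hj0 : (0 : ℝ) < (j : ℝ) + 1 := by positivity
    split_ifs with hj
    · positivity
    · have h1 := rpow_neg_le_of_lt (r := 2 * γ - 4 * η) (η := η) (by positivity) (hs j hj)
        (by linarith)
      calc weakBound D γ η K n j ^ 2
          = K ^ 2 * (n : ℝ) ^ (4 * η - D / ((D : ℝ) + 2)) *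
            ((j : ℝ) + 1) ^ (-(2 * γ - 4 * η)) := by
            rw [weakBound, mul_pow, mul_pow, ← Real.rpow_mul_natCast hn0.le,
              ← Real.rpow_mul_natCast hj0.le]
            congr 3
            · push_cast
              field_simp
              ring
            · push_cast
              ring
        _ ≤ K ^ 2 * (n : ℝ) ^ (4 * η - D / ((D : ℝ) + 2)) *
            (((n : ℝ) ^ ρ) ^ (-(2 * γ - 4 * η - 1 - η)) * ((j : ℝ) + 1) ^ (-(1 + η))) := by gcongr
        _ = K ^ 2 * (n : ℝ) ^ (4 * η - D / ((D : ℝ) + 2) - ρ * (2 * γ - 1 - 5 * η)) *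
            ((j : ℝ) + 1) ^ (-(1 + η)) := by
            rw [← Real.rpow_mul hn0.le, ← mul_assoc, mul_assoc (K ^ 2), ← Real.rpow_add hn0]
            congr 3
            ring
        _ ≤ _ := by
            gcongr
  have hmaj := hS.mul_left (K ^ 2 * (n : ℝ) ^ (-(p / (p + 1))))
  have hsum : Summable (fun j => if j ∈ s then 0 else weakBound D γ η K n j ^ 2) := by
    refine Summable.of_nonneg_of_le (fun j => ?_) hterm hmaj
    split_ifs
    · exact le_rfl
    · positivity
  refine ⟨hsum, (hsum.tsum_le_tsum hterm hmaj).trans (le_of_eq ?_)⟩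
  rw [tsum_mul_left]
  ring

/-- On polynomially bounded indices, logarithms are of order `log n`. -/
theorem eventually_log_le (C Q : ℝ) :
    ∀ᶠ n : ℕ in atTop, ∀ j : ℕ, (j : ℝ) + 1 ≤ C * (n : ℝ) ^ Q →
      Real.log (n * ((j : ℝ) + 1)) ≤ (Q + 2) * Real.log n ∧
      logWeight j * fluct n j ≤ (Q + 2) * Real.log n * (n : ℝ) ^ (-(1 / 2) : ℝ) ∧
      fluct n j ≤ (Q + 2) * Real.log n * (n : ℝ) ^ (-(1 / 2) : ℝ) := by
  filter_upwards [eventually_ge_atTop 3, tendsto_natCast_atTop_atTop.eventually_ge_atTop C]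
    with n hn hC j hj
  have hn0 : (0 : ℝ) < n := Nat.cast_pos.2 (by omega)
  have hj0 : (0 : ℝ) < (j : ℝ) + 1 := by positivity
  have h1 : Real.log (n * ((j : ℝ) + 1)) ≤ (Q + 2) * Real.log n := by
    have h2 : (n : ℝ) * ((j : ℝ) + 1) ≤ (n : ℝ) ^ (Q + 2) := by
      calc (n : ℝ) * ((j : ℝ) + 1) ≤ n * (n * (n : ℝ) ^ Q) := by
            gcongr
            exact hj.trans (by gcongr)
        _ = _ := by
            rw [Real.rpow_add hn0, Real.rpow_ofNat]
            ring
    calc _ ≤ Real.log ((n : ℝ) ^ (Q + 2)) := Real.log_le_log (by positivity) h2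
      _ = _ := Real.log_rpow hn0 _
  have h3 := one_le_log_mul_succ hn j
  have h4 := one_le_logWeight j
  set L := Real.log (n * ((j : ℝ) + 1)) with hL
  have hfl : fluct n j = √L * (n : ℝ) ^ (-(1 / 2) : ℝ) := by
    rw [fluct, Real.sqrt_div' _ hn0.le, Real.rpow_neg hn0.le, ← Real.sqrt_eq_rpow]
    rfl
  have hw : logWeight j ≤ √L := by
    refine Real.sqrt_le_sqrt ?_
    rw [hL, Real.log_mul hn0.ne' hj0.ne']
    have := one_le_log_mul_succ hn 0
    simp only [Nat.cast_zero, zero_add, mul_one] at this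
    linarith
  have hmain : logWeight j * fluct n j ≤ (Q + 2) * Real.log n * (n : ℝ) ^ (-(1 / 2) : ℝ) := by
    rw [hfl, ← mul_assoc]
    refine mul_le_mul_of_nonneg_right ?_ (by positivity)
    calc logWeight j * √L ≤ √L * √L := by gcongr
      _ = L := Real.mul_self_sqrt (by linarith)
      _ ≤ _ := h1
  exact ⟨h1, hmain, (le_mul_of_one_le_left (fluct_nonneg n j) h4).trans hmain⟩

end Large

/-- The strongly driven coefficients have enough time to reach their target. -/
theorem eventually_strong (D : ℕ) {c cb ct C q γ A : ℝ} (hc : 0 < c) (hcb : 0 < cb) (hct : 0 < ct)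
    (hC : 0 < C) (hγ : 0 ≤ γ) (hA1 : 1 ≤ cb ^ D * ct * A)
    (hA2 : 2 + γ * q ≤ 2 * (cb ^ D * ct * A)) (W : ℝ) :
    ∀ᶠ n : ℕ in atTop, ∀ b₀ T : ℝ, cb * (n : ℝ) ^ (-(1 / (2 * ((D : ℝ) + 2)))) ≤ b₀ →
      ct * (n : ℝ) ^ (((D : ℝ) + 1) / ((D : ℝ) + 2)) ≤ T →
      2 ≤ Real.exp (b₀ ^ D * (A * Real.log n * (n : ℝ) ^ (-(1 / 2) : ℝ)) * T) ∧
      ∀ (j : ℕ) (l : ℝ), (j : ℝ) + 1 ≤ C * (n : ℝ) ^ q → c * ((j : ℝ) + 1) ^ (-γ) ≤ l →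
        W ≤ b₀ ^ D * l *
          Real.exp (2 * (b₀ ^ D * (A * Real.log n * (n : ℝ) ^ (-(1 / 2) : ℝ)) * T)) / 8 := by
  set k₀ := cb ^ D * (c * C ^ (-γ)) / 8 with hk₀
  have hk₀pos : 0 < k₀ := by positivity
  filter_upwards [eventually_ge_atTop 3, tendsto_natCast_atTop_atTop.eventually_ge_atTop (W / k₀)]
    with n hn hW b₀ T hb hT
  have hn0 : (0 : ℝ) < n := Nat.cast_pos.2 (by omega)
  have hn3 : (3 : ℝ) ≤ n := by exact_mod_cast hn
  have hn1 : (1 : ℝ) ≤ n := by linarith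
  have hlog : 0 ≤ Real.log n := Real.log_nonneg hn1
  have hct0 : 0 < cb ^ D * ct := by positivity
  have hA0 : 0 < A := by
    by_contra! h
    nlinarith
  set ω : ℝ := 1 / (2 * ((D : ℝ) + 2)) with hω
  set u := (n : ℝ) ^ (-ω) with hu
  have hu0 : 0 < u := by positivity
  have hb0 : 0 < b₀ := lt_of_lt_of_le (by positivity) hb
  have hbT : cb ^ D * ct * √n ≤ b₀ ^ D * T := by
    calc cb ^ D * ct * √n = (cb * u) ^ D * (ct * (n : ℝ) ^ (((D : ℝ) + 1) / ((D : ℝ) + 2))) := by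
          rw [← pow_mul_rpow_scale D hn0]
          ring
      _ ≤ _ := by gcongr
  have hexp : cb ^ D * ct * A * Real.log n ≤
      b₀ ^ D * (A * Real.log n * (n : ℝ) ^ (-(1 / 2) : ℝ)) * T := by
    have hs : √(n : ℝ) * (n : ℝ) ^ (-(1 / 2) : ℝ) = 1 := by
      rw [Real.sqrt_eq_rpow, ← Real.rpow_add hn0]
      norm_num
    calc cb ^ D * ct * A * Real.log n
        = cb ^ D * ct * √n * (A * Real.log n * (n : ℝ) ^ (-(1 / 2) : ℝ)) := by
          rw [show cb ^ D * ct * √n * (A * Real.log n * (n : ℝ) ^ (-(1 / 2) : ℝ)) =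
            cb ^ D * ct * A * Real.log n * (√n * (n : ℝ) ^ (-(1 / 2) : ℝ)) by ring, hs, mul_one]
      _ ≤ b₀ ^ D * T * (A * Real.log n * (n : ℝ) ^ (-(1 / 2) : ℝ)) := by gcongr
      _ = _ := by ring
  refine ⟨?_, fun j l hj hl => ?_⟩
  · calc (2 : ℝ) ≤ n := by linarith
      _ = Real.exp (1 * Real.log n) := by rw [one_mul, Real.exp_log hn0]
      _ ≤ _ := Real.exp_le_exp.2 ((mul_le_mul_of_nonneg_right hA1 hlog).trans hexp)
  · have hj0 : (0 : ℝ) < (j : ℝ) + 1 := by positivity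
    have h1 : (n : ℝ) ^ (2 + γ * q) ≤ Real.exp (2 *
        (b₀ ^ D * (A * Real.log n * (n : ℝ) ^ (-(1 / 2) : ℝ)) * T)) := by
      rw [Real.rpow_def_of_pos hn0, Real.exp_le_exp]
      nlinarith
    have h2 : C ^ (-γ) * (n : ℝ) ^ (-(γ * q)) ≤ ((j : ℝ) + 1) ^ (-γ) := by
      calc C ^ (-γ) * (n : ℝ) ^ (-(γ * q)) = (C * (n : ℝ) ^ q) ^ (-γ) := by
            rw [Real.mul_rpow hC.le (by positivity), ← Real.rpow_mul hn0.le]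
            congr 2
            ring
        _ ≤ _ := Real.rpow_le_rpow_of_nonpos hj0 hj (by linarith)
    have h3 : (n : ℝ) ^ (-1 : ℝ) ≤ u ^ D := by
      rw [hu, ← Real.rpow_mul_natCast hn0.le]
      refine Real.rpow_le_rpow_of_exponent_le hn1 ?_
      rw [hω, neg_mul, neg_le_neg_iff, one_div_mul_eq_div, div_le_one (by positivity)]
      linarith [(Nat.cast_nonneg D : (0 : ℝ) ≤ D)]
    calc W ≤ k₀ * n := by rwa [div_le_iff₀' hk₀pos] at hW
      _ = (cb ^ D * (n : ℝ) ^ (-1 : ℝ)) * (c * (C ^ (-γ) * (n : ℝ) ^ (-(γ * q)))) *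
          (n : ℝ) ^ (2 + γ * q) / 8 := by
          rw [hk₀, Real.rpow_add hn0, Real.rpow_neg hn0.le (γ * q), Real.rpow_neg_one,
            Real.rpow_ofNat]
          field_simp
      _ ≤ (cb ^ D * u ^ D) * l *
          Real.exp (2 * (b₀ ^ D * (A * Real.log n * (n : ℝ) ^ (-(1 / 2) : ℝ)) * T)) / 8 := by
          have hl' : c * (C ^ (-γ) * (n : ℝ) ^ (-(γ * q))) ≤ l :=
            (mul_le_mul_of_nonneg_left h2 hc.le).trans hl
          have hl0 : 0 ≤ l := le_trans (by positivity) hl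
          gcongr
      _ ≤ _ := by
          have hl0 : 0 ≤ l := le_trans (by positivity) hl
          rw [← mul_pow]
          gcongr

theorem tsum_le_of_head_tail {r u v : ℕ → ℝ} {s : Finset ℕ} {m : ℝ} (hr : ∀ j, 0 ≤ r j)
    (hs : ∀ j ∈ s, r j ≤ m) (ht : ∀ j ∉ s, r j ≤ 2 * u j + 2 * v j)
    (hu : Summable fun j => if j ∈ s then 0 else u j)
    (hv : Summable fun j => if j ∈ s then 0 else v j) :
    ∑' j, r j ≤ s.card * m + 2 * ∑' j, (if j ∈ s then 0 else u j) +
      2 * ∑' j, (if j ∈ s then 0 else v j) := by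
  have hsum : HasSum (fun j => if j ∈ s then m else 0) (s.card * m) := by
    have : HasSum (fun j => if j ∈ s then m else 0) (∑ j ∈ s, if j ∈ s then m else 0) :=
      hasSum_sum_of_ne_finset_zero fun j hj => if_neg hj
    rwa [Finset.sum_congr rfl fun j hj => if_pos hj, Finset.sum_const, nsmul_eq_mul] at this
  have htot := (hsum.add (hu.hasSum.mul_left 2)).add (hv.hasSum.mul_left 2)
  have hbd : ∀ j, r j ≤ (if j ∈ s then m else 0) + 2 * (if j ∈ s then 0 else u j) +
      2 * (if j ∈ s then 0 else v j) := by
    intro j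
    by_cases hj : j ∈ s
    · simpa [hj] using hs j hj
    · simpa [hj] using ht j hj
  exact (Summable.tsum_le_tsum hbd (Summable.of_nonneg_of_le hr hbd htot.summable)
    htot.summable).trans htot.tsum_eq.le

theorem sub_sq_le_two_mul_add {x y z : ℝ} (h : |y| ≤ z) : (x - y) ^ 2 ≤ 2 * x ^ 2 + 2 * z ^ 2 := by
  have h2 : y ^ 2 ≤ z ^ 2 := sq_le_sq' (abs_le.1 h).1 (abs_le.1 h).2
  nlinarith [sq_nonneg (x + y)]

set_option maxHeartbeats 800000 in
/-- The rate of convergence of a driven family at the stopping time. -/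
theorem eventually_tsum_sq_le (D : ℕ) {lam θ : ℕ → ℝ} {γ p q A : ℝ} (hγ1 : 1 < γ)
    (hlam : SameOrder ⊤ lam (fun j => ((j : ℝ) + 1) ^ (-γ))) (hp : 1 < p) (hq : 1 ≤ q)
    (hmis : Misaligned θ p q) (hγ : (p + 1) / ((D : ℝ) + 2) < γ) (hA : 0 < A)
    {cb Cb ct Ct : ℝ} (hcb : 0 < cb) (hCb : 0 < Cb) (hct : 0 < ct) :
    ∃ M > 0, ∀ᶠ n : ℕ in atTop, ∀ (b₀ T : ℝ) (a b β g : ℕ → ℝ → ℝ),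
      cb * (n : ℝ) ^ (-(1 / (2 * ((D : ℝ) + 2)))) ≤ b₀ →
      b₀ ≤ Cb * (n : ℝ) ^ (-(1 / (2 * ((D : ℝ) + 2)))) →
      ct * (n : ℝ) ^ (((D : ℝ) + 1) / ((D : ℝ) + 2)) ≤ T →
      T ≤ Ct * (n : ℝ) ^ (((D : ℝ) + 1) / ((D : ℝ) + 2)) →
      DrivenFamily D lam θ A n b₀ a b β g →
      ∑' j, (θ j - a j T * b j T ^ D * β j T) ^ 2 ≤
        M * (Real.log n ^ 2 * (n : ℝ) ^ (-(p / (p + 1)))) := by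
  obtain ⟨c, hc, Cl, hCl, hlam⟩ := hlam
  rw [eventually_top] at hlam
  have hlam0 : ∀ j, 0 < lam j := fun j => lt_of_lt_of_le (by positivity) (hlam j).1
  have hp1 : 0 < p + 1 := by linarith
  have hD2 : (0 : ℝ) < (D : ℝ) + 2 := by positivity
  have hγ' : 1 / ((D : ℝ) + 2) < γ / (p + 1) := by
    rw [div_lt_iff₀ hD2] at hγ
    rw [div_lt_div_iff₀ hD2 hp1]
    linarith
  have hω : 1 / (2 * ((D : ℝ) + 2)) < 1 / (p + 1) * (γ / 2) := by
    rw [show 1 / (2 * ((D : ℝ) + 2)) = 1 / ((D : ℝ) + 2) / 2 by field_simp,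
      show 1 / (p + 1) * (γ / 2) = γ / (p + 1) / 2 by ring]
    linarith
  have hd : -(D / ((D : ℝ) + 2)) - 1 / (p + 1) * (2 * γ - 1) < -(p / (p + 1)) := by
    have h1 : (D : ℝ) / ((D : ℝ) + 2) = 1 - 2 * (1 / ((D : ℝ) + 2)) := by
      field_simp
      ring
    have h2 : 1 / (p + 1) * (2 * γ - 1) = 2 * (γ / (p + 1)) - 1 + p / (p + 1) := by
      field_simp
      ring
    rw [h1, h2]
    linarith
  obtain ⟨η, hη, hη1, hη2, hη3, hη4, hη5⟩ := exists_exponent_slack hγ1 (by positivity) hω hd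
  obtain ⟨C, hC, hhead⟩ := exists_head hp hq hmis (ρ := 1 / (p + 1)) le_rfl
  have hsumθ := summable_logWeight_mul_abs hp hq hmis
  have hw : ∀ j, 1 ≤ logWeight j := one_le_logWeight
  set S := ∑' j, logWeight j * |θ j| with hS
  have hS0 : 0 ≤ S := tsum_nonneg fun j =>
    mul_nonneg (zero_le_one.trans (hw j)) (abs_nonneg _)
  have hθS : ∀ j, |θ j| ≤ S := fun j =>
    (le_mul_of_one_le_left (abs_nonneg _) (hw j)).trans
      (hsumθ.le_tsum j fun i _ => mul_nonneg (zero_le_one.trans (hw i)) (abs_nonneg _))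
  set V := S + 1 with hV
  have hV0 : 0 ≤ V := by linarith
  obtain ⟨K, hK, hweak⟩ := eventually_weak D hlam0 hCl (fun j => (hlam j).2) hη hη1 hη5 hcb hCb.le
    (Ct := Ct) (G := 1 + 2 * (A * (1 + V))) (by positivity)
  have htail := tail_weight_mul_weakBound D hη hη3 hη2 hK.le (δ := 1 / 2) (by norm_num)
  obtain ⟨K', hK'⟩ := tail_sq_weakBound D (K := K) hη hη3 hη4
  set A₀ := A * (1 + V) * (q + 2) with hA₀
  set c₅ := cb ^ D * ct with hc₅
  have hc₅0 : 0 < c₅ := by positivity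
  set A₃ := A₀ + (2 + γ * q) / c₅ with hA₃
  have hA₀0 : 0 < A₀ := by positivity
  have hA₃c : 2 + γ * q ≤ c₅ * A₃ := by
    rw [hA₃, mul_add, mul_div_cancel₀ _ hc₅0.ne']
    exact le_add_of_nonneg_left (by positivity)
  have hγq : 0 ≤ γ * q := by positivity
  have hstrong := eventually_strong D (q := q) hc hcb hct hC (by linarith : 0 ≤ γ)
    (show 1 ≤ c₅ * A₃ by linarith) (by linarith : 2 + γ * q ≤ 2 * (c₅ * A₃)) S
  have hheadsum := (tendsto_log_mul_rpow_neg (C * A₀)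
    (show 1 / (p + 1) - 1 / 2 < 0 by
      rw [sub_neg, div_lt_div_iff₀ hp1 two_pos]; linarith)).eventually_lt_const
    (show (0 : ℝ) < 1 / 2 by norm_num)
  refine ⟨C * (4 * A₃ ^ 2) + 2 * C + 2 * |K'| + 1, by positivity, ?_⟩
  filter_upwards [hweak, htail, hstrong, hheadsum, eventually_log_le C q, eventually_ge_atTop 3]
    with n hweak htail hstrong hheadsum hlog hn b₀ T a b β g hb1 hb2 hT1 hT2 h
  have hn0 : (0 : ℝ) < n := Nat.cast_pos.2 (by omega)
  have hlog1 : 1 ≤ Real.log n := by simpa using one_le_log_mul_succ hn 0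
  have hb0 : 0 < b₀ := lt_of_lt_of_le (by positivity) hb1
  have hT0 : 0 ≤ T := le_trans (by positivity) hT1
  obtain ⟨s, hcard, hsj, hsc, hsθ, hsθ'⟩ := hhead n (by omega)
  obtain ⟨htU, htU'⟩ := htail s fun j hj => (hsc j hj).1
  obtain ⟨htU2, htU2'⟩ := hK' n (by omega) s fun j hj => (hsc j hj).1
  have hθfl : ∀ j ∉ s, |θ j| ≤ fluct n j := fun j hj =>
    (hsc j hj).2.trans (rpow_neg_half_le_fluct hn j)
  have hwk := fun j hj => hweak b₀ T hT0 hb1 hb2 hT2 j (hsc j hj).1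
  have hdev := h.deviation_lt hA.le hlam0 hb0 (T := T) hV0 s hθfl (fun j hj => (hwk j hj).1)
    (fun j hj => (hwk j hj).2) hsumθ htU (by
      have : ∑ j ∈ s, logWeight j * (A * (1 + V) * fluct n j) ≤
          C * A₀ * Real.log n * (n : ℝ) ^ (1 / (p + 1) - 1 / 2) := by
        calc ∑ j ∈ s, logWeight j * (A * (1 + V) * fluct n j)
            ≤ ∑ _j ∈ s, A₀ * Real.log n * (n : ℝ) ^ (-(1 / 2) : ℝ) := by
              refine Finset.sum_le_sum fun j hj => ?_
              have := mul_le_mul_of_nonneg_left (hlog j (hsj j hj)).2.1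
                (show 0 ≤ A * (1 + V) by positivity)
              calc _ = A * (1 + V) * (logWeight j * fluct n j) := by ring
                _ ≤ _ := this
                _ = _ := by rw [hA₀]; ring
          _ = s.card * (A₀ * Real.log n * (n : ℝ) ^ (-(1 / 2) : ℝ)) := by
              rw [Finset.sum_const, nsmul_eq_mul]
          _ ≤ C * (n : ℝ) ^ (1 / (p + 1)) * (A₀ * Real.log n * (n : ℝ) ^ (-(1 / 2) : ℝ)) := by
              gcongr
          _ = _ := by
              rw [sub_eq_add_neg, Real.rpow_add hn0]
              ring
      linarith)
  set τ := A₃ * Real.log n * (n : ℝ) ^ (-(1 / 2) : ℝ) with hτ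
  have hA₃0 : 0 < A₃ := by positivity
  have hτ0 : 0 < τ := by positivity
  obtain ⟨hst1, hst2⟩ := hstrong b₀ T hb1 hT1
  have hs_err : ∀ j ∈ s, (θ j - a j T * b j T ^ D * β j T) ^ 2 ≤ 4 * τ ^ 2 := by
    intro j hj
    have hle : A * (1 + V) * fluct n j ≤ τ := by
      calc A * (1 + V) * fluct n j
          ≤ A * (1 + V) * ((q + 2) * Real.log n * (n : ℝ) ^ (-(1 / 2) : ℝ)) :=
            mul_le_mul_of_nonneg_left (hlog j (hsj j hj)).2.2 (by positivity)
        _ = A₀ * Real.log n * (n : ℝ) ^ (-(1 / 2) : ℝ) := by rw [hA₀]; ring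
        _ ≤ A₃ * Real.log n * (n : ℝ) ^ (-(1 / 2) : ℝ) := by
            have : A₀ ≤ A₃ := le_add_of_nonneg_right (by positivity)
            gcongr
    have h1 := (h.flow j).abs_coeff_sub_le_of_strong (hlam0 j) hb0 hT0 hle hτ0
      (fun r hr => h.abs_signal_sub_le hA.le hr.1 (hdev r ⟨hr.1, hr.2.le⟩) j) hst1
      ((hθS j).trans (hst2 j _ (hsj j hj) (hlam j).1))
    calc _ = |θ j - a j T * b j T ^ D * β j T| ^ 2 := (sq_abs _).symm
      _ ≤ (2 * τ) ^ 2 := by gcongr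
      _ = _ := by ring
  have hs_tail : ∀ j ∉ s, (θ j - a j T * b j T ^ D * β j T) ^ 2 ≤
      2 * θ j ^ 2 + 2 * weakBound D γ η K n j ^ 2 := by
    intro j hj
    exact sub_sq_le_two_mul_add ((h.abs_coeff_le hA.le hlam0 hb0 hT0 le_rfl hV0
      (fun r hr => hdev r ⟨hr.1, hr.2.le⟩) (hθfl j hj) (hwk j hj).1).trans (hwk j hj).2)
  set R := (n : ℝ) ^ (-(p / (p + 1))) with hR
  have hR0 : 0 < R := by positivity
  have hmain : s.card * (4 * τ ^ 2) ≤ C * (4 * A₃ ^ 2) * (Real.log n ^ 2 * R) := by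
    calc (s.card : ℝ) * (4 * τ ^ 2) ≤ C * (n : ℝ) ^ (1 / (p + 1)) * (4 * τ ^ 2) := by gcongr
      _ = C * (4 * A₃ ^ 2) * (Real.log n ^ 2 *
          ((n : ℝ) ^ (1 / (p + 1)) * ((n : ℝ) ^ (-(1 / 2) : ℝ)) ^ 2)) := by rw [hτ]; ring
      _ = _ := by
          rw [← Real.rpow_mul_natCast hn0.le, ← Real.rpow_add hn0, hR]
          congr 4
          push_cast
          field_simp
          ring
  have hRlog : R ≤ Real.log n ^ 2 * R := le_mul_of_one_le_left hR0.le (one_le_pow₀ hlog1)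
  calc _ ≤ _ := tsum_le_of_head_tail (fun j => sq_nonneg _) hs_err hs_tail hsθ htU2
    _ ≤ C * (4 * A₃ ^ 2) * (Real.log n ^ 2 * R) + 2 * (C * R) + 2 * (|K'| * R) := by
        have : K' * R ≤ |K'| * R := by gcongr; exact le_abs_self _
        gcongr
        exact htU2'.trans this
    _ ≤ C * (4 * A₃ ^ 2) * (Real.log n ^ 2 * R) + 2 * (C * (Real.log n ^ 2 * R)) +
        2 * (|K'| * (Real.log n ^ 2 * R)) + Real.log n ^ 2 * R := by
        have : 0 ≤ Real.log n ^ 2 * R := by positivity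
        refine (add_le_add (add_le_add le_rfl ?_) ?_).trans (le_add_of_nonneg_right this)
        all_goals gcongr
    _ = _ := by ring

/-! ### The gradient flow as a driven family -/

theorem continuous_tsum_mul_abs_sub {m θ : ℕ → ℝ} {R : ℝ≥0} (hm0 : ∀ k, 0 ≤ m k)
    (hmR : ∀ k, m k ≤ R) (hθ : Summable fun k => |θ k|) :
    Continuous fun u : lp (fun _ : ℕ => ℝ) 1 => ∑' k, m k * |θ k - u k| := by
  have hs : ∀ u : lp (fun _ : ℕ => ℝ) 1, Summable fun k => m k * |θ k - u k| := fun u =>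
    Summable.of_nonneg_of_le (fun k => mul_nonneg (hm0 k) (abs_nonneg _))
      (fun k => mul_le_mul (hmR k) (abs_sub (θ k) (u k)) (abs_nonneg _) R.2)
      ((hθ.add (summable_abs_of_lp_one u)).mul_left (R : ℝ))
  refine (LipschitzWith.of_le_add_mul R fun u v => ?_).continuous
  have h1 : Summable fun k => (R : ℝ) * |(u - v) k| := (summable_abs_of_lp_one (u - v)).mul_left _
  rw [dist_eq_norm, norm_lp_one, ← tsum_mul_left, ← (hs v).tsum_add h1]
  refine (hs u).tsum_le_tsum (fun k => ?_) ((hs v).add h1)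
  have h2 : |θ k - u k| ≤ |θ k - v k| + |(u - v) k| := by
    have := abs_sub (θ k - v k) ((u - v) k)
    rwa [lp.coeFn_sub, Pi.sub_apply, show θ k - v k - (u k - v k) = θ k - u k by ring] at this
  calc m k * |θ k - u k| ≤ m k * (|θ k - v k| + |(u - v) k|) :=
        mul_le_mul_of_nonneg_left h2 (hm0 k)
    _ ≤ _ := by
        rw [mul_add]
        exact add_le_add le_rfl (mul_le_mul_of_nonneg_right (hmR k) (abs_nonneg _))

theorem continuousOn_deviation (D : ℕ) {θ : ℕ → ℝ} (n : ℕ) (hθ : Summable fun k => |θ k|)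
    {a : ℝ → SeqTwo} {b : ℝ → SeqTop} {β : ℝ → SeqTwo} {s : Set ℝ} (ha : ContinuousOn a s)
    (hb : ContinuousOn b s) (hβ : ContinuousOn β s) :
    ContinuousOn (deviation D θ n (fun j t => a t j) (fun j t => b t j) (fun j t => β t j)) s := by
  have h1 : ContinuousOn (fun t => mulOne (mulTwo (b t ^ D) (a t)) (β t)) s :=
    (mulOne.continuous.comp_continuousOn
      ((mulTwo.continuous.comp_continuousOn (hb.pow D)).clm_apply ha)).clm_apply hβ
  refine ((continuous_tsum_mul_abs_sub (m := fun k => min (logWeight k) √n) (R := NNReal.sqrt n)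
    (fun k => le_min (zero_le_one.trans (one_le_logWeight k)) (Real.sqrt_nonneg _))
    (fun k => (min_le_right _ _).trans (by simp)) hθ).comp_continuousOn h1).congr fun t _ => ?_
  refine tsum_congr fun k => ?_
  simp [lp.infty_coeFn_pow, mul_comm]

section Correlation

variable {X : Type*} {e : ℕ → X → ℝ} {n : ℕ} {x : Fin n → X} {C : ℝ}

theorem signal_eq_tsum (hC : ∀ i j, |e j (x i)| ≤ C) {y ε : Fin n → ℝ} {θ c : ℕ → ℝ}
    (hθ : Summable fun k => |θ k|) (hc : Summable fun k => |c k|) {f : X → ℝ}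
    (hy : ∀ i, y i = ∑' k, θ k * e k (x i) + ε i) (hf : ∀ i, f (x i) = ∑' k, c k * e k (x i))
    (j : ℕ) :
    HasSum (fun k => (θ k - c k) * (1 / (n : ℝ) * ∑ i, e j (x i) * e k (x i)))
      (signal e x y f j - 1 / (n : ℝ) * ∑ i, ε i * e j (x i)) := by
  have h1 : ∀ i, HasSum (fun k => (θ k - c k) * e k (x i) * e j (x i))
      ((y i - ε i - f (x i)) * e j (x i)) := by
    intro i
    rw [hy, hf, add_sub_cancel_right]
    refine HasSum.mul_right _ ?_
    refine ((summable_expansion hθ (hC i)).hasSum.sub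
      (summable_expansion hc (hC i)).hasSum).congr_fun ?_
    intro k
    ring
  have h2 := (hasSum_sum fun i (_ : i ∈ Finset.univ) => h1 i).mul_left (1 / (n : ℝ))
  have h3 : signal e x y f j - 1 / (n : ℝ) * ∑ i, ε i * e j (x i) =
      1 / (n : ℝ) * ∑ i, (y i - ε i - f (x i)) * e j (x i) := by
    rw [signal, ← mul_sub, ← Finset.sum_sub_distrib]
    congr 1
    exact Finset.sum_congr rfl fun i _ => by ring
  rw [h3]
  refine h2.congr_fun fun k => ?_
  rw [mul_left_comm, Finset.mul_sum]
  congr 1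
  exact Finset.sum_congr rfl fun i _ => by ring

theorem GoodSample.abs_gram_sub_le {A : ℝ} {ε : Fin n → ℝ} (h : GoodSample e A x ε) (hA : 0 ≤ A)
    (hC : ∀ i j, |e j (x i)| ≤ C) (hn : 3 ≤ n) (j k : ℕ) :
    |1 / (n : ℝ) * ∑ i, e j (x i) * e k (x i) - if j = k then 1 else 0| ≤
      (A + C ^ 2 + 1) * fluct n j * min (logWeight k) √n := by
  have hn0 : (0 : ℝ) < n := Nat.cast_pos.2 (by omega)
  have hL := one_le_log_mul_succ hn j
  have hfl := fluct_nonneg n j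
  have hk0 : 0 ≤ Real.log ((k : ℝ) + 1) := log_succ_nonneg k
  have hw := one_le_logWeight k
  rcases min_cases (logWeight k) √(n : ℝ) with ⟨hmin, -⟩ | ⟨hmin, -⟩
  · rw [hmin]
    have h1 : √(Real.log (n * ((j : ℝ) + 1) * ((k : ℝ) + 1)) / n) ≤ fluct n j * logWeight k := by
      rw [fluct, logWeight, ← Real.sqrt_mul (by positivity)]
      refine Real.sqrt_le_sqrt ?_
      rw [Real.log_mul (by positivity) (by positivity), div_mul_eq_mul_div]
      refine div_le_div_of_nonneg_right ?_ hn0.le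
      nlinarith
    calc _ ≤ A * √(Real.log (n * ((j : ℝ) + 1) * ((k : ℝ) + 1)) / n) := h.1 j k
      _ ≤ A * (fluct n j * logWeight k) := by gcongr
      _ ≤ (A + C ^ 2 + 1) * (fluct n j * logWeight k) := by
          refine mul_le_mul_of_nonneg_right ?_ (by positivity)
          linarith [sq_nonneg C]
      _ = _ := by ring
  · rw [hmin]
    have h1 : 1 ≤ fluct n j * √n := by
      rw [fluct, ← Real.sqrt_mul (by positivity), div_mul_cancel₀ _ hn0.ne', Real.one_le_sqrt]
      exact hL
    have h2 : |1 / (n : ℝ) * ∑ i, e j (x i) * e k (x i)| ≤ C ^ 2 := by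
      rw [abs_mul, abs_of_nonneg (by positivity), one_div_mul_eq_div, div_le_iff₀ hn0]
      calc |∑ i, e j (x i) * e k (x i)| ≤ ∑ i, |e j (x i) * e k (x i)| :=
            Finset.abs_sum_le_sum_abs _ _
        _ ≤ ∑ _i : Fin n, C ^ 2 := by
            refine Finset.sum_le_sum fun i _ => ?_
            rw [abs_mul, sq]
            exact mul_le_mul (hC i j) (hC i k) (abs_nonneg _) ((abs_nonneg _).trans (hC i j))
        _ = _ := by simp [mul_comm]
    have h3 : |if j = k then (1 : ℝ) else 0| ≤ 1 := by
      split_ifs <;> simp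
    calc _ ≤ C ^ 2 + 1 := (abs_sub _ _).trans (add_le_add h2 h3)
      _ ≤ (A + C ^ 2 + 1) * 1 := by linarith
      _ ≤ (A + C ^ 2 + 1) * (fluct n j * √n) := by gcongr
      _ = _ := by ring

theorem IsGradientFlow.drivenFamily {lam : ℕ → ℝ} {D : ℕ} {b₀ : ℝ} {y ε : Fin n → ℝ}
    {a : ℝ → SeqTwo} {b : ℝ → SeqTop} {β : ℝ → SeqTwo} (h : IsGradientFlow e lam D b₀ x y a b β)
    {A : ℝ} (hA : 0 ≤ A) (hgood : GoodSample e A x ε) (hC : ∀ i j, |e j (x i)| ≤ C) (hn : 3 ≤ n)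
    {θ : ℕ → ℝ} (hθ : Summable fun k => |θ k|) (hy : ∀ i, y i = ∑' k, θ k * e k (x i) + ε i) :
    DrivenFamily D lam θ (A + C ^ 2 + 1) n b₀ (fun j t => a t j) (fun j t => b t j)
      (fun j t => β t j) (fun j t => signal e x y (predictor e D (a t) (b t) (β t)) j) where
  flow := h.scalarFlow hC
  cont := continuousOn_deviation D n hθ h.cont_a h.cont_b h.cont_β
  pert t _ j := by
    have hc := summable_abs_coeff (D := D) (a t) (b t) (β t)
    have h1 := signal_eq_tsum hC hθ hc hy
      (fun i => tsum_congr fun k => (by ring : a t k * b t k ^ D * e k (x i) * β t k =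
        a t k * b t k ^ D * β t k * e k (x i))) j (f := predictor e D (a t) (b t) (β t))
    have h2 : HasSum (fun k => (θ k - a t k * b t k ^ D * β t k) * if j = k then 1 else 0)
        (θ j - a t j * b t j ^ D * β t j) := by
      convert hasSum_ite_eq j (θ j - a t j * b t j ^ D * β t j) using 2 with k
      by_cases hk : k = j
      · subst hk; simp
      · simp [hk, Ne.symm hk]
    have h3 := h1.sub h2
    set w : ℕ → ℝ := fun k => min (logWeight k) √n
    set r : ℕ → ℝ := fun k => θ k - a t k * b t k ^ D * β t k
    have hw0 : ∀ k, 0 ≤ w k := fun k =>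
      le_min (zero_le_one.trans (one_le_logWeight k)) (Real.sqrt_nonneg _)
    have hsum : Summable fun k => w k * |r k| :=
      Summable.of_nonneg_of_le (fun k => mul_nonneg (hw0 k) (abs_nonneg _))
        (fun k => mul_le_mul (min_le_right _ _) (abs_sub (θ k) (a t k * b t k ^ D * β t k))
          (abs_nonneg _) (Real.sqrt_nonneg _)) ((hθ.add hc).mul_left √(n : ℝ))
    set A' := A + C ^ 2 + 1 with hA'
    have h4 : |signal e x y (predictor e D (a t) (b t) (β t)) j -
        1 / (n : ℝ) * ∑ i, ε i * e j (x i) - r j| ≤ A' * fluct n j * ∑' k, w k * |r k| := by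
      rw [← tsum_mul_left, ← h3.tsum_eq, ← Real.norm_eq_abs]
      refine tsum_of_norm_bounded (hsum.mul_left _).hasSum fun k => ?_
      rw [← mul_sub, norm_mul, mul_comm (w k), mul_left_comm]
      exact mul_le_mul_of_nonneg_left (hgood.abs_gram_sub_le hA hC hn j k) (abs_nonneg _)
    have h5 : |1 / (n : ℝ) * ∑ i, ε i * e j (x i)| ≤ A' * fluct n j :=
      (hgood.2 j).trans (mul_le_mul_of_nonneg_right (by rw [hA']; nlinarith) (fluct_nonneg n j))
    calc |signal e x y (predictor e D (a t) (b t) (β t)) j - r j|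
        = |(signal e x y (predictor e D (a t) (b t) (β t)) j -
          1 / (n : ℝ) * ∑ i, ε i * e j (x i) - r j) + 1 / (n : ℝ) * ∑ i, ε i * e j (x i)| := by
          congr 1
          ring
      _ ≤ _ := abs_add_le _ _
      _ ≤ A' * fluct n j * ∑' k, w k * |r k| + A' * fluct n j := add_le_add h4 h5
      _ = A' * fluct n j * (1 + ∑' k, w k * |r k|) := by ring

end Correlation

/-- Without extra layers the parameters `b` play no role. -/
theorem DrivenFamily.change_b {lam θ : ℕ → ℝ} {A : ℝ} {n : ℕ} {b₀ : ℝ} {a b β g : ℕ → ℝ → ℝ}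
    (h : DrivenFamily 0 lam θ A n b₀ a b β g) (b₁ : ℝ) :
    DrivenFamily 0 lam θ A n b₁ a (fun _ _ => b₁) β g where
  flow j := (h.flow j).change_b b₁
  cont := by
    have h1 : deviation 0 θ n a (fun _ _ => b₁) β = deviation 0 θ n a b β := by
      ext t
      simp [deviation]
    exact h1 ▸ h.cont
  pert t ht j := by
    have h1 := h.pert t ht j
    simp only [deviation, pow_zero] at h1 ⊢
    exact h1

theorem eventually_tsum_sq_le_of_sameOrder (D : ℕ) {lam θ : ℕ → ℝ} {γ p q A : ℝ} (hγ1 : 1 < γ)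
    (hlam : SameOrder ⊤ lam (fun j => ((j : ℝ) + 1) ^ (-γ))) (hp : 1 < p) (hq : 1 ≤ q)
    (hmis : Misaligned θ p q) (hγ : (p + 1) / ((D : ℝ) + 2) < γ) (hA : 0 < A) {b₀ t : ℕ → ℝ}
    (hb : D ≠ 0 → SameOrder atTop b₀ (fun n => (n : ℝ) ^ (-(1 / (2 * ((D : ℝ) + 2))))))
    (ht : SameOrder atTop t (fun n => (n : ℝ) ^ (((D : ℝ) + 1) / ((D : ℝ) + 2)))) :
    ∃ M > 0, ∀ᶠ n : ℕ in atTop, ∀ a b β g : ℕ → ℝ → ℝ,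
      DrivenFamily D lam θ A n (b₀ n) a b β g →
      ∑' j, (θ j - a j (t n) * b j (t n) ^ D * β j (t n)) ^ 2 ≤
        M * (Real.log n ^ 2 * (n : ℝ) ^ (-(p / (p + 1)))) := by
  obtain ⟨ct, hct, Ct, -, ht⟩ := ht
  rcases eq_or_ne D 0 with rfl | hD
  · obtain ⟨M, hM, h⟩ := eventually_tsum_sq_le 0 hγ1 hlam hp hq hmis hγ hA one_pos one_pos hct
      (Ct := Ct)
    refine ⟨M, hM, ?_⟩
    filter_upwards [h, ht] with n hn htn a b β g hdr
    simpa using hn _ (t n) _ _ _ _ (one_mul _).le (one_mul _).ge htn.1 htn.2 (hdr.change_b _)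
  · obtain ⟨cb, hcb, Cb, hCb, hb⟩ := hb hD
    obtain ⟨M, hM, h⟩ := eventually_tsum_sq_le D hγ1 hlam hp hq hmis hγ hA hcb hCb hct (Ct := Ct)
    refine ⟨M, hM, ?_⟩
    filter_upwards [h, ht, hb] with n hn htn hbn a b β g hdr
    exact hn _ _ _ _ _ _ hbn.1 hbn.2 htn.1 htn.2 hdr

end AdaptiveKernel

theorem mainTheorem4
    {X : Type*} [MeasurableSpace X] (μ : Measure X) [IsProbabilityMeasure μ]
    (e : ℕ → X → ℝ) (lam : ℕ → ℝ) (γ : ℝ) (hE : AdaptiveKernel.EigenSystem μ e lam γ)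
    (fstar : X → ℝ) (hf : MemLp fstar 2 μ)
    (p q : ℝ) (hp : 0 < p) (hq : 1 ≤ q)
    (hmis : AdaptiveKernel.Misaligned (AdaptiveKernel.coeff μ e fstar) p q)
    (hfast : AdaptiveKernel.FastDecay (AdaptiveKernel.coeff μ e fstar))
    (κ : Kernel X ℝ) [IsMarkovKernel κ] (σ : ℝ≥0)
    (hκ : AdaptiveKernel.IsSubGaussianNoise μ κ σ)
    {Ω : Type*} [MeasurableSpace Ω] (P : Measure Ω) [IsProbabilityMeasure P]
    (x : ℕ → Ω → X) (ε : ℕ → Ω → ℝ) (hS : AdaptiveKernel.IsSample P μ κ x ε)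
    (y : ℕ → Ω → ℝ) (hy : ∀ i ω, y i ω = fstar (x i ω) + ε i ω)
    (D : ℕ) (hγ : (p + 1) / ((D : ℝ) + 2) < γ)
    (b₀ t : ℕ → ℝ)
    (hb : D ≠ 0 → AdaptiveKernel.SameOrder atTop b₀
      (fun n => (n : ℝ) ^ (-(1 / (2 * ((D : ℝ) + 2))))))
    (ht : AdaptiveKernel.SameOrder atTop t
      (fun n => (n : ℝ) ^ (((D : ℝ) + 1) / ((D : ℝ) + 2)))) :
    (∀ n : ℕ, ∀ᵐ ω ∂P, ∃ f : X → ℝ,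
      AdaptiveKernel.IsEstimator e lam D (b₀ n) (t n)
        (fun i : Fin n => x i ω) (fun i : Fin n => y i ω) f) ∧
    ∀ fhat : ℕ → Ω → X → ℝ,
      (∀ n : ℕ, ∀ᵐ ω ∂P, AdaptiveKernel.IsEstimator e lam D (b₀ n) (t n)
        (fun i : Fin n => x i ω) (fun i : Fin n => y i ω) (fhat n ω)) →
      AdaptiveKernel.IsTildeBigOP P
        (fun n ω => eLpNorm (fun z => fstar z - fhat n ω z) 2 μ ^ 2)
        (fun n => (n : ℝ) ^ (-(p / (p + 1)))) := by
  open AdaptiveKernel in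
  obtain ⟨B, hB⟩ := hE.basis
  obtain ⟨C, hC⟩ := hE.bounded
  have hγ1 := hE.one_lt
  set θ := coeff μ e fstar with hθdef
  have hp1 : 1 < p := one_lt_of_misaligned hp hmis hfast
  have hθ : Summable fun j => |θ j| :=
    Summable.of_nonneg_of_le (fun j => abs_nonneg _)
      (fun j => le_mul_of_one_le_left (abs_nonneg _) (one_le_logWeight j))
      (summable_logWeight_mul_abs hp1 hq hmis)
  have hCx : ∀ᵐ ω ∂P, ∀ i j, |e j (x i ω)| ≤ C := hS.ae_forall (ae_all_iff.2 hC)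
  refine ⟨fun n => ?_, fun fhat hfhat => ?_⟩
  · obtain ⟨c, hc, Cl, -, hlam⟩ := hE.decay
    rw [eventually_top] at hlam
    have hlam0 : ∀ j, 0 < lam j := fun j => lt_of_lt_of_le (by positivity) (hlam j).1
    have hlams : Summable lam := by
      have h1 := (summable_succ_rpow (η := γ - 1) (by linarith)).mul_left Cl
      refine Summable.of_nonneg_of_le (fun j => (hlam0 j).le) (fun j => (hlam j).2) ?_
      simpa using h1
    filter_upwards [hCx] with ω hω
    obtain ⟨a, b, β, h⟩ := exists_isGradientFlow hlam0 hlams D (b₀ n) (fun i : Fin n => x i ω)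
      (fun i : Fin n => y i ω) (C := C) fun i j => hω i j
    exact ⟨_, a, b, β, h, rfl⟩
  · obtain ⟨A, hA, K, hK⟩ := measure_not_goodSample_le hκ hS
      (fun j => (Lp.aestronglyMeasurable (B j)).congr (hB j)) (C := C.toNNReal)
      (fun j => (hC j).mono fun z hz => hz.trans (Real.le_coe_toNNReal C))
      (integral_mul_of_basis B hB)
    have hfx : ∀ᵐ ω ∂P, ∀ i, fstar (x i ω) = ∑' k, θ k * e k (x i ω) :=
      hS.ae_forall (ae_eq_tsum_coeff B hB hC hf hθ)
    obtain ⟨M, hM, hrate⟩ := eventually_tsum_sq_le_of_sameOrder D hγ1 hE.decay hp1 hq hmis hγ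
      (show 0 < A + C ^ 2 + 1 by positivity) hb ht
    refine ⟨2, fun δ hδ => ⟨M, hM, ?_⟩⟩
    have hlim : Tendsto (fun n : ℕ => K / (n : ℝ) ^ 2) atTop (𝓝 0) :=
      tendsto_const_nhds.div_atTop
        ((tendsto_pow_atTop two_ne_zero).comp tendsto_natCast_atTop_atTop)
    filter_upwards [hrate, hlim.eventually_le_const hδ, eventually_ge_atTop 3] with n hn hKn hn3
    refine (measure_mono_ae ?_).trans ((hK n (by omega)).trans (ENNReal.ofReal_le_ofReal hKn))
    filter_upwards [hCx, hfx, hfhat n] with ω hω1 hω2 ⟨a, b, β, hflow, hfeq⟩ hbad hgood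
    refine not_le.2 hbad ?_
    have hdr := hflow.drivenFamily hA.le hgood (fun i j => hω1 i j) hn3 hθ
      fun i => by rw [hy, hω2]
    have hpred : fhat n ω = fun z =>
        ∑' j, a (t n) j * b (t n) j ^ D * β (t n) j * e j z := by
      rw [hfeq]
      ext z
      exact tsum_congr fun j => by ring
    simp only [hpred]
    rw [eLpNorm_sub_tsum_sq B hB hC hf (summable_abs_coeff _ _ _)]
    exact ENNReal.ofReal_le_ofReal (hn _ _ _ _ hdr)
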